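/- Let $K$ be a number field of degree $n$ with ring of integers $R$, let $q$ be a prime, $R_q=R/qR$, and $\sigma>0$. Let $\iota:K\to\mathbb R^n$ be the adjusted canonical embedding, with one coordinate $\varphi(x)$ for each real embedding $\varphi$ and two coordinates $\sqrt2\,\mathrm{Re}\,\varphi(x)$, $\sqrt2\,\mathrm{Im}\,\varphi(x)$ for each pair $\varphi,\overline\varphi$ of complex embeddings. The error distribution gives $x\in R$ a probability proportional to $\exp(-\|\iota(x)\|^2/2\sigma^2)$. For $s\in R_q$, an RLWE sample with secret $s$ is a pair $(a,\,as+e)\in R_q\times R_q$, where $a\in R_q$ is uniform and $e$ is drawn from the error distribution and reduced modulo $qR$. Search RLWE is the problem of finding $s$ (an arbitrary element of $R_q$) given access to arbitrarily many independent RLWE samples with secret $s$. A (randomized) test $D$ taking $m$ pairs from $R_q\times R_q$ solves decision RLWE with advantage $\varepsilon$ if $$\bigl|\Pr[D \text{ accepts } m \text{ independent RLWE samples with a common uniformly random secret}]-\Pr[D\text{ accepts } m\text{ independent uniform elements of }R_q\times R_q]\bigr|\ \ge\ \varepsilon .$$ Reductions are finite programs, independent of the instance, which use registers holding natural numbers (constants,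 addition, truncated subtraction, test for zero, repetition of a block as often as a register says) and arrays of elements of $R_q$ indexed by registers. The following operations count as one step each, as does each operation on registers and each iteration of a repetition: writing $0$ or $1$ to an array entry; addition, subtraction, multiplication and test for zero in $R_q$; evaluating on an element of $R_q$ the $k$-th automorphism of $K$, in an arbitrary fixed numbering of the $n$ automorphisms; drawing a uniform element of $R_q$; drawing a fresh RLWE sample with secret $s$; calling the decision oracle $D$ on $m$ pairs read from two arrays. **Theorem (search-to-decision).** There are one program $P$ and one constant $c$ such that the following holds for every number field $K$ that is Galois over $\mathbb Q$, of degree $n$, every prime $q$ unramified in $K$, of any residue degree $f$, every numbering of $\mathrm{Gal}(K/\mathbb Q)$, every $\sigma>0$, all natural numbers $m$, $\ell\ge1$, $\kappa$, and every test $D$ that solves decision RLWE for $(K,q,\sigma)$ with $m$ samples and advantage $1/\ell$. For every secret $s\in R_q$, the program $P$, started on the numbers $n,q,f,m,\ell,\kappa$ with access to RLWE samples with secret $s$ and to the oracle $D$, outputs $s$ with probability at least $1-2^{-\kappa}$, and always makes at most $c\,(n+q^f+m+\ell+\kappa)^c$ steps. That is, there is a probabilistic reduction from search RLWE to decision RLWE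 that runs in time polynomial in $n$, in the norm $q^f$ of the primes above $q$, in the number of samples and the inverse advantage of the decision oracle, and in the security parameter $\kappa$. -/

import Mathlib

open scoped NumberField ENNReal

noncomputable section

namespace RLWE

section Instances

open scoped Classical in
/-- The adjusted canonical embedding `ι : K → ℝⁿ`: one coordinate `σ(x)` for each real embedding,
and the two coordinates `√2 Re σ(x)`, `√2 Im σ(x)` for each pair of complex conjugate embeddings. -/
def adjustedEmbedding (K : Type*) [Field K] [NumberField K] (x : K) :
    EuclideanSpace ℝ ({w : NumberField.InfinitePlace K // w.IsReal} ⊕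
      ({w : NumberField.InfinitePlace K // w.IsComplex} × Fin 2)) :=
  WithLp.toLp 2 (Sum.elim (fun w => (w.1.embedding x).re)
    (fun p => Real.sqrt 2 * ![(p.1.1.embedding x).re, (p.1.1.embedding x).im] p.2))

/-- The Gaussian function `exp (-‖v‖² / (2σ²))` on a Euclidean space. -/
def gaussian {ι : Type*} [Fintype ι] (σ : ℝ) (v : EuclideanSpace ℝ ι) : ℝ :=
  Real.exp (-‖v‖ ^ 2 / (2 * σ ^ 2))

open scoped Classical in
open NumberField in
theorem norm_mixedEmbedding_le (K : Type*) [Field K] [NumberField K] (x : K) :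
    ‖mixedEmbedding K x‖ ≤ ‖adjustedEmbedding K x‖ := by
  have hc : ∀ i, |adjustedEmbedding K x i| ≤ ‖adjustedEmbedding K x‖ := fun i => by
    simpa using PiLp.norm_apply_le (adjustedEmbedding K x) i
  rw [Prod.norm_def]
  refine max_le ((pi_norm_le_iff_of_nonneg (norm_nonneg _)).2 fun w => ?_)
    ((pi_norm_le_iff_of_nonneg (norm_nonneg _)).2 fun w => ?_)
  · have h := hc (Sum.inl w)
    have e : (w.1.embedding x).re = InfinitePlace.embedding_of_isReal w.2 x := by
      rw [← InfinitePlace.embedding_of_isReal_apply w.2 x, Complex.ofReal_re]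
    simp only [adjustedEmbedding, Sum.elim_inl] at h ⊢
    rw [e] at h
    simpa [mixedEmbedding.mixedEmbedding_apply_isReal] using h
  · rw [mixedEmbedding.mixedEmbedding_apply_isComplex]
    refine abs_le_of_sq_le_sq' ?_ (norm_nonneg _) |>.2
    rw [← Complex.normSq_eq_norm_sq, Complex.normSq_apply, EuclideanSpace.norm_sq_eq]
    have hle : ∑ j : Fin 2, ‖adjustedEmbedding K x (Sum.inr (w, j))‖ ^ 2 ≤
        ∑ i, ‖adjustedEmbedding K x i‖ ^ 2 := by
      rw [Fintype.sum_sum_type, Fintype.sum_prod_type]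
      have h1 : ∑ j : Fin 2, ‖adjustedEmbedding K x (Sum.inr (w, j))‖ ^ 2 ≤
          ∑ w', ∑ j : Fin 2, ‖adjustedEmbedding K x (Sum.inr (w', j))‖ ^ 2 :=
        Finset.single_le_sum
          (f := fun w' => ∑ j : Fin 2, ‖adjustedEmbedding K x (Sum.inr (w', j))‖ ^ 2)
          (fun _ _ => Finset.sum_nonneg fun _ _ => sq_nonneg _) (Finset.mem_univ w)
      have h2 : 0 ≤ ∑ v, ‖adjustedEmbedding K x (Sum.inl v)‖ ^ 2 :=
        Finset.sum_nonneg fun _ _ => sq_nonneg _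
      linarith
    refine le_trans ?_ hle
    rw [Fin.sum_univ_two]
    simp only [adjustedEmbedding, Sum.elim_inr, Real.norm_eq_abs, sq_abs, mul_pow,
      Real.sq_sqrt (show (0 : ℝ) ≤ 2 by norm_num), Matrix.cons_val_zero, Matrix.cons_val_one]
    nlinarith [sq_nonneg (w.1.embedding x).re, sq_nonneg (w.1.embedding x).im]

open scoped Classical in
open NumberField in
theorem summable_gaussian (K : Type*) [Field K] [NumberField K] {σ : ℝ} (hσ : 0 < σ) :
    Summable fun x : 𝓞 K => gaussian σ (adjustedEmbedding K (x : K)) := by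
  let L := (mixedEmbedding.integerLattice K)
  let j : 𝓞 K → L := fun x => ⟨mixedEmbedding K x, ⟨x, rfl⟩⟩
  have hj : Function.Injective j := fun x y h => by
    have := congrArg Subtype.val h
    exact RingOfIntegers.ext (mixedEmbedding_injective K this)
  have hs : Summable fun z : L => Real.exp (-‖(z : mixedEmbedding.mixedSpace K)‖ ^ 2 / (2 * σ ^ 2)) := by
    let k := Module.finrank ℤ L + 1
    have h0 := (ZLattice.summable_norm_pow_inv L (2 * k) (by omega)).mul_left
      ((k.factorial : ℝ) * (2 * σ ^ 2) ^ k)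
    refine Summable.of_norm_bounded_eventually h0 ?_
    have : ∀ᶠ z : L in Filter.cofinite, z ≠ 0 := by
      rw [Filter.eventually_cofinite]
      simp
    filter_upwards [this] with z hz
    have hz' : 0 < ‖z‖ := norm_pos_iff.2 hz
    have hy : 0 < ‖z‖ ^ 2 / (2 * σ ^ 2) := by positivity
    have hp := Real.pow_div_factorial_le_exp _ hy.le k
    rw [Real.norm_eq_abs, abs_of_pos (Real.exp_pos _)]
    have e1 : -‖(z : mixedEmbedding.mixedSpace K)‖ ^ 2 / (2 * σ ^ 2) = -(‖z‖ ^ 2 / (2 * σ ^ 2)) := by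
      rw [Submodule.coe_norm]; ring
    rw [e1, Real.exp_neg]
    have hpos : 0 < (‖z‖ ^ 2 / (2 * σ ^ 2)) ^ k / k.factorial := by positivity
    refine (inv_anti₀ hpos hp).trans_eq ?_
    rw [pow_mul, inv_pow, inv_div, div_pow, inv_pow, div_div_eq_mul_div, mul_div_assoc, div_eq_mul_inv,
      mul_assoc]
  refine Summable.of_nonneg_of_le (fun _ => (Real.exp_pos _).le) (fun x => ?_)
    (hs.comp_injective hj)
  simp only [gaussian, Function.comp_apply, j]
  refine Real.exp_le_exp.2 ?_
  have := norm_mixedEmbedding_le K (x : K)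
  have h2 : ‖mixedEmbedding K (x : K)‖ ^ 2 ≤ ‖adjustedEmbedding K (x : K)‖ ^ 2 := by gcongr
  gcongr

open scoped Classical in
/-- The error distribution: the discrete Gaussian distribution with parameter `σ` on the lattice
`ι(R)`, `R = 𝓞 K`, regarded as a distribution on `R` itself. -/
def errorDist (K : Type*) [Field K] [NumberField K] (σ : ℝ) (hσ : 0 < σ) : PMF (𝓞 K) :=
  PMF.normalize (fun x : 𝓞 K => ENNReal.ofReal (gaussian σ (adjustedEmbedding K (x : K))))
    (by
      refine ENNReal.tsum_eq_zero.not.2 fun h => ?_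
      have := h 0
      rw [ENNReal.ofReal_eq_zero] at this
      exact absurd (Real.exp_pos _) (not_lt.2 this))
    (by
      have h := ENNReal.ofReal_tsum_of_nonneg (f := fun x : 𝓞 K =>
        gaussian σ (adjustedEmbedding K (x : K))) (fun _ => (Real.exp_pos _).le)
        (summable_gaussian K hσ)
      rw [← h]
      exact ENNReal.ofReal_ne_top)

/-- `R_q = R / qR`, where `R = 𝓞 K`. -/
abbrev Rq (K : Type*) [Field K] [NumberField K] (q : ℕ) : Type _ :=
  𝓞 K ⧸ Ideal.span {(q : 𝓞 K)}

instance finiteRq (K : Type*) [Field K] [NumberField K] (q : ℕ) [hq : Fact q.Prime] :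
    Finite (Rq K q) := by
  refine Ideal.finiteQuotientOfFreeOfNeBot _ ?_
  rw [Ne, Ideal.span_singleton_eq_bot]
  exact_mod_cast hq.out.ne_zero

instance fintypeRq (K : Type*) [Field K] [NumberField K] (q : ℕ) [Fact q.Prime] :
    Fintype (Rq K q) :=
  Fintype.ofFinite _

/-- The RLWE distribution of `(K, q, σ, s)`: a pair `(a, a s + e)` with `a` uniform in `R_q`
and `e` drawn from the error distribution and reduced modulo `qR`. -/
def rlweDist (K : Type*) [Field K] [NumberField K] (q : ℕ) [Fact q.Prime] (σ : ℝ) (hσ : 0 < σ)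
    (s : Rq K q) : PMF (Rq K q × Rq K q) :=
  (PMF.uniformOfFintype (Rq K q)).bind fun a =>
    (errorDist K σ hσ).map fun e => (a, a * s + Ideal.Quotient.mk _ e)

/-- `m` independent samples from `p`. -/
def iid {α : Type*} (p : PMF α) : (m : ℕ) → PMF (Fin m → α)
  | 0 => PMF.pure Fin.elim0
  | m + 1 => p.bind fun x => (iid p m).map fun v => Fin.cons x v

/-- The advantage of the (randomized) test `D` in distinguishing `m` independent RLWE samples with a
uniformly random secret from `m` independent uniform samples of `R_q × R_q`. -/
def decisionAdvantage (K : Type*) [Field K] [NumberField K] (q : ℕ) [Fact q.Prime] (σ : ℝ)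
    (hσ : 0 < σ) (m : ℕ) (D : (Fin m → Rq K q × Rq K q) → PMF Bool) : ℝ :=
  |(((PMF.uniformOfFintype (Rq K q)).bind fun s =>
        (iid (rlweDist K q σ hσ s) m).bind D) true).toReal
    - (((iid (PMF.uniformOfFintype (Rq K q × Rq K q)) m).bind D) true).toReal|

/-- The rational prime `q` is unramified in `K`. -/
def Unramified (K : Type*) [Field K] [NumberField K] (q : ℕ) : Prop :=
  ∀ 𝔭 ∈ (Ideal.span {(q : ℤ)}).primesOver (𝓞 K), 𝔭.ramificationIdx ℤ = 1

/-- The action of a field automorphism on `R_q`. -/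
def galRq (K : Type*) [Field K] [NumberField K] (q : ℕ) (τ : K ≃ₐ[ℚ] K) :
    Rq K q →+* Rq K q :=
  Ideal.quotientMap (Ideal.span {(q : 𝓞 K)})
    (NumberField.RingOfIntegers.mapRingEquiv (τ : K ≃+* K)).toRingHom
    (by
      rw [Ideal.span_singleton_le_iff_mem, Ideal.mem_comap, map_natCast]
      exact Ideal.mem_span_singleton_self _)

end Instances

section Machine

/-- The address of a ring element: a fixed array, and a register that holds the index in it. -/
abbrev Cell : Type := ℕ × ℕ

/-- Programs. A program is a finite text that does not depend on the ring; it works on registers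
holding natural numbers and on arrays of ring elements. Each line below costs one step each time it
is executed (`loop` also costs one step per iteration). -/
inductive Program : Type
  /-- register `x` becomes the constant `k` -/
  | natConst (x k : ℕ)
  /-- register `x` becomes the sum of registers `y` and `z` -/
  | natAdd (x y z : ℕ)
  /-- register `x` becomes the difference of registers `y` and `z`, or `0` if it is negative -/
  | natSub (x y z : ℕ)
  /-- cell `x` becomes `0` -/
  | ringZero (x : Cell)
  /-- cell `x` becomes `1` -/
  | ringOne (x : Cell)
  /-- cell `x` becomes the sum of cells `y` and `z` -/
  | ringAdd (x y z : Cell)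
  /-- cell `x` becomes the difference of cells `y` and `z` -/
  | ringSub (x y z : Cell)
  /-- cell `x` becomes the product of cells `y` and `z` -/
  | ringMul (x y z : Cell)
  /-- cell `x` becomes the image of cell `y` under the automorphism whose number is in register
  `k` -/
  | ringAut (x : Cell) (k : ℕ) (y : Cell)
  /-- cell `x` becomes a fresh uniformly random ring element -/
  | ringRand (x : Cell)
  /-- a fresh sample `(a, b)` is requested; `a` is written to cell `x`, then `b` to cell `y` -/
  | sample (x y : Cell)
  /-- the decision oracle is called on the pairs `(Aᵢ, Bᵢ)`, `i < m`, of entries of the arrays `A`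
  and `B`; register `x` becomes `1` if it accepts and `0` if it rejects -/
  | oracle (x A B : ℕ)
  /-- first `c`, then `d` -/
  | seq (c d : Program)
  /-- `c` if register `x` is `0`, else `d` -/
  | ifNatZero (x : ℕ) (c d : Program)
  /-- `c` if cell `x` is `0`, else `d` -/
  | ifRingZero (x : Cell) (c d : Program)
  /-- `c` repeated as many times as the number that is in register `x` at the start -/
  | loop (x : ℕ) (c : Program)

/-- What a program has access to: the numbered automorphisms, the source of samples, and the
decision oracle with its number of samples. -/
structure Access (R : Type*) where
  aut : ℕ → R → R
  samples : PMF (R × R)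
  m : ℕ
  oracle : (Fin m → R × R) → PMF Bool

/-- The memory, and the number of steps made so far. -/
structure State (R : Type*) where
  nat : ℕ → ℕ
  ring : ℕ → ℕ → R
  steps : ℕ

namespace State

/-- Count one step. -/
def tick {R : Type*} (S : State R) : State R :=
  { S with steps := S.steps + 1 }

/-- Write to a register. -/
def setNat {R : Type*} (S : State R) (x v : ℕ) : State R :=
  { S with nat := Function.update S.nat x v }

/-- Read a cell. -/
def get {R : Type*} (S : State R) (x : Cell) : R :=
  S.ring x.1 (S.nat x.2)

/-- Write to a cell. -/
def set {R : Type*} (S : State R) (x : Cell) (v : R) : State R :=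
  { S with ring := Function.update S.ring x.1 (Function.update (S.ring x.1) (S.nat x.2) v) }

end State

open scoped Classical in
/-- The distribution of the final state of a program, run from a given state. -/
def Program.run {R : Type*} [CommRing R] [Fintype R] (E : Access R) :
    Program → State R → PMF (State R)
  | natConst x k, S => PMF.pure (S.tick.setNat x k)
  | natAdd x y z, S => PMF.pure (S.tick.setNat x (S.nat y + S.nat z))
  | natSub x y z, S => PMF.pure (S.tick.setNat x (S.nat y - S.nat z))
  | ringZero x, S => PMF.pure (S.tick.set x 0)
  | ringOne x, S => PMF.pure (S.tick.set x 1)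
  | ringAdd x y z, S => PMF.pure (S.tick.set x (S.get y + S.get z))
  | ringSub x y z, S => PMF.pure (S.tick.set x (S.get y - S.get z))
  | ringMul x y z, S => PMF.pure (S.tick.set x (S.get y * S.get z))
  | ringAut x k y, S => PMF.pure (S.tick.set x (E.aut (S.nat k) (S.get y)))
  | ringRand x, S => (PMF.uniformOfFintype R).map fun r => S.tick.set x r
  | sample x y, S => E.samples.map fun ab => (S.tick.set x ab.1).set y ab.2
  | oracle x A B, S => (E.oracle fun i => (S.ring A i, S.ring B i)).map fun t =>
      S.tick.setNat x (if t then 1 else 0)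
  | seq c d, S => (c.run E S).bind fun T => d.run E T
  | ifNatZero x c d, S => if S.nat x = 0 then c.run E S.tick else d.run E S.tick
  | ifRingZero x c d, S => if S.get x = 0 then c.run E S.tick else d.run E S.tick
  | loop x c, S => (fun p : PMF (State R) => p.bind fun T => c.run E T.tick)^[S.nat x]
      (PMF.pure S.tick)

/-- The initial state: the numbers of the list `inp` in the registers `0, 1, 2, …`, and `0` everywhere
else. -/
def State.init {R : Type*} [CommRing R] (inp : List ℕ) : State R where
  nat := fun x => inp.getD x 0
  ring := fun _ _ => 0
  steps := 0

/-- The output of a program: the ring element at index `0` of the array `0`. -/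
def State.output {R : Type*} (S : State R) : R :=
  S.ring 0 0

end Machine

/-- What a reduction from search RLWE to decision RLWE has access to: the automorphisms of `K`
acting on `R_q`, numbered from `0` to `n - 1` by `τ`, samples of the RLWE distribution with
the secret `s`, and the decision oracle `D`. -/
def access (K : Type*) [Field K] [NumberField K] (q : ℕ) [Fact q.Prime] (σ : ℝ) (hσ : 0 < σ)
    (τ : Fin (Module.finrank ℚ K) ≃ (K ≃ₐ[ℚ] K)) (m : ℕ)
    (D : (Fin m → Rq K q × Rq K q) → PMF Bool) (s : Rq K q) : Access (Rq K q) where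
  aut := fun k x => if hk : k < Module.finrank ℚ K then galRq K q (τ ⟨k, hk⟩) x else x
  samples := rlweDist K q σ hσ s
  m := m
  oracle := D

end RLWE

end

/-!
The reduction works in the decomposition of `R_q` as the product of the residue fields of the primes
above `q`, which has one component for each prime because `q` is unramified (`span_eq_iInf`,
`toResidues`). All residue fields have `Q = q ^ f` elements, and the Galois group permutes the
components transitively (`galRq_indicator`, `PrimesAbove.exists_map_eq`) and preserves the error
distribution (`errorDist_map_smul`). Everything else takes place in a ring with these properties,
which are collected in `Splitting`.

*Hybrids.* For an idempotent `E`, an LWE sample with second entry masked by a uniform multiple of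
`E` interpolates between an LWE sample, `E = 0`, and a uniform pair, `E = 1`. If the components are
masked one after the other, the acceptance probability of the oracle has to change noticeably at
some step (`exists_le_abs_sub`), say when the component `j` is added to the mask `t`.

*Testing a guess.* Let `d` be the idempotent of the component `j` and let `Y = d x` be a guess
for `d s`. From samples with secret `s` one makes samples with a uniformly random secret, masked in
the components of `t`, and adds `v (d, Y)` to them for a uniform `v`. If the guess is correct, this
is again the hybrid with mask `t`; if it is wrong, the error `Y - d s` is invertible in the
component `j`, and its random multiples mask this component too (`trial_true_of_eq`,
`trial_true_of_ne`). So the oracle tells correct guesses from wrong ones, and random guesses hit the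
right value among `Q` candidates.

*From one component to all.* If all samples are first mapped by an automorphism `τ`, they are samples
with secret `τ s`, by the invariance of the error distribution. The same test at the component `j`
now finds `d (τ s)`, and the inverse `τ ^ (n - 1)` of `τ` turns this into another component of `s`.
By transitivity each component is reached (`guessPhase_spec`).

*The idempotents.* The program cannot see the primes. But for random `x`, the element
`1 - x ^ (Q - 1)` is the idempotent of the components where `x` vanishes. Multiplying such random
idempotents, and skipping those that would make the product zero, leaves a single component with
overwhelming probability, because two given components are separated in one attempt with probability
at least `1 / Q ^ 2` (`splitPhase_spec`). The automorphisms carry this component to all others.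

*Probabilities.* Acceptance probabilities are estimated by counting, with the Chernoff bound
(`chernoff`, `estimate_spec`). All repetition counts are powers of `B = 8 + n + Q + ℓ + κ`; the
failure probabilities add up to at most `2 ^ (-κ)` (`total_failure_le`). As no loop count exceeds
a power of the parameters and the program has a fixed size and nesting depth, the running time is
polynomial (`reduction_steps`).
-/

namespace RLWE

/-! ### Expectations and failure probabilities -/

section Expectation

variable {α β : Type*}

/-- The expectation of a `[0, ∞]`-valued function under a discrete distribution. -/
noncomputable def expect (μ : PMF α) (φ : α → ℝ≥0∞) : ℝ≥0∞ := ∑' a, μ a * φ a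

open scoped Classical in
/-- The probability that `Φ` does not hold under `μ`. -/
noncomputable def failProb (μ : PMF α) (Φ : α → Prop) : ℝ≥0∞ :=
  expect μ fun a => if Φ a then 0 else 1

theorem expect_pure (a : α) (φ : α → ℝ≥0∞) : expect (PMF.pure a) φ = φ a := by
  classical
  rw [expect, tsum_eq_single a]
  · simp
  · intro b hb
    simp [PMF.pure_apply, hb]

theorem expect_bind (μ : PMF α) (ν : α → PMF β) (φ : β → ℝ≥0∞) :
    expect (μ.bind ν) φ = expect μ fun a => expect (ν a) φ := by
  simp only [expect, PMF.bind_apply, ← ENNReal.tsum_mul_left, ← ENNReal.tsum_mul_right]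
  rw [ENNReal.tsum_comm]
  simp only [mul_assoc]

theorem expect_map (μ : PMF α) (f : α → β) (φ : β → ℝ≥0∞) :
    expect (μ.map f) φ = expect μ fun a => φ (f a) := by
  rw [PMF.map, expect_bind]
  simp only [Function.comp, expect_pure]

theorem expect_mono {μ : PMF α} {φ ψ : α → ℝ≥0∞} (h : ∀ a ∈ μ.support, φ a ≤ ψ a) :
    expect μ φ ≤ expect μ ψ := by
  refine ENNReal.tsum_le_tsum fun a => ?_
  by_cases ha : a ∈ μ.support
  · exact mul_le_mul_right (h a ha) _
  · rw [PMF.mem_support_iff, not_not] at ha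
    simp [ha]

theorem expect_congr {μ : PMF α} {φ ψ : α → ℝ≥0∞} (h : ∀ a ∈ μ.support, φ a = ψ a) :
    expect μ φ = expect μ ψ :=
  le_antisymm (expect_mono fun a ha => (h a ha).le) (expect_mono fun a ha => (h a ha).ge)

theorem expect_const (μ : PMF α) (r : ℝ≥0∞) : expect μ (fun _ => r) = r := by
  rw [expect, ENNReal.tsum_mul_right, μ.tsum_coe, one_mul]

theorem expect_add (μ : PMF α) (φ ψ : α → ℝ≥0∞) :
    expect μ (fun a => φ a + ψ a) = expect μ φ + expect μ ψ := by
  simp only [expect, mul_add, ENNReal.tsum_add]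

theorem expect_mul_right (μ : PMF α) (φ : α → ℝ≥0∞) (r : ℝ≥0∞) :
    expect μ (fun a => φ a * r) = expect μ φ * r := by
  simp only [expect, ← mul_assoc, ENNReal.tsum_mul_right]

theorem expect_finset_sum {ι : Type*} (s : Finset ι) (μ : PMF α) (φ : ι → α → ℝ≥0∞) :
    expect μ (fun a => ∑ i ∈ s, φ i a) = ∑ i ∈ s, expect μ (φ i) := by
  classical
  induction s using Finset.induction_on with
  | empty => simp [expect_const]
  | insert i s hi ih => simp only [Finset.sum_insert hi, expect_add, ih]

theorem failProb_le_one (μ : PMF α) (Φ : α → Prop) : failProb μ Φ ≤ 1 := by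
  classical
  refine (expect_mono (ψ := fun _ => 1) fun a _ => ?_).trans (expect_const μ 1).le
  split_ifs <;> simp

theorem failProb_pure {a : α} {Φ : α → Prop} (h : Φ a) : failProb (PMF.pure a) Φ = 0 := by
  rw [failProb, expect_pure, if_pos h]

theorem failProb_map (μ : PMF α) (f : α → β) (Φ : β → Prop) :
    failProb (μ.map f) Φ = failProb μ fun a => Φ (f a) :=
  expect_map ..

theorem failProb_mono {μ : PMF α} {Φ Ψ : α → Prop} (h : ∀ a ∈ μ.support, Φ a → Ψ a) :
    failProb μ Ψ ≤ failProb μ Φ := by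
  classical
  refine expect_mono fun a ha => ?_
  have := h a ha
  split_ifs <;> simp_all

theorem failProb_eq_zero {μ : PMF α} {Φ : α → Prop} (h : ∀ a ∈ μ.support, Φ a) :
    failProb μ Φ = 0 := by
  rw [failProb, expect_congr (ψ := fun _ => 0) fun a ha => if_pos (h a ha), expect_const]

theorem failProb_and_le (μ : PMF α) (Φ Ψ : α → Prop) :
    failProb μ (fun a => Φ a ∧ Ψ a) ≤ failProb μ Φ + failProb μ Ψ := by
  classical
  rw [failProb, failProb, failProb, ← expect_add]
  refine expect_mono fun a _ => ?_
  split_ifs <;> simp_all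

theorem failProb_forall_le {ι : Type*} (s : Finset ι) (μ : PMF α) (Φ : ι → α → Prop) :
    failProb μ (fun a => ∀ i ∈ s, Φ i a) ≤ ∑ i ∈ s, failProb μ (Φ i) := by
  classical
  simp only [failProb]
  rw [← expect_finset_sum]
  refine expect_mono fun a _ => ?_
  split_ifs with h
  · exact zero_le
  · push Not at h
    obtain ⟨i, hi, hΦ⟩ := h
    refine le_trans ?_ (Finset.single_le_sum (f := fun i => if Φ i a then (0 : ℝ≥0∞) else 1)
      (fun _ _ => zero_le) hi)
    rw [if_neg hΦ]

/-- The union bound for two consecutive random choices. -/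
theorem failProb_bind_le {μ : PMF α} {ν : α → PMF β} {Φ : α → Prop} {Ψ : β → Prop}
    {δ ε : ℝ≥0∞} (h : failProb μ Φ ≤ δ)
    (h' : ∀ a ∈ μ.support, Φ a → failProb (ν a) Ψ ≤ ε) :
    failProb (μ.bind ν) Ψ ≤ δ + ε := by
  classical
  rw [failProb, expect_bind]
  calc _ ≤ expect μ (fun a => (if Φ a then 0 else 1) + ε) := by
        refine expect_mono fun a ha => ?_
        split_ifs with hΦ
        · simpa [failProb] using h' a ha hΦ
        · exact (failProb_le_one (ν a) Ψ).trans le_self_add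
    _ ≤ _ := by
        rw [expect_add, expect_const]
        exact add_le_add_left h ε

/-- If the first choice satisfies `Φ` with certainty, nothing is lost there. -/
theorem failProb_bind_le_of_forall {μ : PMF α} {ν : α → PMF β} {Ψ : β → Prop} {ε : ℝ≥0∞}
    (h : ∀ a ∈ μ.support, failProb (ν a) Ψ ≤ ε) : failProb (μ.bind ν) Ψ ≤ ε := by
  simpa using failProb_bind_le (Φ := fun _ => True) (δ := 0) (failProb_eq_zero fun _ _ => trivial).le
    fun a ha _ => h a ha

theorem one_sub_failProb_le_map_apply (μ : PMF α) (f : α → β) (b : β) :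
    1 - failProb μ (fun a => f a = b) ≤ (μ.map f) b := by
  classical
  have h : (μ.map f) b + failProb μ (fun a => f a = b) = 1 := by
    rw [PMF.map_apply, failProb, expect, ← ENNReal.tsum_add, ← μ.tsum_coe]
    refine tsum_congr fun a => ?_
    by_cases hb : f a = b
    · simp [hb]
    · simp [hb, Ne.symm hb]
  rw [← h]
  exact tsub_le_iff_right.2 le_rfl

theorem bind_congr_support {μ : PMF α} {ν ν' : α → PMF β} (h : ∀ a ∈ μ.support, ν a = ν' a) :
    μ.bind ν = μ.bind ν' := by
  ext b
  simp only [PMF.bind_apply]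
  refine tsum_congr fun a => ?_
  by_cases ha : a ∈ μ.support
  · rw [h a ha]
  · rw [PMF.mem_support_iff, not_not] at ha
    simp [ha]

theorem map_congr_support {μ : PMF α} {f g : α → β} (h : ∀ a ∈ μ.support, f a = g a) :
    μ.map f = μ.map g :=
  bind_congr_support fun a ha => by simp [h a ha]

end Expectation

/-! ### Repeated random steps -/

section Iterate

variable {α : Type*}

/-- The distribution after `k` steps of the Markov chain `g`, started at `a`. -/
noncomputable def iter (g : α → PMF α) : ℕ → α → PMF α
  | 0, a => PMF.pure a
  | k + 1, a => (g a).bind (iter g k)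

theorem iterate_bind_eq (g : α → PMF α) (k : ℕ) (μ : PMF α) :
    (fun p : PMF α => p.bind g)^[k] μ = μ.bind (iter g k) := by
  induction k generalizing μ with
  | zero => simp [iter]
  | succ k ih => rw [Function.iterate_succ_apply, ih, PMF.bind_bind]; rfl

theorem iter_invariant {g : α → PMF α} {I : ℕ → α → Prop} {k : ℕ}
    (h : ∀ j < k, ∀ a, I j a → ∀ b ∈ (g a).support, I (j + 1) b) {a : α} (ha : I 0 a) :
    ∀ b ∈ (iter g k a).support, I k b := by
  have key : ∀ i j, i + j = k → ∀ a, I i a → ∀ b ∈ (iter g j a).support, I k b := by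
    intro i j
    induction j generalizing i with
    | zero =>
      intro hk a ha b hb
      simp only [iter, PMF.mem_support_pure_iff] at hb
      rw [hb, ← hk]
      exact ha
    | succ j ih =>
      intro hk a ha b hb
      simp only [iter, PMF.mem_support_bind_iff] at hb
      obtain ⟨c, hc, hb⟩ := hb
      exact ih (i + 1) (by omega) c (h i (by omega) a ha c hc) b hb
  exact key 0 k (zero_add k) a ha

/-- The union bound for a loop with an invariant that each step maintains up to failure
probability `δ`. -/
theorem failProb_iter_le {g : α → PMF α} {I : ℕ → α → Prop} {k : ℕ} {δ : ℝ≥0∞}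
    (h : ∀ j < k, ∀ a, I j a → failProb (g a) (I (j + 1)) ≤ δ) {a : α} (ha : I 0 a) :
    failProb (iter g k a) (I k) ≤ k * δ := by
  have key : ∀ i j, i + j = k → ∀ a, I i a → failProb (iter g j a) (I k) ≤ j * δ := by
    intro i j
    induction j generalizing i with
    | zero =>
      intro hk a ha
      rw [add_zero] at hk
      subst hk
      simp [iter, failProb_pure ha]
    | succ j ih =>
      intro hk a ha
      refine (failProb_bind_le (h i (by omega) a ha)
        fun b _ hb => ih (i + 1) (by omega) b hb).trans_eq ?_
      push_cast
      ring
  exact key 0 k (zero_add k) a ha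

/-- A loop that tries to reach a goal: each step keeps the goal up to failure probability `δ`, and
misses it with probability at most `θ` from anywhere. -/
theorem failProb_iter_goal_le {g : α → PMF α} {I G : α → Prop} {δ θ : ℝ≥0∞}
    (hI : ∀ a, I a → ∀ b ∈ (g a).support, I b)
    (hG : ∀ a, I a → G a → failProb (g a) G ≤ δ)
    (hθ : ∀ a, I a → failProb (g a) G ≤ θ) (k : ℕ) {a : α} (ha : I a) :
    failProb (iter g k a) G ≤ k * δ + θ ^ k := by
  classical
  have keep : ∀ j a, I a → G a → failProb (iter g j a) G ≤ j * δ := by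
    intro j a ha hGa
    have := failProb_iter_le (g := g) (I := fun _ a => I a ∧ G a) (k := j) (δ := δ)
      (fun _ _ a h => (failProb_mono fun b hb hGb => ⟨hI a h.1 b hb, hGb⟩).trans (hG a h.1 h.2))
      ⟨ha, hGa⟩
    exact (failProb_mono fun b _ hb => hb.2).trans this
  induction k generalizing a with
  | zero => simpa using failProb_le_one _ _
  | succ k ih =>
    rw [iter, failProb, expect_bind]
    calc _ ≤ expect (g a) (fun b => k * δ + (if G b then 0 else 1) * θ ^ k) := by
          refine expect_mono fun b hb => ?_
          split_ifs with hGb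
          · simpa [failProb] using keep k b (hI a ha b hb) hGb
          · simpa [failProb] using ih (hI a ha b hb)
      _ = k * δ + failProb (g a) G * θ ^ k := by
          rw [expect_add, expect_const, expect_mul_right, failProb]
      _ ≤ _ := by
          rw [pow_succ']
          gcongr
          · simp
          · exact hθ a ha

end Iterate

/-! ### A Chernoff bound for counters -/

section Chernoff

variable {α : Type*}

theorem exp_le_one_add_add_sq {x : ℝ} (hx : |x| ≤ 1) : Real.exp x ≤ 1 + x + x ^ 2 := by
  have := (abs_le.1 (Real.abs_exp_sub_one_sub_id_le hx)).2
  linarith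

/-- The exponential moment of a counter that each step increases with probability `p`. -/
theorem expect_iter_counter {g : α → PMF α} {I : α → Prop} {cnt : α → ℕ} {p : ℝ≥0∞}
    (hI : ∀ a, I a → ∀ b ∈ (g a).support, I b)
    (hcnt : ∀ a, I a → ∀ w : ℕ → ℝ≥0∞,
      expect (g a) (fun b => w (cnt b)) = (1 - p) * w (cnt a) + p * w (cnt a + 1))
    (x : ℝ≥0∞) (k : ℕ) {a : α} (ha : I a) :
    expect (iter g k a) (fun b => x ^ cnt b) = (1 - p + p * x) ^ k * x ^ cnt a := by
  induction k generalizing a with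
  | zero => simp [iter, expect_pure]
  | succ k ih =>
    rw [iter, expect_bind, expect_congr fun b hb => ih (hI a ha b hb)]
    rw [hcnt a ha fun c => (1 - p + p * x) ^ k * x ^ c]
    ring

/-- One tail of the Chernoff bound, with the exponential parameter `l` of either sign. -/
theorem expect_tail_le {μ : PMF α} {cnt : α → ℕ} {p : ℝ} (hp0 : 0 ≤ p) (hp : p ≤ 1) {N : ℕ}
    (hμ : ∀ x : ℝ≥0∞, expect μ (fun b => x ^ cnt b) =
      (1 - ENNReal.ofReal p + ENNReal.ofReal p * x) ^ N)
    {l u : ℝ} (hl : |l| ≤ 1) :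
    failProb μ (fun b => l * (cnt b - N * p) < |l| * u) ≤
      ENNReal.ofReal (Real.exp (N * l ^ 2 - |l| * u)) := by
  classical
  set r := Real.exp (-(l * (N * p)) - |l| * u)
  calc failProb μ _ ≤ expect μ (fun b => ENNReal.ofReal (Real.exp l) ^ cnt b * ENNReal.ofReal r) := by
        refine expect_mono fun b _ => ?_
        split_ifs with h
        · exact zero_le
        · rw [← ENNReal.ofReal_pow (Real.exp_pos _).le, ← ENNReal.ofReal_mul (by positivity),
            ← Real.exp_nat_mul, ← Real.exp_add, ← ENNReal.ofReal_one]
          refine ENNReal.ofReal_le_ofReal (Real.one_le_exp ?_)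
          nlinarith
    _ = ENNReal.ofReal ((1 - p + p * Real.exp l) ^ N * r) := by
        have h0 : 0 ≤ 1 - p := by linarith
        rw [expect_mul_right, hμ, ENNReal.ofReal_mul (by positivity),
          ENNReal.ofReal_pow (by positivity), ENNReal.ofReal_add h0 (by positivity),
          ENNReal.ofReal_mul hp0, ENNReal.ofReal_sub _ hp0, ENNReal.ofReal_one]
    _ ≤ _ := by
        refine ENNReal.ofReal_le_ofReal ?_
        have h1 : 1 - p + p * Real.exp l ≤ Real.exp (p * l + l ^ 2) := by
          have h2 := exp_le_one_add_add_sq hl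
          have h3 := Real.add_one_le_exp (p * l + l ^ 2)
          nlinarith [sq_nonneg l]
        have h0 : 0 ≤ 1 - p + p * Real.exp l := by
          have : 0 ≤ 1 - p := by linarith
          positivity
        calc _ ≤ Real.exp (p * l + l ^ 2) ^ N * r := by gcongr
          _ = _ := by
            rw [← Real.exp_nat_mul, ← Real.exp_add]
            congr 1
            ring

/-- The Chernoff bound: a sum of `N` independent bits with mean `p` deviates from `N * p` by `u` or
more with probability at most `2 exp (-u² / 4N)`. -/
theorem chernoff {μ : PMF α} {cnt : α → ℕ} {p : ℝ} (hp0 : 0 ≤ p) (hp : p ≤ 1) {N : ℕ}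
    (hμ : ∀ x : ℝ≥0∞, expect μ (fun b => x ^ cnt b) =
      (1 - ENNReal.ofReal p + ENNReal.ofReal p * x) ^ N)
    {u : ℝ} (hu : 0 < u) (huN : u ≤ N) :
    failProb μ (fun b => |(cnt b : ℝ) - N * p| < u) ≤
      2 * ENNReal.ofReal (Real.exp (-(u ^ 2 / (4 * N)))) := by
  have hN : (0 : ℝ) < N := hu.trans_le huN
  set l : ℝ := u / (2 * N)
  have hl : 0 < l := by positivity
  have hl1 : l ≤ 1 := by
    rw [div_le_one (by positivity)]
    linarith
  have e : N * l ^ 2 - l * u = -(u ^ 2 / (4 * N)) := by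
    simp only [l]
    field_simp
    ring
  have h1 := expect_tail_le hp0 hp hμ (l := l) (u := u) (by rwa [abs_of_pos hl])
  have h2 := expect_tail_le hp0 hp hμ (l := -l) (u := u) (by rwa [abs_neg, abs_of_pos hl])
  rw [abs_neg, neg_sq] at h2
  rw [abs_of_pos hl, e] at h1 h2
  calc _ ≤ _ := failProb_mono (Φ := fun b => l * ((cnt b : ℝ) - N * p) < l * u ∧
          -l * ((cnt b : ℝ) - N * p) < l * u) fun b _ h => by
            rw [abs_lt]
            constructor <;> nlinarith [h.1, h.2]
    _ ≤ _ := failProb_and_le _ _ _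
    _ ≤ _ := by
        rw [two_mul]
        exact add_le_add h1 h2

end Chernoff

/-! ### Uniform distributions -/

section Uniform

variable {α β : Type*} [Fintype α] [Nonempty α] [Fintype β] [Nonempty β]

theorem map_uniform_of_card_fiber [DecidableEq β] (f : α → β) (c : ℕ)
    (h : ∀ b, (Finset.univ.filter fun a => f a = b).card = c) :
    (PMF.uniformOfFintype α).map f = PMF.uniformOfFintype β := by
  have hcard : Fintype.card α = Fintype.card β * c := by
    rw [← Finset.card_univ, Finset.card_eq_sum_card_fiberwise (f := f) (t := Finset.univ)
      fun _ _ => Finset.mem_coe.2 (Finset.mem_univ _)]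
    simp [h]
  have hα : (Fintype.card α : ℝ≥0∞) ≠ 0 := by simp
  have hc : (c : ℝ≥0∞) ≠ 0 := by
    rintro hc
    rw [Nat.cast_eq_zero] at hc
    rw [hc, mul_zero] at hcard
    simp [hcard] at hα
  ext b
  rw [PMF.map_apply, PMF.uniformOfFintype_apply, tsum_fintype]
  simp only [PMF.uniformOfFintype_apply, eq_comm (a := b)]
  rw [← Finset.sum_filter, Finset.sum_const, h, nsmul_eq_mul, hcard, Nat.cast_mul,
    ENNReal.mul_inv (by simp) (by simp), mul_left_comm, ENNReal.mul_inv_cancel hc (by simp), mul_one]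

/-- A surjective homomorphism of finite groups maps the uniform distribution to the uniform one. -/
theorem map_uniform_of_surjective {G H : Type*} [AddCommGroup G] [Fintype G] [AddCommGroup H]
    [Fintype H] (f : G →+ H) (hf : Function.Surjective f) :
    (PMF.uniformOfFintype G).map f = PMF.uniformOfFintype H := by
  classical
  refine map_uniform_of_card_fiber f (Finset.univ.filter fun a => f a = 0).card fun b => ?_
  obtain ⟨a, rfl⟩ := hf b
  refine Finset.card_bij' (fun x _ => x - a) (fun x _ => x + a) ?_ ?_ ?_ ?_ <;> simp [sub_eq_zero]

theorem map_uniform_of_bijective (f : α → β) (hf : Function.Bijective f) :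
    (PMF.uniformOfFintype α).map f = PMF.uniformOfFintype β := by
  classical
  refine map_uniform_of_card_fiber f 1 fun b => ?_
  obtain ⟨a, rfl⟩ := hf.2 b
  rw [Finset.card_eq_one]
  exact ⟨a, by ext x; simp [hf.1.eq_iff]⟩

theorem uniform_prod {γ : Type*} (F : α × β → PMF γ) :
    (PMF.uniformOfFintype (α × β)).bind F =
      (PMF.uniformOfFintype α).bind fun a => (PMF.uniformOfFintype β).bind fun b => F (a, b) := by
  ext c
  simp only [PMF.bind_apply, PMF.uniformOfFintype_apply, tsum_fintype, Fintype.sum_prod_type,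
    Finset.mul_sum, Fintype.card_prod, Nat.cast_mul]
  rw [ENNReal.mul_inv (by simp) (by simp)]
  simp only [mul_assoc]

/-- The probability that a uniform element misses a given value. -/
theorem failProb_uniform_eq (b : β) :
    failProb (PMF.uniformOfFintype β) (fun x => x = b) = 1 - (Fintype.card β : ℝ≥0∞)⁻¹ := by
  classical
  have h : (Fintype.card β : ℝ≥0∞)⁻¹ + failProb (PMF.uniformOfFintype β) (fun x => x = b) = 1 := by
    rw [failProb, ← (PMF.uniformOfFintype β).tsum_coe, ← PMF.uniformOfFintype_apply b, expect,
      ← tsum_ite_eq b (PMF.uniformOfFintype β), ← ENNReal.tsum_add]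
    refine tsum_congr fun x => ?_
    split_ifs with hx
    · simp
    · simp [PMF.uniformOfFintype_apply, ENNReal.mul_inv_cancel]
  rw [← h, ENNReal.add_sub_cancel_left (by simp)]

end Uniform

/-! ### Frame and cost of a program -/

namespace Program

/-- Whether the text of a program contains an instruction that writes to register `r`. -/
def writesNat : Program → ℕ → Bool
  | natConst x _, r => x == r
  | natAdd x _ _, r => x == r
  | natSub x _ _, r => x == r
  | ringZero _, _ => false
  | ringOne _, _ => false
  | ringAdd _ _ _, _ => false
  | ringSub _ _ _, _ => false
  | ringMul _ _ _, _ => false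
  | ringAut _ _ _, _ => false
  | ringRand _, _ => false
  | sample _ _, _ => false
  | oracle x _ _, r => x == r
  | seq c d, r => c.writesNat r || d.writesNat r
  | ifNatZero _ c d, r => c.writesNat r || d.writesNat r
  | ifRingZero _ c d, r => c.writesNat r || d.writesNat r
  | loop _ c, r => c.writesNat r

/-- Whether the text of a program contains an instruction that writes to the array `r`. -/
def writesRing : Program → ℕ → Bool
  | natConst _ _, _ => false
  | natAdd _ _ _, _ => false
  | natSub _ _ _, _ => false
  | ringZero x, r => x.1 == r
  | ringOne x, r => x.1 == r
  | ringAdd x _ _, r => x.1 == r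
  | ringSub x _ _, r => x.1 == r
  | ringMul x _ _, r => x.1 == r
  | ringAut x _ _, r => x.1 == r
  | ringRand x, r => x.1 == r
  | sample x y, r => x.1 == r || y.1 == r
  | oracle _ _ _, _ => false
  | seq c d, r => c.writesRing r || d.writesRing r
  | ifNatZero _ c d, r => c.writesRing r || d.writesRing r
  | ifRingZero _ c d, r => c.writesRing r || d.writesRing r
  | loop _ c, r => c.writesRing r

/-- The registers that hold the repetition counts of the loops of a program. -/
def loopRegs : Program → List ℕ
  | seq c d => c.loopRegs ++ d.loopRegs
  | ifNatZero _ c d => c.loopRegs ++ d.loopRegs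
  | ifRingZero _ c d => c.loopRegs ++ d.loopRegs
  | loop x c => x :: c.loopRegs
  | _ => []

/-- A bound for the number of steps of a program whose loop registers keep the values `ρ`. -/
def cost (ρ : ℕ → ℕ) : Program → ℕ
  | seq c d => c.cost ρ + d.cost ρ
  | ifNatZero _ c d => 1 + (c.cost ρ + d.cost ρ)
  | ifRingZero _ c d => 1 + (c.cost ρ + d.cost ρ)
  | loop x c => 1 + ρ x * (1 + c.cost ρ)
  | _ => 1

variable {R : Type*} [CommRing R] [Fintype R] (E : Access R)

theorem run_seq (c d : Program) (S : State R) :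
    (seq c d).run E S = (c.run E S).bind fun T => d.run E T := rfl

theorem run_loop (x : ℕ) (c : Program) (S : State R) :
    (loop x c).run E S = iter (fun T => c.run E T.tick) (S.nat x) S.tick := by
  rw [run, iterate_bind_eq, PMF.pure_bind]

theorem nat_eq_of_writesNat {c : Program} {r : ℕ} (h : c.writesNat r = false) {S T : State R}
    (hT : T ∈ (c.run E S).support) : T.nat r = S.nat r := by
  induction c generalizing S T with
  | seq c d hc hd =>
    simp only [writesNat, Bool.or_eq_false_iff] at h
    simp only [run_seq, PMF.mem_support_bind_iff] at hT
    obtain ⟨U, hU, hT⟩ := hT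
    rw [hd h.2 hT, hc h.1 hU]
  | ifNatZero x c d hc hd =>
    simp only [writesNat, Bool.or_eq_false_iff] at h
    rw [run] at hT
    split_ifs at hT
    · exact hc (S := S.tick) h.1 hT
    · exact hd (S := S.tick) h.2 hT
  | ifRingZero x c d hc hd =>
    simp only [writesNat, Bool.or_eq_false_iff] at h
    rw [run] at hT
    split_ifs at hT
    · exact hc (S := S.tick) h.1 hT
    · exact hd (S := S.tick) h.2 hT
  | loop x c hc =>
    rw [run_loop] at hT
    exact iter_invariant (I := fun _ T => T.nat r = S.nat r)
      (fun _ _ U hU V hV => (hc h hV).trans hU) rfl T hT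
  | sample x y =>
    simp only [run, PMF.support_map] at hT
    obtain ⟨v, -, rfl⟩ := hT
    rfl
  | ringRand x =>
    simp only [run, PMF.support_map] at hT
    obtain ⟨v, -, rfl⟩ := hT
    rfl
  | oracle x A B =>
    simp only [run, PMF.support_map] at hT
    obtain ⟨v, -, rfl⟩ := hT
    simp only [writesNat, beq_eq_false_iff_ne] at h
    exact Function.update_of_ne h.symm _ _
  | _ =>
    simp only [run, PMF.mem_support_pure_iff] at hT
    subst hT
    first
    | rfl
    | simp only [writesNat, beq_eq_false_iff_ne] at h
      exact Function.update_of_ne h.symm _ _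

theorem ring_eq_of_writesRing {c : Program} {r : ℕ} (h : c.writesRing r = false) {S T : State R}
    (hT : T ∈ (c.run E S).support) : T.ring r = S.ring r := by
  induction c generalizing S T with
  | seq c d hc hd =>
    simp only [writesRing, Bool.or_eq_false_iff] at h
    simp only [run_seq, PMF.mem_support_bind_iff] at hT
    obtain ⟨U, hU, hT⟩ := hT
    rw [hd h.2 hT, hc h.1 hU]
  | ifNatZero x c d hc hd =>
    simp only [writesRing, Bool.or_eq_false_iff] at h
    rw [run] at hT
    split_ifs at hT
    · exact hc (S := S.tick) h.1 hT
    · exact hd (S := S.tick) h.2 hT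
  | ifRingZero x c d hc hd =>
    simp only [writesRing, Bool.or_eq_false_iff] at h
    rw [run] at hT
    split_ifs at hT
    · exact hc (S := S.tick) h.1 hT
    · exact hd (S := S.tick) h.2 hT
  | loop x c hc =>
    rw [run_loop] at hT
    exact iter_invariant (I := fun _ T => T.ring r = S.ring r)
      (fun _ _ U hU V hV => (hc h hV).trans hU) rfl T hT
  | sample x y =>
    simp only [run, PMF.support_map] at hT
    obtain ⟨v, -, rfl⟩ := hT
    simp only [writesRing, Bool.or_eq_false_iff, beq_eq_false_iff_ne] at h
    exact (Function.update_of_ne h.2.symm _ _).trans (Function.update_of_ne h.1.symm _ _)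
  | ringRand x =>
    simp only [run, PMF.support_map] at hT
    obtain ⟨v, -, rfl⟩ := hT
    simp only [writesRing, beq_eq_false_iff_ne] at h
    exact Function.update_of_ne h.symm _ _
  | oracle x A B =>
    simp only [run, PMF.support_map] at hT
    obtain ⟨v, -, rfl⟩ := hT
    rfl
  | _ =>
    simp only [run, PMF.mem_support_pure_iff] at hT
    subst hT
    first
    | rfl
    | simp only [writesRing, beq_eq_false_iff_ne] at h
      exact Function.update_of_ne h.symm _ _

/-- If a program never writes to its loop registers, its number of steps is bounded by `cost`. -/
theorem steps_le {c : Program} (ρ : ℕ → ℕ) (hc : ∀ r ∈ c.loopRegs, c.writesNat r = false)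
    {S T : State R} (hS : ∀ r ∈ c.loopRegs, S.nat r = ρ r) (hT : T ∈ (c.run E S).support) :
    T.steps ≤ S.steps + c.cost ρ := by
  induction c generalizing S T with
  | seq c d ihc ihd =>
    simp only [loopRegs, List.mem_append, writesNat, Bool.or_eq_false_iff] at hc hS
    simp only [run_seq, PMF.mem_support_bind_iff] at hT
    obtain ⟨U, hU, hT⟩ := hT
    have h1 := ihc (fun r hr => (hc r (.inl hr)).1) (fun r hr => hS r (.inl hr)) hU
    have h2 := ihd (fun r hr => (hc r (.inr hr)).2)
      (fun r hr => (nat_eq_of_writesNat E (hc r (.inr hr)).1 hU).trans (hS r (.inr hr))) hT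
    simp only [cost]
    omega
  | ifNatZero x c d ihc ihd =>
    simp only [loopRegs, List.mem_append, writesNat, Bool.or_eq_false_iff] at hc hS
    rw [run] at hT
    have h1 := ihc (S := S.tick) (T := T) (fun r hr => (hc r (.inl hr)).1)
      (fun r hr => hS r (.inl hr))
    have h2 := ihd (S := S.tick) (T := T) (fun r hr => (hc r (.inr hr)).2)
      (fun r hr => hS r (.inr hr))
    simp only [cost, State.tick] at h1 h2 ⊢
    split_ifs at hT
    · have := h1 hT
      omega
    · have := h2 hT
      omega
  | ifRingZero x c d ihc ihd =>
    simp only [loopRegs, List.mem_append, writesNat, Bool.or_eq_false_iff] at hc hS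
    rw [run] at hT
    have h1 := ihc (S := S.tick) (T := T) (fun r hr => (hc r (.inl hr)).1)
      (fun r hr => hS r (.inl hr))
    have h2 := ihd (S := S.tick) (T := T) (fun r hr => (hc r (.inr hr)).2)
      (fun r hr => hS r (.inr hr))
    simp only [cost, State.tick] at h1 h2 ⊢
    split_ifs at hT
    · have := h1 hT
      omega
    · have := h2 hT
      omega
  | loop x c ihc =>
    simp only [loopRegs, List.mem_cons, writesNat] at hc hS
    rw [run_loop] at hT
    have h := iter_invariant (a := S.tick) (k := S.nat x) (g := fun T => c.run E T.tick)
      (I := fun j T => (∀ r ∈ c.loopRegs, T.nat r = ρ r) ∧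
        T.steps ≤ S.steps + 1 + j * (1 + c.cost ρ)) ?_
      ⟨fun r hr => hS r (.inr hr), by simp [State.tick]⟩ T hT
    · rw [hS x (.inl rfl)] at h
      simp only [cost]
      have := h.2
      omega
    · intro j _ U hU V hV
      refine ⟨fun r hr => (nat_eq_of_writesNat E (hc r (.inr hr)) hV).trans (hU.1 r hr), ?_⟩
      have := ihc (S := U.tick) (fun r hr => hc r (.inr hr)) (fun r hr => hU.1 r hr) hV
      have h2 := hU.2
      simp only [State.tick] at this
      have e : (j + 1) * (1 + c.cost ρ) = j * (1 + c.cost ρ) + (1 + c.cost ρ) := by ring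
      omega
  | sample x y =>
    simp only [run, PMF.support_map] at hT
    obtain ⟨v, -, rfl⟩ := hT
    exact le_rfl
  | ringRand x =>
    simp only [run, PMF.support_map] at hT
    obtain ⟨v, -, rfl⟩ := hT
    exact le_rfl
  | oracle x A B =>
    simp only [run, PMF.support_map] at hT
    obtain ⟨v, -, rfl⟩ := hT
    exact le_rfl
  | _ =>
    simp only [run, PMF.mem_support_pure_iff] at hT
    subst hT
    exact le_rfl

end Program

/-! ### Hybrid distributions -/

section Hybrid

variable {R : Type*} [CommRing R] [Fintype R]

/-- The distribution of a pair `(a, a s + e)` with `a` uniform and `e` drawn from `χ`. -/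
noncomputable def lwe (χ : PMF R) (s : R) : PMF (R × R) :=
  (PMF.uniformOfFintype R).bind fun a => χ.map fun e => (a, a * s + e)

/-- The hybrid distribution: an LWE sample whose second entry is masked by a uniform multiple
of `E`. For an idempotent `E`, this makes it uniform in the components of the ring where `E` is one,
and leaves it unchanged in the others. -/
noncomputable def hybrid (χ : PMF R) (E s : R) : PMF (R × R) :=
  (PMF.uniformOfFintype R).bind fun a => (PMF.uniformOfFintype R).bind fun w =>
    χ.map fun e => (a, a * s + e + w * E)

/-- The probability that a test accepts `m` samples of the hybrid distribution with a common
uniformly random secret. -/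
noncomputable def acceptProb (χ : PMF R) {m : ℕ} (D : (Fin m → R × R) → PMF Bool) (E : R) : ℝ≥0∞ :=
  ((PMF.uniformOfFintype R).bind fun s => (iid (hybrid χ E s) m).bind D) true

theorem hybrid_zero (χ : PMF R) (s : R) : hybrid χ 0 s = lwe χ s := by
  simp only [hybrid, lwe, mul_zero, add_zero, PMF.bind_const]

theorem hybrid_one (χ : PMF R) (s : R) : hybrid χ 1 s = PMF.uniformOfFintype (R × R) := by
  rw [← PMF.bind_pure (PMF.uniformOfFintype (R × R)), uniform_prod, hybrid]
  congr 1
  ext1 a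
  simp only [PMF.map, Function.comp_def]
  rw [PMF.bind_comm]
  refine (bind_congr_support fun e _ => ?_).trans (PMF.bind_const χ _)
  conv_rhs => rw [← map_uniform_of_bijective (fun w : R => a * s + e + w * 1) (by
    simpa using AddGroup.addLeft_bijective (a * s + e)), PMF.bind_map]
  rfl

/-- Randomizing the secret and injecting a guess: from an LWE sample with secret `s`, a new
secret `s + t`, an element `D` and a guess `Y` for `D * s`. -/
noncomputable def transformed (χ : PMF R) (E D Y t s : R) : PMF (R × R) :=
  (lwe χ s).bind fun p => (PMF.uniformOfFintype R).bind fun v =>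
    (PMF.uniformOfFintype R).map fun u =>
      (p.1 + v * D, p.2 + p.1 * t + v * (D * t + Y) + u * E)

/-- The transformed samples follow a hybrid distribution with mask `E'` as soon as the error
`v * (Y - D * s) + u * E` that the transformation introduces is of the form `w * E'` with `w` a
unimodular combination of `u` and `v`. -/
theorem transformed_eq_hybrid (χ : PMF R) {E D Y s E' α β α' β' : R} (hα : α * E' = Y - D * s)
    (hβ : β * E' = E) (h : α * α' + β * β' = 1) (t : R) :
    transformed χ E D Y t s = hybrid χ E' (s + t) := by
  let f : R × R × R →+ R × R :=
    { toFun := fun x => (x.1 + x.2.1 * D, x.2.1 * α + x.2.2 * β)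
      map_zero' := by simp
      map_add' := fun x y => by ext <;> simp <;> ring }
  have hf : Function.Surjective f := fun y => by
    refine ⟨(y.1 - α' * y.2 * D, α' * y.2, β' * y.2), ?_⟩
    ext
    · simp [f]
    · change α' * y.2 * α + β' * y.2 * β = y.2
      linear_combination y.2 * h
  have hl : transformed χ E D Y t s = χ.bind fun e =>
      (PMF.uniformOfFintype (R × R × R)).bind fun x =>
        PMF.pure ((f x).1, (f x).1 * (s + t) + e + (f x).2 * E') := by
    simp only [transformed, lwe, PMF.map, PMF.bind_bind, PMF.pure_bind, Function.comp_def]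
    rw [PMF.bind_comm]
    congr 1
    ext1 e
    simp only [uniform_prod]
    congr 1
    ext1 a
    congr 1
    ext1 v
    congr 1
    ext1 u
    congr 2
    change _ = (a + v * D) * (s + t) + e + (v * α + u * β) * E'
    linear_combination (-v) * hα - u * hβ
  have hr : hybrid χ E' (s + t) = χ.bind fun e =>
      (PMF.uniformOfFintype (R × R)).bind fun x =>
        PMF.pure (x.1, x.1 * (s + t) + e + x.2 * E') := by
    simp only [hybrid, uniform_prod, PMF.map, Function.comp_def]
    rw [PMF.bind_comm χ]
    congr 1
    ext1 a
    rw [PMF.bind_comm]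
  rw [hl, hr, ← map_uniform_of_surjective f hf]
  simp only [PMF.bind_map, Function.comp_def]

/-- An automorphism that preserves the error distribution maps samples with secret `s` to samples
with secret `f s`. -/
theorem lwe_map {χ : PMF R} (f : R →+* R) (hf : Function.Bijective f) (hχ : χ.map f = χ) (s : R) :
    (lwe χ s).map (fun p => (f p.1, f p.2)) = lwe χ (f s) := by
  simp only [lwe, PMF.map_bind, PMF.map_comp, Function.comp_def, map_add, map_mul]
  conv_rhs => rw [← map_uniform_of_bijective f hf, PMF.bind_map]
  congr 1
  ext1 a
  conv_rhs => rw [← hχ]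
  rw [Function.comp_apply, PMF.map_comp]
  rfl

/-- A test applied to transformed samples for a uniformly random shift `t` of the secret. -/
noncomputable def trial (χ : PMF R) {m : ℕ} (D : (Fin m → R × R) → PMF Bool) (E d Y s : R) :
    PMF Bool :=
  (PMF.uniformOfFintype R).bind fun t => (iid (transformed χ E d Y t s) m).bind D

/-- Since the shift `t` makes the secret `s + t` uniform, a test of transformed samples accepts as
often as for a random secret. -/
theorem trial_true (χ : PMF R) {m : ℕ} (D : (Fin m → R × R) → PMF Bool)
    {E d Y s E' α β α' β' : R} (hα : α * E' = Y - d * s)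
    (hβ : β * E' = E) (h : α * α' + β * β' = 1) :
    trial χ D E d Y s true = acceptProb χ D E' := by
  rw [trial, acceptProb]
  conv_rhs => rw [← map_uniform_of_bijective (fun t => s + t) (AddGroup.addLeft_bijective s),
    PMF.bind_map]
  simp only [transformed_eq_hybrid χ hα hβ h, Function.comp_def]

/-- A correct guess leaves the hybrid unchanged. -/
theorem trial_true_of_eq (χ : PMF R) {m : ℕ} (D : (Fin m → R × R) → PMF Bool) {E d Y s : R}
    (h : Y = d * s) : trial χ D E d Y s true = acceptProb χ D E :=
  trial_true χ D (α := 0) (β := 1) (α' := 0) (β' := 1) (by simp [h]) (by simp) (by simp)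

end Hybrid

/-! ### Idempotents of a finite product of fields -/

section Idempotents

variable {R : Type*} [CommRing R] {ι : Type*} [DecidableEq ι] {F : ι → Type*}
  [∀ i, Field (F i)] (φ : R ≃+* ∀ i, F i)

/-- The idempotent of a product of fields that is one in the components of the set `s`. -/
def indicator (s : Finset ι) : R := φ.symm fun i => if i ∈ s then 1 else 0

theorem apply_indicator (s : Finset ι) (i : ι) :
    φ (indicator φ s) i = if i ∈ s then 1 else 0 := by
  simp [indicator]

theorem indicator_injective : Function.Injective (indicator φ) := fun s t h => by
  ext i
  have := congrFun (congrArg φ h) i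
  rw [apply_indicator, apply_indicator] at this
  by_cases hs : i ∈ s <;> by_cases ht : i ∈ t <;> simp_all

theorem indicator_empty : indicator φ ∅ = 0 := by
  apply φ.injective
  ext i
  simp [apply_indicator]

theorem indicator_univ [Fintype ι] : indicator φ Finset.univ = 1 := by
  apply φ.injective
  ext i
  simp [apply_indicator]

theorem indicator_eq_zero {s : Finset ι} : indicator φ s = 0 ↔ s = ∅ := by
  rw [← indicator_empty φ, (indicator_injective φ).eq_iff]

theorem indicator_mul (s t : Finset ι) : indicator φ s * indicator φ t = indicator φ (s ∩ t) := by
  apply φ.injective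
  ext i
  by_cases hs : i ∈ s <;> by_cases ht : i ∈ t <;> simp [apply_indicator, hs, ht]

theorem indicator_sub_mul (s t : Finset ι) :
    indicator φ s - indicator φ s * indicator φ t = indicator φ (s \ t) := by
  apply φ.injective
  ext i
  by_cases hs : i ∈ s <;> by_cases ht : i ∈ t <;> simp [apply_indicator, hs, ht]

theorem indicator_add_sdiff (s t : Finset ι) :
    indicator φ s + indicator φ (t \ s) = indicator φ (s ∪ t) := by
  apply φ.injective
  ext i
  by_cases hs : i ∈ s <;> by_cases ht : i ∈ t <;> simp [apply_indicator, hs, ht]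

/-- Fermat's little theorem in each component: `1 - x ^ (Q - 1)` is the idempotent of the zeros
of `x`. -/
theorem one_sub_pow_eq_indicator [Fintype ι] [∀ i, Fintype (F i)] [∀ i, DecidableEq (F i)] {Q : ℕ}
    (hQ : ∀ i, Fintype.card (F i) = Q) (hQ1 : 1 < Q) (x : R) :
    1 - x ^ (Q - 1) = indicator φ (Finset.univ.filter fun i => φ x i = 0) := by
  apply φ.injective
  ext i
  simp only [map_sub, map_one, map_pow, Pi.sub_apply, Pi.one_apply, Pi.pow_apply, apply_indicator,
    Finset.mem_filter, Finset.mem_univ, true_and]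
  split_ifs with h
  · rw [h, zero_pow (by omega), sub_zero]
  · rw [← hQ i, FiniteField.pow_card_sub_one_eq_one _ h, sub_self]

theorem indicator_singleton_mul_eq {j : ι} {x y : R} :
    indicator φ {j} * x = indicator φ {j} * y ↔ φ x j = φ y j := by
  constructor
  · intro h
    have := congrFun (congrArg φ h) j
    simpa [apply_indicator] using this
  · intro h
    apply φ.injective
    ext i
    by_cases hi : i = j
    · subst hi
      simp [apply_indicator, h]
    · simp [apply_indicator, hi]

/-- A wrong guess in the component `j` moves the hybrid forward by that component, since the error
of the guess is invertible there. -/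
theorem trial_true_of_ne [Fintype R] (χ : PMF R) {m : ℕ} (D : (Fin m → R × R) → PMF Bool) {j : ι}
    {E x s : R} (hE : E * indicator φ {j} = 0) (hx : indicator φ {j} * x ≠ indicator φ {j} * s) :
    trial χ D E (indicator φ {j}) (indicator φ {j} * x) s true =
      acceptProb χ D (E + indicator φ {j}) := by
  set d := indicator φ {j} with hd
  have hdd : d * d = d := by rw [hd, indicator_mul, Finset.inter_self]
  have hinv : ∃ y : R, d * (x - s) * y = d := by
    refine ⟨φ.symm (Pi.single j (φ (x - s) j)⁻¹), ?_⟩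
    have hne : φ (x - s) j ≠ 0 := by
      rw [map_sub, Pi.sub_apply, sub_ne_zero]
      exact fun h => hx ((indicator_singleton_mul_eq φ).2 h)
    apply φ.injective
    ext i
    by_cases hi : i = j
    · subst hi
      simp only [hd, map_mul, Pi.mul_apply, apply_indicator, RingEquiv.apply_symm_apply,
        Pi.single_eq_same, Finset.mem_singleton, if_true, one_mul]
      exact mul_inv_cancel₀ hne
    · simp [hd, apply_indicator, hi]
  obtain ⟨y, hy⟩ := hinv
  refine trial_true χ D (α := d * (x - s)) (β := 1 - d) (α' := y) (β' := 1) ?_ ?_ ?_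
  · linear_combination (x - s) * hE + (x - s) * hdd
  · linear_combination (-1 : R) * hE - hdd
  · linear_combination hy

end Idempotents

/-! ### The reduction as a program -/

section Reduction

local notation "rDeg" => (0 : ℕ)
local notation "rPrime" => (1 : ℕ)
local notation "rInertia" => (2 : ℕ)
local notation "rSamples" => (3 : ℕ)
local notation "rAdvantage" => (4 : ℕ)
local notation "rSecurity" => (5 : ℕ)
local notation "rZero" => (6 : ℕ)
local notation "rCard" => (7 : ℕ)
local notation "rCardPred" => (8 : ℕ)
local notation "rDegPred" => (9 : ℕ)
local notation "rBase" => (10 : ℕ)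
local notation "rSplits" => (11 : ℕ)
local notation "rGuesses" => (12 : ℕ)
local notation "rUnit" => (13 : ℕ)
local notation "rTrials" => (14 : ℕ)
local notation "rFar" => (15 : ℕ)
local notation "rNear" => (16 : ℕ)
local notation "rFour" => (17 : ℕ)
local notation "rThree" => (18 : ℕ)
local notation "rSix" => (19 : ℕ)
local notation "rNine" => (20 : ℕ)
local notation "rOne" => (21 : ℕ)
local notation "rAut" => (22 : ℕ)
local notation "rIndex" => (23 : ℕ)
local notation "rCount" => (24 : ℕ)
local notation "rBit" => (25 : ℕ)
local notation "rCount₀" => (26 : ℕ)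
local notation "rCount₁" => (27 : ℕ)
local notation "rDiff" => (28 : ℕ)
local notation "rTemp" => (29 : ℕ)
local notation "rFound" => (30 : ℕ)
local notation "aOut" => (0 : ℕ)
local notation "aZero" => (1 : ℕ)
local notation "aIdem" => (2 : ℕ)
local notation "aX" => (3 : ℕ)
local notation "aY" => (4 : ℕ)
local notation "aMask" => (5 : ℕ)
local notation "aMask'" => (6 : ℕ)
local notation "aPart" => (7 : ℕ)
local notation "aFoundMask" => (8 : ℕ)
local notation "aFoundPart" => (9 : ℕ)
local notation "aParMask" => (10 : ℕ)
local notation "aParPart" => (11 : ℕ)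
local notation "aParGuess" => (12 : ℕ)
local notation "aShift" => (13 : ℕ)
local notation "aCoef" => (14 : ℕ)
local notation "aV" => (15 : ℕ)
local notation "aU" => (16 : ℕ)
local notation "aProd" => (17 : ℕ)
local notation "aImage" => (18 : ℕ)
local notation "aValue" => (19 : ℕ)
local notation "aCovered" => (20 : ℕ)
local notation "aLeft" => (22 : ℕ)
local notation "aRight" => (23 : ℕ)

open Program

/-! ### Estimating an acceptance probability -/

section Trial

/-- The transformation of one sample, in place, at the index in `rIndex`: the automorphism with number
`rAut` is applied, the secret is shifted by `aShift`, the multiple of `aParPart` and its guess by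
`aV` is added, and the mask `aParMask` is applied with the factor `aU`. -/
def mixBlock : Program :=
  seq (ringAut (aLeft, rIndex) rAut (aLeft, rIndex)) <|
  seq (ringAut (aRight, rIndex) rAut (aRight, rIndex)) <|
  seq (ringMul (aProd, rZero) (aLeft, rIndex) (aShift, rZero)) <|
  seq (ringAdd (aRight, rIndex) (aRight, rIndex) (aProd, rZero)) <|
  seq (ringMul (aProd, rZero) (aV, rZero) (aCoef, rZero)) <|
  seq (ringAdd (aRight, rIndex) (aRight, rIndex) (aProd, rZero)) <|
  seq (ringMul (aProd, rZero) (aV, rZero) (aParPart, rZero)) <|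
  seq (ringAdd (aLeft, rIndex) (aLeft, rIndex) (aProd, rZero)) <|
  seq (ringMul (aProd, rZero) (aU, rZero) (aParMask, rZero)) <|
  seq (ringAdd (aRight, rIndex) (aRight, rIndex) (aProd, rZero)) <|
  natAdd rIndex rIndex rOne

variable {R : Type*} [CommRing R] [Fintype R] {E : Access R}

theorem mixBlock_run {S : State R} (h0 : S.nat rZero = 0) (h1 : S.nat rOne = 1) :
    ∃ T, mixBlock.run E S = PMF.pure T ∧ T.nat rIndex = S.nat rIndex + 1 ∧
      T.ring aLeft (S.nat rIndex) = E.aut (S.nat rAut) (S.ring aLeft (S.nat rIndex)) +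
        S.ring aV 0 * S.ring aParPart 0 ∧
      T.ring aRight (S.nat rIndex) = E.aut (S.nat rAut) (S.ring aRight (S.nat rIndex)) +
        E.aut (S.nat rAut) (S.ring aLeft (S.nat rIndex)) * S.ring aShift 0 +
        S.ring aV 0 * S.ring aCoef 0 + S.ring aU 0 * S.ring aParMask 0 ∧
      (∀ j, j ≠ S.nat rIndex → T.ring aLeft j = S.ring aLeft j ∧
        T.ring aRight j = S.ring aRight j) := by
  refine ⟨_, by simp only [mixBlock, run, PMF.pure_bind]; rfl, ?_, ?_, ?_, ?_⟩
  · simp [State.tick, State.set, State.setNat, State.get, h0, h1]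
  · simp [State.tick, State.set, State.setNat, State.get, h0, h1]
  · simp [State.tick, State.set, State.setNat, State.get, h0, h1]
  · intro j hj
    simp [State.tick, State.set, State.setNat, State.get, h0, h1, hj]

/-- One transformed sample is written to the arrays `aLeft`, `aRight` at the index in `rIndex`. -/
def sampleBlock : Program :=
  seq (sample (aLeft, rIndex) (aRight, rIndex)) <|
  seq (ringRand (aV, rZero)) <|
  seq (ringRand (aU, rZero)) mixBlock

/-- One call of the oracle on transformed samples; `rCount` counts the accepting calls. -/
def trialBlock : Program :=
  seq (ringRand (aShift, rZero)) <|
  seq (ringMul (aCoef, rZero) (aParPart, rZero) (aShift, rZero)) <|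
  seq (ringAdd (aCoef, rZero) (aCoef, rZero) (aParGuess, rZero)) <|
  seq (natConst rIndex 0) <|
  seq (loop rSamples sampleBlock) <|
  seq (oracle rBit aLeft aRight) <|
  natAdd rCount rCount rBit

/-- The number of accepting oracle calls among `N` calls on transformed samples. -/
def estimate : Program := seq (natConst rCount 0) (loop rTrials trialBlock)

/-- The registers and cells that are never written to after the parameters have been computed:
`n` is the degree, `Q` the cardinality of the residue fields, and `B` the number of which the loop
counts are powers. -/
structure Params (E : Access R) (n Q B : ℕ) (S : State R) : Prop where
  deg : S.nat rDeg = n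
  samples : S.nat rSamples = E.m
  zero : S.nat rZero = 0
  cardPred : S.nat rCardPred = Q - 1
  degPred : S.nat rDegPred = n - 1
  splits : S.nat rSplits = B ^ 4
  guesses : S.nat rGuesses = B ^ 3
  trials : S.nat rTrials = B ^ 9
  far : S.nat rFar = 6 * B ^ 6
  near : S.nat rNear = 2 * B ^ 6
  one : S.nat rOne = 1
  ringZero : S.ring aZero 0 = 0

variable {n Q B : ℕ}

/-- The parameters lie in registers below `22`, so a program that does not write there keeps them. -/
theorem Params.frame {S T : State R} (h : Params E n Q B S) {c : Program}
    (hc : ∀ r < 22, c.writesNat r = false) (hz : c.writesRing aZero = false)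
    (hT : T ∈ (c.run E S).support) : Params E n Q B T := by
  have e : ∀ r < 22, T.nat r = S.nat r := fun r hr => nat_eq_of_writesNat E (hc r hr) hT
  constructor
  all_goals first | rw [e _ (by norm_num)] | rw [ring_eq_of_writesRing E hz hT]
  exacts [h.deg, h.samples, h.zero, h.cardPred, h.degPred, h.splits, h.guesses, h.trials, h.far,
    h.near, h.one, h.ringZero]

omit [Fintype R] in
theorem Params.tick {S : State R} (h : Params E n Q B S) : Params E n Q B S.tick := by
  obtain ⟨_, _, _, _, _, _, _, _, _, _, _, _⟩ := h
  constructor <;> assumption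

/-- The hypotheses on the access to the ring: samples with secret `s`, and the automorphism with
number `k` is the ring automorphism `f`, which preserves the error distribution. -/
structure GoodAut (E : Access R) (χ : PMF R) (s : R) (k : ℕ) (f : R →+* R) : Prop where
  samples : E.samples = lwe χ s
  aut : E.aut k = f
  bijective : Function.Bijective f
  map : χ.map f = χ

variable {χ : PMF R} {s : R} {k : ℕ} {f : R →+* R}

/-- As the automorphism maps samples with secret `s` to samples with secret `f s`, the sample that is
written follows the transformed distribution for the secret `f s`. -/
theorem sampleBlock_map {S : State R} (hE : GoodAut E χ s (S.nat rAut) f)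
    (h0 : S.nat rZero = 0) (h1 : S.nat rOne = 1) {D Y t M : R} (hD : S.ring aParPart 0 = D)
    (hM : S.ring aParMask 0 = M) (ht : S.ring aShift 0 = t) (hg : S.ring aCoef 0 = D * t + Y) :
    (sampleBlock.run E S).map
      (fun T => (T.ring aLeft (S.nat rIndex), T.ring aRight (S.nat rIndex))) =
      transformed χ M D Y t (f s) := by
  rw [transformed, ← lwe_map f hE.bijective hE.map, ← hE.samples, PMF.bind_map]
  simp only [sampleBlock, run_seq, run, PMF.bind_map, PMF.map_bind, Function.comp_def]
  congr 1
  ext1 p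
  congr 1
  ext1 v
  rw [PMF.map]
  congr 1
  ext1 u
  obtain ⟨T, hT, -, ha, hb, -⟩ := mixBlock_run (E := E)
    (S := (((((S.tick.set (aLeft, rIndex) p.1).set (aRight, rIndex) p.2).tick.set
      (aV, rZero) v).tick.set (aU, rZero) u))) h0 h1
  rw [hT, PMF.pure_map, Function.comp_apply]
  simp [State.set, State.tick, h0, hD, hM, hg, ht, hE.aut] at ha hb
  simp only [ha, hb]

theorem sampleBlock_support {S T : State R} (h0 : S.nat rZero = 0) (h1 : S.nat rOne = 1)
    (hT : T ∈ (sampleBlock.run E S).support) :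
    T.nat rIndex = S.nat rIndex + 1 ∧ ∀ j, j ≠ S.nat rIndex → T.ring aLeft j = S.ring aLeft j ∧
        T.ring aRight j = S.ring aRight j := by
  simp only [sampleBlock, run_seq, run, PMF.bind_map, PMF.mem_support_bind_iff,
    Function.comp_apply] at hT
  obtain ⟨p, -, v, -, u, -, hT⟩ := hT
  obtain ⟨U, hU, hj, -, -, hr⟩ := mixBlock_run (E := E)
    (S := (((((S.tick.set (aLeft, rIndex) p.1).set (aRight, rIndex) p.2).tick.set
      (aV, rZero) v).tick.set (aU, rZero) u))) h0 h1
  rw [hU, PMF.mem_support_pure_iff] at hT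
  subst hT
  refine ⟨hj, fun j hne => ?_⟩
  have := hr j hne
  simpa [State.set, State.tick, hne] using this

/-- The sampling loop fills the arrays with independent transformed samples. -/
theorem iter_sampleBlock_map {D Y t M : R} (l : ℕ) {S : State R}
    (hE : GoodAut E χ s (S.nat rAut) f)
    (h0 : S.nat rZero = 0) (h1 : S.nat rOne = 1) (hD : S.ring aParPart 0 = D)
    (hM : S.ring aParMask 0 = M)
    (ht : S.ring aShift 0 = t) (hg : S.ring aCoef 0 = D * t + Y) :
    (iter (fun T => sampleBlock.run E T.tick) l S).map
      (fun T (i : Fin l) => (T.ring aLeft (S.nat rIndex + i), T.ring aRight (S.nat rIndex + i))) =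
      iid (transformed χ M D Y t (f s)) l ∧
    ∀ T ∈ (iter (fun T => sampleBlock.run E T.tick) l S).support, ∀ j < S.nat rIndex,
      T.ring aLeft j = S.ring aLeft j ∧ T.ring aRight j = S.ring aRight j := by
  induction l generalizing S with
  | zero =>
    simp only [iter, iid, PMF.pure_map, PMF.mem_support_pure_iff]
    refine ⟨congrArg _ (funext fun i => i.elim0), ?_⟩
    rintro T rfl j -
    exact ⟨rfl, rfl⟩
  | succ l ih =>
    have key : ∀ T ∈ (sampleBlock.run E S.tick).support, _ := fun T hT =>
      have hr : ∀ r, sampleBlock.writesNat r = false → T.nat r = S.nat r :=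
        fun r hr => nat_eq_of_writesNat (S := S.tick) E hr hT
      have hs : ∀ r, sampleBlock.writesRing r = false → T.ring r = S.ring r :=
        fun r hr => ring_eq_of_writesRing (S := S.tick) E hr hT
      ih (S := T) (by rw [hr _ rfl]; exact hE) (by rw [hr _ rfl]; exact h0)
        (by rw [hr _ rfl]; exact h1) (by rw [hs _ rfl]; exact hD) (by rw [hs _ rfl]; exact hM)
        (by rw [hs _ rfl]; exact ht) (by rw [hs _ rfl]; exact hg)
    have step : ∀ T ∈ (sampleBlock.run E S.tick).support, T.nat rIndex = S.nat rIndex + 1 ∧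
        ∀ j, j ≠ S.nat rIndex → T.ring aLeft j = S.ring aLeft j ∧
          T.ring aRight j = S.ring aRight j := fun T hT =>
      sampleBlock_support (S := S.tick) h0 h1 hT
    constructor
    · rw [iter, PMF.map_bind, iid, ← sampleBlock_map (S := S.tick) hE h0 h1 hD hM ht hg, PMF.bind_map]
      refine bind_congr_support fun T hT => ?_
      rw [Function.comp_apply, sampleBlock_map (S := S.tick) hE h0 h1 hD hM ht hg, ← (key T hT).1,
        PMF.map_comp]
      refine map_congr_support fun U hU => funext fun i => ?_
      refine Fin.cases ?_ (fun i => ?_) i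
      · have h := (key T hT).2 U hU (S.nat rIndex) (by rw [(step T hT).1]; omega)
        simp [h.1, h.2, State.tick]
      · have e : S.nat rIndex + (i + 1) = S.nat rIndex + 1 + i := by omega
        simp [(step T hT).1, e]
    · intro T hT j hj
      simp only [iter, PMF.mem_support_bind_iff] at hT
      obtain ⟨U, hU, hT⟩ := hT
      have h2 := (key U hU).2 T hT j (by rw [(step U hU).1]; omega)
      have h3 := (step U hU).2 j hj.ne
      exact ⟨h2.1.trans h3.1, h2.2.trans h3.2⟩

/-- A trial increases the counter by one exactly if the test accepts. -/
theorem trialBlock_map {S : State R} (hP : Params E n Q B S) (hE : GoodAut E χ s (S.nat rAut) f)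
    {M D Y : R} (hM : S.ring aParMask 0 = M) (hD : S.ring aParPart 0 = D)
    (hY : S.ring aParGuess 0 = Y) :
    (trialBlock.run E S).map (fun T => T.nat rCount) =
      (trial χ E.oracle M D Y (f s)).map fun b => S.nat rCount + if b then 1 else 0 := by
  have h0 := hP.zero
  rw [trialBlock, run_seq, run, PMF.bind_map, PMF.map_bind, trial, PMF.map_bind]
  congr 1
  ext1 t
  simp only [Function.comp_apply, run_seq]
  obtain ⟨U, hU, hg, ht, hMU, hDU, hj, hn⟩ : ∃ U, ((ringMul (aCoef, rZero) (aParPart, rZero)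
      (aShift, rZero)).run E (S.tick.set (aShift, rZero) t)).bind (fun T =>
        ((ringAdd (aCoef, rZero) (aCoef, rZero) (aParGuess, rZero)).run E T).bind fun T =>
          (natConst rIndex 0).run E T) = PMF.pure U ∧ U.ring aCoef 0 = D * t + Y ∧
        U.ring aShift 0 = t ∧ U.ring aParMask 0 = M ∧ U.ring aParPart 0 = D ∧
        U.nat rIndex = 0 ∧ ∀ r, r ≠ rIndex → U.nat r = S.nat r := by
    refine ⟨_, by simp only [run, PMF.pure_bind]; rfl, ?_⟩
    simp +contextual [State.tick, State.set, State.setNat, State.get, h0, hD, hY, hM]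
  have assoc : ∀ F : State R → PMF (State R), ((ringMul (aCoef, rZero) (aParPart, rZero)
      (aShift, rZero)).run E (S.tick.set (aShift, rZero) t)).bind (fun T =>
        ((ringAdd (aCoef, rZero) (aCoef, rZero) (aParGuess, rZero)).run E T).bind fun T =>
          ((natConst rIndex 0).run E T).bind F) = F U := fun F => by
    rw [← PMF.pure_bind U F, ← hU]
    simp only [PMF.bind_bind]
  rw [assoc, run_loop, hn _ (by norm_num), hP.samples, PMF.map_bind]
  have h := (iter_sampleBlock_map (E := E) (S := U.tick) (D := D) (Y := Y) (t := t) (M := M) E.m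
    (by simpa [State.tick, hn] using hE) (by simpa [State.tick, hn] using hP.zero)
    (by simpa [State.tick, hn] using hP.one) hDU hMU ht hg).1
  rw [← h, PMF.bind_map, PMF.map_bind]
  refine bind_congr_support fun T hT => ?_
  have hc : T.nat rCount = S.nat rCount := by
    have : T ∈ ((loop rSamples sampleBlock).run E U).support := by
      rwa [run_loop, hn _ (by norm_num), hP.samples]
    rw [nat_eq_of_writesNat E rfl this, hn _ (by norm_num)]
  simp only [run, PMF.bind_map, Function.comp_def, PMF.map_bind, PMF.pure_map]
  simp [PMF.map, Function.comp_def, State.tick, State.setNat, hc, hj]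

theorem expect_bool (μ : PMF Bool) (w : Bool → ℝ≥0∞) :
    expect μ w = (1 - μ true) * w false + μ true * w true := by
  have h : μ true + μ false = 1 := by
    rw [← μ.tsum_coe, tsum_bool, add_comm]
  rw [expect, tsum_bool, ← h, ENNReal.add_sub_cancel_left (μ.apply_ne_top _)]

/-- The estimate deviates from its mean by more than the unit `B ^ 6` only with exponentially
small probability. -/
theorem estimate_spec {S : State R} (hP : Params E n Q B S) (hE : GoodAut E χ s (S.nat rAut) f)
    (hB : 8 ≤ B) {M D Y : R} {p : ℝ≥0∞} (hM : S.ring aParMask 0 = M) (hD : S.ring aParPart 0 = D)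
    (hY : S.ring aParGuess 0 = Y) (hp : trial χ E.oracle M D Y (f s) true = p) :
    failProb (estimate.run E S)
      (fun T => |(T.nat rCount : ℝ) - (B : ℝ) ^ 9 * p.toReal| < (B : ℝ) ^ 6) ≤
      (1 / 2) ^ (6 * B) := by
  have hp1 : p ≤ 1 := hp ▸ PMF.coe_le_one _ _
  have hpt : p ≠ ∞ := ne_top_of_le_ne_top ENNReal.one_ne_top hp1
  have hB0 : (8 : ℝ) ≤ B := by exact_mod_cast hB
  rw [estimate, run_seq, run, PMF.pure_bind, run_loop]
  set S' := ((S.tick.setNat rCount 0)).tick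
  have hN : (S.tick.setNat rCount 0).nat rTrials = B ^ 9 := by
    simpa [State.tick, State.setNat] using hP.trials
  rw [hN]
  let I : State R → Prop := fun T => Params E n Q B T ∧ T.nat rAut = S.nat rAut ∧
    T.ring aParMask 0 = M ∧ T.ring aParPart 0 = D ∧ T.ring aParGuess 0 = Y
  have hI' : I S' := by
    refine ⟨?_, ?_, hM, hD, hY⟩
    · refine (hP.frame (c := natConst rCount 0) (by decide) rfl ?_).tick
      simp [run]
    · simp [S', State.tick, State.setNat]
  have hI : ∀ T, I T → ∀ U ∈ (trialBlock.run E T.tick).support, I U := fun T hT U hU => by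
    refine ⟨hT.1.tick.frame (by decide) rfl hU,
      (nat_eq_of_writesNat E rfl hU).trans hT.2.1, ?_, ?_, ?_⟩ <;>
      rw [ring_eq_of_writesRing E rfl hU]
    exacts [hT.2.2.1, hT.2.2.2.1, hT.2.2.2.2]
  have hcnt : ∀ T, I T → ∀ w : ℕ → ℝ≥0∞,
      expect (trialBlock.run E T.tick) (fun U => w (U.nat rCount)) =
        (1 - p) * w (T.nat rCount) + p * w (T.nat rCount + 1) := fun T hT w => by
    rw [← expect_map _ (fun U : State R => U.nat rCount), trialBlock_map hT.1.tick
      (by rw [State.tick, hT.2.1]; exact hE) hT.2.2.1 hT.2.2.2.1 hT.2.2.2.2, expect_map,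
      expect_bool, hp]
    simp [State.tick]
  have h0 : S'.nat rCount = 0 := by simp [S', State.tick, State.setNat]
  -- For `N = B ^ 9` and the deviation `u = B ^ 6`, the exponent `u ^ 2 / 4 N` is `B ^ 3 / 4`, which is
  -- at least `16 B`.
  have hm := fun x => expect_iter_counter (g := fun T => trialBlock.run E T.tick) hI hcnt x (B ^ 9) hI'
  have hc := chernoff (μ := iter (fun T => trialBlock.run E T.tick) (B ^ 9) S')
    (cnt := fun T => T.nat rCount) (p := p.toReal) (N := B ^ 9) (u := (B : ℝ) ^ 6) (by positivity)
    (by simpa using (ENNReal.toReal_le_toReal hpt ENNReal.one_ne_top).2 hp1)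
    (fun x => by rw [ENNReal.ofReal_toReal hpt, hm x, h0, pow_zero, mul_one]) (by positivity)
    (by push_cast; exact pow_le_pow_right₀ (by linarith) (by norm_num))
  rw [Nat.cast_pow] at hc
  refine hc.trans ?_
  have e1 : ((B : ℝ) ^ 6) ^ 2 / (4 * (B : ℝ) ^ 9) = (B : ℝ) ^ 3 / 4 := by
    field_simp
  have e2 : 16 * (B : ℝ) ≤ (B : ℝ) ^ 3 / 4 := by
    have : (64 : ℝ) ≤ (B : ℝ) ^ 2 := by nlinarith
    nlinarith
  have e3 : Real.exp (-((B : ℝ) ^ 3 / 4)) ≤ (1 / 2) ^ (6 * B + 1) := by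
    calc _ ≤ Real.exp (-((6 * B + 1 : ℕ) * 1 : ℝ)) := by
          rw [Real.exp_le_exp]
          push_cast
          linarith
      _ = (Real.exp (-1)) ^ (6 * B + 1) := by
          rw [← Real.exp_nat_mul]
          congr 1
          ring
      _ ≤ _ := by
          gcongr
          rw [Real.exp_neg, one_div]
          exact inv_anti₀ (by norm_num) (by linarith [Real.add_one_le_exp (1 : ℝ)])
  rw [e1]
  calc _ ≤ 2 * ENNReal.ofReal ((1 / 2) ^ (6 * B + 1)) := by gcongr
    _ = _ := by
      rw [ENNReal.ofReal_pow (by norm_num), ENNReal.ofReal_div_of_pos (by norm_num), pow_succ,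
        mul_left_comm]
      simp [ENNReal.mul_inv_cancel]

end Trial

/-! ### An idempotent with a single component -/

section Component

variable {R : Type*} [CommRing R] [Fintype R] {E : Access R} {n Q B : ℕ}
  {χ : PMF R} {s : R}

/-- An attempt to shrink the support of the idempotent in `aIdem`: it is multiplied by the
idempotent `1 - x ^ (Q - 1)` of the zeros of a random `x`, unless the product is zero. -/
def splitBlock : Program :=
  seq (ringRand (aX, rZero)) <|
  seq (ringOne (aY, rZero)) <|
  seq (loop rCardPred (ringMul (aY, rZero) (aY, rZero) (aX, rZero))) <|
  seq (ringOne (aProd, rZero)) <|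
  seq (ringSub (aY, rZero) (aProd, rZero) (aY, rZero)) <|
  seq (ringMul (aY, rZero) (aY, rZero) (aIdem, rZero)) <|
  ifRingZero (aY, rZero) (natConst rTemp 0) (ringAdd (aIdem, rZero) (aY, rZero) (aZero, rZero))

/-- The search for an idempotent that is one in exactly one component. -/
def splitPhase : Program := seq (ringOne (aIdem, rZero)) (loop rSplits splitBlock)

theorem iter_ringMul (l : ℕ) {S : State R} (h0 : S.nat rZero = 0) :
    ∃ T, iter (fun T => (ringMul (aY, rZero) (aY, rZero) (aX, rZero)).run E T.tick) l S =
      PMF.pure T ∧ T.ring aY 0 = S.ring aY 0 * S.ring aX 0 ^ l ∧ T.nat = S.nat ∧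
      ∀ r, r ≠ aY → T.ring r = S.ring r := by
  induction l generalizing S with
  | zero => exact ⟨S, rfl, by simp, rfl, fun _ _ => rfl⟩
  | succ l ih =>
    obtain ⟨T, hT, hy, hn, hr⟩ := ih (S := S.tick.tick.set (aY, rZero)
      (S.ring aY 0 * S.ring aX 0)) h0
    refine ⟨T, ?_, ?_, hn, fun r hne => ?_⟩
    · rw [← hT, iter, run, PMF.pure_bind]
      simp [State.get, State.tick, h0]
    · rw [hy]
      simp [State.set, State.tick, h0]
      ring
    · rw [hr r hne]
      simp [State.set, State.tick, hne]

open scoped Classical in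
theorem splitBlock_map {S : State R} (hP : Params E n Q B S) :
    (splitBlock.run E S).map (fun T => T.ring aIdem 0) =
      (PMF.uniformOfFintype R).map fun x =>
        if (1 - x ^ (Q - 1)) * S.ring aIdem 0 = 0 then S.ring aIdem 0
        else (1 - x ^ (Q - 1)) * S.ring aIdem 0 := by
  have h0 := hP.zero
  rw [splitBlock, run_seq, run, PMF.bind_map, PMF.map_bind]
  refine congrArg _ (funext fun x => ?_)
  obtain ⟨T, hT, hy, hn, hr⟩ := iter_ringMul (E := E) (Q - 1)
    (S := ((S.tick.set (aX, rZero) x).tick.set (aY, rZero) 1).tick) h0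
  have hn' : T.nat = S.nat := hn
  have hz : T.ring aZero 0 = 0 := by
    rw [hr _ (by norm_num)]
    simpa [State.set, State.tick] using hP.ringZero
  have hi : T.ring aIdem 0 = S.ring aIdem 0 := by
    rw [hr _ (by norm_num)]
    simp [State.set, State.tick]
  replace hy : T.ring aY 0 = x ^ (Q - 1) := by
    rw [hy]
    simp [State.set, State.tick, h0]
  have hq : ((S.tick.set (aX, rZero) x).tick.set (aY, rZero) 1).nat rCardPred = Q - 1 := hP.cardPred
  simp only [Function.comp_apply, run_seq, run_loop]
  rw [show (ringOne (aY, rZero)).run E (S.tick.set (aX, rZero) x) = PMF.pure _ from rfl,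
    PMF.pure_bind, hq, hT]
  simp only [run, PMF.pure_bind]
  by_cases hc : (1 - x ^ (Q - 1)) * S.ring aIdem 0 = 0
  · simp [hc, State.get, State.set, State.setNat, State.tick, hn', h0, hy, hi, PMF.pure_map]
  · simp [hc, State.get, State.set, State.tick, hn', h0, hy, hi, hz, PMF.pure_map]

variable {ι : Type*} [Fintype ι] [DecidableEq ι] {F : ι → Type*}
  [∀ i, Field (F i)] [∀ i, Fintype (F i)] (φ : R ≃+* ∀ i, F i)

omit [Fintype ι] in
/-- Two given components are separated by one attempt with probability at least `1 / Q ^ 2`, since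
a random element is zero in the first and one in the second with this probability. -/
theorem failProb_uniform_separate (hQ : ∀ i, Fintype.card (F i) = Q) {i j : ι} (hij : i ≠ j) :
    failProb (PMF.uniformOfFintype R) (fun x => φ x i = 0 ∧ φ x j = 1) ≤
      1 - ((Q ^ 2 : ℕ) : ℝ≥0∞)⁻¹ := by
  let g : R →+ F i × F j :=
    { toFun := fun x => (φ x i, φ x j)
      map_zero' := by simp
      map_add' := by simp }
  have hg : Function.Surjective g := fun y => by
    refine ⟨φ.symm (Function.update (Function.update 0 i y.1) j y.2), ?_⟩
    ext <;> simp [g, hij]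
  have h := failProb_uniform_eq ((0, 1) : F i × F j)
  rw [← map_uniform_of_surjective g hg, failProb_map, Fintype.card_prod, hQ, hQ, ← sq] at h
  refine (failProb_mono fun x _ hx => ?_).trans h.le
  exact Prod.ext_iff.1 hx

/-- The support of the idempotent after one attempt. -/
theorem exists_splitBlock_map {S : State R} (hP : Params E n Q B S)
    (hQ : ∀ i, Fintype.card (F i) = Q) (hQ1 : 1 < Q) {t : Finset ι}
    (ht : S.ring aIdem 0 = indicator φ t) :
    ∃ Z : R → Finset ι, (∀ x i, i ∈ Z x ↔ φ x i = 0) ∧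
      (splitBlock.run E S).map (fun T => T.ring aIdem 0) = (PMF.uniformOfFintype R).map fun x =>
        indicator φ (if Z x ∩ t = ∅ then t else Z x ∩ t) := by
  classical
  refine ⟨fun x => Finset.univ.filter fun i => φ x i = 0, by simp, ?_⟩
  rw [splitBlock_map hP]
  congr 1
  ext1 x
  rw [one_sub_pow_eq_indicator φ hQ hQ1, ht, indicator_mul]
  simp only [indicator_eq_zero]
  split_ifs <;> rfl

/-- An idempotent with nonempty support that contains no two different components is the idempotent
of one component. The bound is the union bound over all pairs of components, each of which gets
`B ^ 4` independent chances to be separated. -/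
theorem splitPhase_spec {S : State R} [Nonempty ι] (hP : Params E n Q B S)
    (hQ : ∀ i, Fintype.card (F i) = Q) (hQ1 : 1 < Q) :
    failProb (splitPhase.run E S)
      (fun T => Params E n Q B T ∧ ∃ j, T.ring aIdem 0 = indicator φ {j}) ≤
      (Fintype.card ι : ℝ≥0∞) ^ 2 * (1 - ((Q ^ 2 : ℕ) : ℝ≥0∞)⁻¹) ^ (B ^ 4) := by
  classical
  let I : State R → Prop := fun T => Params E n Q B T ∧
    ∃ t : Finset ι, t.Nonempty ∧ T.ring aIdem 0 = indicator φ t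
  -- `G p`: the two components of the pair `p` have been separated.
  let G : ι × ι → State R → Prop := fun p T => p.1 ≠ p.2 →
    ∀ t : Finset ι, T.ring aIdem 0 = indicator φ t → ¬ (p.1 ∈ t ∧ p.2 ∈ t)
  set g : State R → PMF (State R) := fun T => splitBlock.run E T.tick
  have hstep : ∀ T, I T → ∃ t : Finset ι, t.Nonempty ∧ T.ring aIdem 0 = indicator φ t ∧
      ∃ Z : R → Finset ι, (∀ x i, i ∈ Z x ↔ φ x i = 0) ∧
      (g T).map (fun T => T.ring aIdem 0) = (PMF.uniformOfFintype R).map fun x =>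
        indicator φ (if Z x ∩ t = ∅ then t else Z x ∩ t) := by
    rintro T ⟨hT, t, hne, ht⟩
    exact ⟨t, hne, ht, exists_splitBlock_map φ hT.tick hQ hQ1 ht⟩
  have hsub : ∀ T, I T → ∀ U ∈ (g T).support, I U ∧ ∀ p, G p T → G p U := by
    intro T hT U hU
    obtain ⟨t, hne, ht, Z, hZ, hmap⟩ := hstep T hT
    have hU' : U.ring aIdem 0 ∈ ((g T).map fun T => T.ring aIdem 0).support := by
      rw [PMF.support_map]
      exact ⟨U, hU, rfl⟩
    rw [hmap, PMF.support_map] at hU'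
    obtain ⟨x, -, hx⟩ := hU'
    refine ⟨⟨hT.1.tick.frame (by decide) rfl hU, _, ?_, hx.symm⟩, fun p hp hne t' ht' => ?_⟩
    · split_ifs with h
      · exact hne
      · exact Finset.nonempty_iff_ne_empty.2 h
    · rw [← hx, (indicator_injective φ).eq_iff] at ht'
      subst ht'
      refine fun h => hp hne t ht ?_
      split_ifs at h
      · exact h
      · exact ⟨(Finset.mem_inter.1 h.1).2, (Finset.mem_inter.1 h.2).2⟩
  have hpair : ∀ p a, I a → failProb (iter g (B ^ 4) a) (G p) ≤
      (1 - ((Q ^ 2 : ℕ) : ℝ≥0∞)⁻¹) ^ (B ^ 4) := by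
    intro p a ha
    refine (failProb_iter_goal_le (I := I) (G := G p) (δ := 0) (fun T hT U hU => (hsub T hT U hU).1)
      (fun T hT hG => (failProb_eq_zero fun U hU => (hsub T hT U hU).2 p hG).le)
      (fun T hT => ?_) _ ha).trans_eq (by rw [mul_zero, zero_add])
    by_cases hne : p.1 = p.2
    · exact (failProb_eq_zero fun U _ h => absurd hne h).le.trans zero_le
    obtain ⟨t, -, ht, Z, hZ, hmap⟩ := hstep T hT
    refine le_trans ?_ (failProb_uniform_separate φ hQ hne)
    have h := failProb_map (g T) (fun U => U.ring aIdem 0) (fun e => p.1 ≠ p.2 →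
      ∀ t : Finset ι, e = indicator φ t → ¬ (p.1 ∈ t ∧ p.2 ∈ t))
    rw [hmap, failProb_map] at h
    refine h.symm.le.trans ?_
    refine failProb_mono fun x _ hx _ t' ht' h => ?_
    rw [(indicator_injective φ).eq_iff] at ht'
    subst ht'
    split_ifs at h with h0
    · have : p.1 ∈ Z x ∩ t := Finset.mem_inter.2 ⟨(hZ x _).2 hx.1, h.1⟩
      simp [h0] at this
    · have := (hZ x _).1 (Finset.mem_inter.1 h.2).1
      rw [hx.2] at this
      exact one_ne_zero this
  have hS : I (S.tick.set (aIdem, rZero) 1).tick := by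
    refine ⟨(hP.frame (c := ringOne (aIdem, rZero)) (by decide) rfl (by simp [run])).tick,
      Finset.univ, Finset.univ_nonempty, ?_⟩
    simp [State.set, State.tick, hP.zero, indicator_univ]
  rw [splitPhase, run_seq, run, PMF.pure_bind, run_loop,
    show (S.tick.set (aIdem, rZero) 1).nat rSplits = B ^ 4 from hP.splits]
  calc _ ≤ failProb (iter g (B ^ 4) (S.tick.set (aIdem, rZero) 1).tick)
        (fun T => ∀ p ∈ (Finset.univ : Finset (ι × ι)), G p T) := by
        refine failProb_mono fun T hT hG => ?_
        have hIT : I T := iter_invariant (I := fun _ => I)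
          (fun _ _ T hT U hU => (hsub T hT U hU).1) hS T hT
        refine ⟨hIT.1, ?_⟩
        obtain ⟨-, t, ⟨j, hj⟩, ht⟩ := hIT
        refine ⟨j, ht.trans (congrArg _ (Finset.eq_singleton_iff_unique_mem.2 ⟨hj, fun i hi => ?_⟩))⟩
        by_contra hne
        exact hG (i, j) (Finset.mem_univ _) hne t ht ⟨hi, hj⟩
    _ ≤ ∑ p : ι × ι, failProb (iter g (B ^ 4) (S.tick.set (aIdem, rZero) 1).tick) (G p) :=
        failProb_forall_le _ _ _
    _ ≤ ∑ p : ι × ι, (1 - ((Q ^ 2 : ℕ) : ℝ≥0∞)⁻¹) ^ (B ^ 4) :=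
        Finset.sum_le_sum fun p _ => hpair p _ hS
    _ = _ := by
        rw [Finset.sum_const, Finset.card_univ, Fintype.card_prod, nsmul_eq_mul, Nat.cast_mul,
          ← sq]

end Component

/-! ### Neighbouring hybrids that the oracle distinguishes -/

section Search

variable {R : Type*} [CommRing R] [Fintype R] {E : Access R} {n Q B : ℕ}
  {χ : PMF R} {s : R} {ι : Type*} [Fintype ι] [DecidableEq ι] {F : ι → Type*}
  [∀ i, Field (F i)] [∀ i, Fintype (F i)] (φ : R ≃+* ∀ i, F i)

/-- The next mask, and the arguments of the first estimate. -/
def maskBlock : Program :=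
  seq (ringAut (aImage, rZero) rAut (aIdem, rZero)) <|
  seq (ringMul (aPart, rZero) (aImage, rZero) (aMask, rZero)) <|
  seq (ringSub (aPart, rZero) (aImage, rZero) (aPart, rZero)) <|
  seq (ringAdd (aMask', rZero) (aMask, rZero) (aPart, rZero)) <|
  seq (ringAdd (aParMask, rZero) (aMask, rZero) (aZero, rZero)) <|
  seq (ringZero (aParPart, rZero)) (ringZero (aParGuess, rZero))

/-- Keep the first estimate, and set the argument of the second one. -/
def keepBlock : Program :=
  seq (natAdd rCount₀ rCount rZero) (ringAdd (aParMask, rZero) (aMask', rZero) (aZero, rZero))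

/-- Register `rDiff` becomes the distance of the registers `x` and `y`. -/
def distBlock (x y : ℕ) : Program :=
  seq (natSub rTemp x y) (seq (natSub rDiff y x) (natAdd rDiff rDiff rTemp))

/-- Store the current hybrid if the two estimates are far apart, replacing what was stored before, and
pass to the next hybrid. -/
def storeBlock : Program :=
  seq (distBlock rCount₀ rCount) <|
  seq (natSub rTemp rFar rDiff) <|
  seq (ifNatZero rTemp
    (seq (ringAdd (aFoundMask, rZero) (aMask, rZero) (aZero, rZero)) <|
      seq (ringAdd (aFoundPart, rZero) (aPart, rZero) (aZero, rZero)) <|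
      natAdd rFound rCount₀ rZero)
    (natConst rTemp 0)) <|
  seq (ringAdd (aMask, rZero) (aMask', rZero) (aZero, rZero)) <|
  natAdd rAut rAut rOne

/-- The comparison of two neighbouring hybrids. -/
def hybridBlock : Program :=
  seq maskBlock <| seq estimate <| seq keepBlock <| seq estimate storeBlock

/-- The search for two neighbouring hybrids that the oracle distinguishes. -/
def hybridPhase : Program :=
  seq (natConst rAut 0) <| seq (ringZero (aMask, rZero)) (loop rDeg hybridBlock)

theorem maskBlock_run {S T : State R} (hP : Params E n Q B S)
    (hT : T ∈ (maskBlock.run E S).support) :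
    let w := E.aut (S.nat rAut) (S.ring aIdem 0)
    let d := w - w * S.ring aMask 0
    T.ring aPart 0 = d ∧ T.ring aMask' 0 = S.ring aMask 0 + d ∧
      T.ring aParMask 0 = S.ring aMask 0 ∧ T.ring aParPart 0 = 0 ∧ T.ring aParGuess 0 = 0 := by
  simp only [maskBlock, run, PMF.pure_bind, PMF.mem_support_pure_iff] at hT
  subst hT
  simp [State.tick, State.set, State.get, hP.zero, hP.ringZero]

theorem keepBlock_run {S T : State R} (hP : Params E n Q B S)
    (hT : T ∈ (keepBlock.run E S).support) :
    T.nat rCount₀ = S.nat rCount ∧ T.ring aParMask 0 = S.ring aMask' 0 := by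
  simp only [keepBlock, run, PMF.pure_bind, PMF.mem_support_pure_iff] at hT
  subst hT
  simp [State.tick, State.set, State.setNat, State.get, hP.zero, hP.ringZero]

theorem storeBlock_run {S T : State R} (hP : Params E n Q B S)
    (hT : T ∈ (storeBlock.run E S).support) :
    T.nat rAut = S.nat rAut + 1 ∧ T.ring aMask 0 = S.ring aMask' 0 ∧
      if 6 * B ^ 6 ≤ (S.nat rCount - S.nat rCount₀) + (S.nat rCount₀ - S.nat rCount) then
        T.ring aFoundMask 0 = S.ring aMask 0 ∧ T.ring aFoundPart 0 = S.ring aPart 0 ∧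
          T.nat rFound = S.nat rCount₀
      else T.ring aFoundMask 0 = S.ring aFoundMask 0 ∧
        T.ring aFoundPart 0 = S.ring aFoundPart 0 ∧ T.nat rFound = S.nat rFound := by
  simp only [storeBlock, distBlock, run, PMF.pure_bind] at hT
  split_ifs at hT with h <;>
    simp only [PMF.pure_bind, PMF.mem_support_pure_iff] at hT <;> subst hT <;>
    simp [State.tick, State.setNat, hP.far, Nat.sub_eq_zero_iff_le] at h <;>
    simp [State.tick, State.set, State.setNat, State.get, hP.zero, hP.ringZero, hP.one, h, -not_le,
      not_le.2]

/-- The acceptance probability of the hybrid that is masked in the components of `t`. -/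
noncomputable def level (χ : PMF R) {m : ℕ} (D : (Fin m → R × R) → PMF Bool) (t : Finset ι) : ℝ :=
  (acceptProb χ D (indicator φ t)).toReal

/-- Two neighbouring hybrids that the oracle distinguishes: `M` is the mask of the first one,
`d` the idempotent of the component by which they differ, and `c` an estimate for the first
one. -/
def Distinguished (χ : PMF R) {m : ℕ} (D : (Fin m → R × R) → PMF Bool) (B : ℕ) (M d : R) (c : ℕ) :
    Prop :=
  ∃ (j : ι) (t : Finset ι), d = indicator φ {j} ∧ M = indicator φ t ∧ j ∉ t ∧
    |(c : ℝ) - (B : ℝ) ^ 9 * level φ χ D t| < (B : ℝ) ^ 6 ∧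
    4 * (B : ℝ) ^ 6 < (B : ℝ) ^ 9 * |level φ χ D t - level φ χ D (t ∪ {j})|

/-- The components that are masked in the hybrid with number `i`. -/
def covered (π : ℕ → ι → ι) (j : ι) (i : ℕ) : Finset ι := (Finset.range i).image fun k => π k j

omit [Fintype ι] in
theorem covered_succ (π : ℕ → ι → ι) (j : ι) (i : ℕ) :
    covered π j (i + 1) = covered π j i ∪ {π i j} := by
  rw [covered, Finset.range_add_one, Finset.image_insert, covered, Finset.union_comm]
  rfl

/-- The ring is a product of fields with `Q` elements, indexed by `ι` through `φ`; the automorphism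
with number `k`, of order dividing `n`, acts on the components by `π k`, and the action of the
automorphisms with numbers below `n` is transitive. -/
structure Splitting (E : Access R) (χ : PMF R) (s : R) (n Q : ℕ) (σ : ℕ → R →+* R)
    (π : ℕ → ι → ι) : Prop where
  card (i : ι) : Fintype.card (F i) = Q
  one_lt : 1 < Q
  good (k : ℕ) (hk : k < n) : GoodAut E χ s k (σ k)
  iterate (k : ℕ) (hk : k < n) (x : R) : (σ k)^[n] x = x
  perm (k : ℕ) (hk : k < n) (j : ι) : σ k (indicator φ {j}) = indicator φ {π k j}
  trans (i j : ι) : ∃ k < n, π k i = j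

variable {φ} {σ : ℕ → R →+* R} {π : ℕ → ι → ι}

omit [Fintype ι] in
/-- With estimates that are off by less than `B ^ 6`, the threshold `6 B ^ 6` for their distance
ensures that stored hybrids differ by more than `4 B ^ 6`, and that hybrids that differ by at least
`8 B ^ 6` are stored. -/
theorem hybridBlock_spec (hs : Splitting φ E χ s n Q σ π) (hB : 8 ≤ B) {j : ι} {i : ℕ} (hi : i < n)
    {S : State R} (hP : Params E n Q B S) (hk : S.nat rAut = i)
    (he : S.ring aIdem 0 = indicator φ {j})
    (hM : S.ring aMask 0 = indicator φ (covered π j i)) :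
    failProb (hybridBlock.run E S) (fun T => T.nat rAut = i + 1 ∧
      T.ring aMask 0 = indicator φ (covered π j (i + 1)) ∧
      (Distinguished φ χ E.oracle B (T.ring aFoundMask 0) (T.ring aFoundPart 0) (T.nat rFound) ∨
        T.ring aFoundMask 0 = S.ring aFoundMask 0 ∧ T.ring aFoundPart 0 = S.ring aFoundPart 0 ∧
          T.nat rFound = S.nat rFound ∧ (B : ℝ) ^ 9 * |level φ χ E.oracle (covered π j i) -
            level φ χ E.oracle (covered π j (i + 1))| < 8 * (B : ℝ) ^ 6)) ≤
      (1 / 2) ^ (6 * B) + (1 / 2) ^ (6 * B) := by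
  rw [hybridBlock, run_seq]
  refine failProb_bind_le_of_forall fun T₁ h₁ => ?_
  obtain ⟨hd, hM', hpM, hpd, hpY⟩ := maskBlock_run hP h₁
  have P₁ := hP.frame (c := maskBlock) (by decide) rfl h₁
  have n₁ := fun r h => nat_eq_of_writesNat (c := maskBlock) (r := r) E h h₁
  have r₁ := fun r h => ring_eq_of_writesRing (c := maskBlock) (r := r) E h h₁
  rw [he, hk, (hs.good i hi).aut, hs.perm i hi, hM, indicator_sub_mul] at hd hM'
  rw [indicator_add_sdiff, ← covered_succ] at hM'
  rw [hM] at hpM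
  have k₁ : T₁.nat rAut = i := (n₁ _ rfl).trans hk
  rw [run_seq]
  refine failProb_bind_le (estimate_spec P₁ (by rw [k₁]; exact hs.good i hi) hB hpM hpd hpY
    (trial_true_of_eq χ E.oracle (by rw [zero_mul]))) fun T₂ h₂ c₂ => ?_
  have P₂ := P₁.frame (c := estimate) (by decide) rfl h₂
  have n₂ := fun r h => nat_eq_of_writesNat (c := estimate) (r := r) E h h₂
  have r₂ := fun r h => ring_eq_of_writesRing (c := estimate) (r := r) E h h₂
  rw [run_seq]
  refine failProb_bind_le_of_forall fun T₃ h₃ => ?_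
  obtain ⟨hc, hpM₃⟩ := keepBlock_run P₂ h₃
  have P₃ := P₂.frame (c := keepBlock) (by decide) rfl h₃
  have n₃ := fun r h => nat_eq_of_writesNat (c := keepBlock) (r := r) E h h₃
  have r₃ := fun r h => ring_eq_of_writesRing (c := keepBlock) (r := r) E h h₃
  have k₃ : T₃.nat rAut = i := by rw [n₃ _ rfl, n₂ _ rfl, k₁]
  rw [run_seq, ← add_zero ((1 / 2 : ℝ≥0∞) ^ (6 * B))]
  refine failProb_bind_le (estimate_spec P₃ (by rw [k₃]; exact hs.good i hi) hB
    (by rw [hpM₃, r₂ _ rfl, hM']) (by rw [r₃ _ rfl, r₂ _ rfl, hpd])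
    (by rw [r₃ _ rfl, r₂ _ rfl, hpY])
    (trial_true_of_eq χ E.oracle (by rw [zero_mul]))) fun T₄ h₄ c₄ => ?_
  have P₄ := P₃.frame (c := estimate) (by decide) rfl h₄
  have n₄ := fun r h => nat_eq_of_writesNat (c := estimate) (r := r) E h h₄
  have r₄ := fun r h => ring_eq_of_writesRing (c := estimate) (r := r) E h h₄
  refine (failProb_eq_zero fun T h => ?_).le
  obtain ⟨hk', hmask, hif⟩ := storeBlock_run P₄ h
  refine ⟨by rw [hk', n₄ _ rfl, k₃], by rw [hmask, r₄ _ rfl, r₃ _ rfl, r₂ _ rfl, hM'], ?_⟩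
  rw [n₄ rCount₀ rfl, hc] at hif
  change |_ - _ * level φ χ E.oracle (covered π j i)| < _ at c₂
  change |_ - _ * level φ χ E.oracle (covered π j (i + 1))| < _ at c₄
  have hdist : ((T₄.nat rCount - T₂.nat rCount + (T₂.nat rCount - T₄.nat rCount) : ℕ) : ℝ) =
      |(T₂.nat rCount : ℝ) - T₄.nat rCount| := by
    rcases le_total (T₂.nat rCount) (T₄.nat rCount) with h | h
    · rw [Nat.sub_eq_zero_of_le h, add_zero, Nat.cast_sub h, abs_sub_comm, abs_of_nonneg]
      exact sub_nonneg.2 (by exact_mod_cast h)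
    · rw [Nat.sub_eq_zero_of_le h, zero_add, Nat.cast_sub h, abs_of_nonneg]
      exact sub_nonneg.2 (by exact_mod_cast h)
  set a := level φ χ E.oracle (covered π j i)
  set b := level φ χ E.oracle (covered π j (i + 1)) with hb
  have hmul : (B : ℝ) ^ 9 * |a - b| = |(B : ℝ) ^ 9 * a - (B : ℝ) ^ 9 * b| := by
    rw [← mul_sub, abs_mul, abs_of_nonneg (by positivity : (0 : ℝ) ≤ (B : ℝ) ^ 9)]
  rw [abs_lt] at c₂ c₄
  split_ifs at hif with hfar
  · left
    have hfar' : 6 * (B : ℝ) ^ 6 ≤ |(T₂.nat rCount : ℝ) - T₄.nat rCount| := by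
      rw [← hdist]
      exact_mod_cast hfar
    have hgap : 4 * (B : ℝ) ^ 6 < (B : ℝ) ^ 9 * |a - b| := by
      rw [hmul]
      rcases le_abs.1 hfar' with h | h
      · exact lt_abs.2 (.inl (by linarith))
      · exact lt_abs.2 (.inr (by linarith))
    -- If the component were masked already, the two hybrids would coincide.
    have hnot : π i j ∉ covered π j i := by
      intro hmem
      have : a = b := by
        rw [hb, covered_succ, Finset.union_eq_left.2 (Finset.singleton_subset_iff.2 hmem)]
      rw [this, sub_self, abs_zero, mul_zero] at hgap
      have : (0 : ℝ) ≤ (B : ℝ) ^ 6 := by positivity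
      linarith
    refine ⟨π i j, covered π j i, ?_, ?_, hnot, ?_, ?_⟩
    · rw [hif.2.1, r₄ _ rfl, r₃ _ rfl, r₂ _ rfl, hd,
        Finset.sdiff_eq_self_of_disjoint (Finset.disjoint_singleton_left.2 hnot)]
    · rw [hif.1, r₄ _ rfl, r₃ _ rfl, r₂ _ rfl, r₁ _ rfl, hM]
    · rw [hif.2.2]
      exact abs_lt.2 c₂
    · rw [← covered_succ]
      exact hgap
  · right
    have hnear : |(T₂.nat rCount : ℝ) - T₄.nat rCount| < 6 * (B : ℝ) ^ 6 := by
      rw [← hdist]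
      exact_mod_cast not_le.1 hfar
    refine ⟨?_, ?_, ?_, ?_⟩
    · rw [hif.1, r₄ _ rfl, r₃ _ rfl, r₂ _ rfl, r₁ _ rfl]
    · rw [hif.2.1, r₄ _ rfl, r₃ _ rfl, r₂ _ rfl, r₁ _ rfl]
    · rw [hif.2.2, n₄ _ rfl, n₃ _ rfl, n₂ _ rfl, n₁ _ rfl]
    · rw [hmul]
      rw [abs_lt] at hnear ⊢
      constructor <;> linarith

omit [Fintype R] [Fintype ι] in
/-- The hybrid argument: some step of a finite sequence is at least the average step. -/
theorem exists_le_abs_sub (p : ℕ → ℝ) {n : ℕ} {δ : ℝ} (h : n * δ ≤ |p 0 - p n|) (hn : 0 < n) :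
    ∃ i < n, δ ≤ |p i - p (i + 1)| := by
  by_contra! hc
  have h1 : |p 0 - p n| ≤ ∑ i ∈ Finset.range n, |p i - p (i + 1)| := by
    rw [← Finset.sum_range_sub' p n]
    exact Finset.abs_sum_le_sum_abs _ _
  have h2 : ∑ i ∈ Finset.range n, |p i - p (i + 1)| < ∑ i ∈ Finset.range n, δ :=
    Finset.sum_lt_sum_of_nonempty (by simpa using hn.ne') fun i hi => hc i (Finset.mem_range.1 hi)
  rw [Finset.sum_const, Finset.card_range, nsmul_eq_mul] at h2
  linarith

theorem hybridPhase_spec (hs : Splitting φ E χ s n Q σ π) (hn : 0 < n) (hB : 8 ≤ B) (hnB : n ≤ B)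
    {l : ℕ} (hl : 0 < l) (hlB : l ≤ B)
    (hadv : 1 / (l : ℝ) ≤ |level φ χ E.oracle ∅ - level φ χ E.oracle Finset.univ|)
    {S : State R} (hP : Params E n Q B S) {j : ι} (he : S.ring aIdem 0 = indicator φ {j}) :
    failProb (hybridPhase.run E S) (fun T => Params E n Q B T ∧
      Distinguished φ χ E.oracle B (T.ring aFoundMask 0) (T.ring aFoundPart 0) (T.nat rFound)) ≤
      n * ((1 / 2) ^ (6 * B) + (1 / 2) ^ (6 * B)) := by
  set p : ℕ → ℝ := fun i => level φ χ E.oracle (covered π j i)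
  let I : ℕ → State R → Prop := fun i T => Params E n Q B T ∧ T.nat rAut = i ∧
    T.ring aIdem 0 = indicator φ {j} ∧ T.ring aMask 0 = indicator φ (covered π j i) ∧
    ((∃ k < i, 8 * (B : ℝ) ^ 6 ≤ (B : ℝ) ^ 9 * |p k - p (k + 1)|) →
      Distinguished φ χ E.oracle B (T.ring aFoundMask 0) (T.ring aFoundPart 0) (T.nat rFound))
  have huniv : covered π j n = Finset.univ := by
    ext i
    obtain ⟨k, hk, hi⟩ := hs.trans j i
    simp only [covered, Finset.mem_image, Finset.mem_range, Finset.mem_univ, iff_true]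
    exact ⟨k, hk, hi⟩
  -- Some step is at least `1 / (n l) ≥ 1 / B ^ 2`, so that its multiple by `B ^ 9` is at least
  -- `B ^ 7 ≥ 8 B ^ 6`.
  have hgap : ∃ k < n, 8 * (B : ℝ) ^ 6 ≤ (B : ℝ) ^ 9 * |p k - p (k + 1)| := by
    have hB0 : (8 : ℝ) ≤ B := by exact_mod_cast hB
    have hn0 : (0 : ℝ) < n := by exact_mod_cast hn
    have hl0 : (0 : ℝ) < l := by exact_mod_cast hl
    have hnB' : (n : ℝ) ≤ B := by exact_mod_cast hnB
    have hlB' : (l : ℝ) ≤ B := by exact_mod_cast hlB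
    obtain ⟨k, hk, h⟩ := exists_le_abs_sub p (n := n) (δ := 1 / (n * l)) (by
      refine le_trans (le_of_eq ?_) (hadv.trans_eq ?_)
      · field_simp
      · simp only [p, huniv]
        rfl) hn
    refine ⟨k, hk, ?_⟩
    calc 8 * (B : ℝ) ^ 6 ≤ (B : ℝ) ^ 9 * (1 / (B * B)) := by
          rw [mul_one_div, le_div_iff₀ (by positivity)]
          calc 8 * (B : ℝ) ^ 6 * (B * B) = 8 * (B : ℝ) ^ 8 := by ring
            _ ≤ B * (B : ℝ) ^ 8 := by gcongr
            _ = _ := by ring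
      _ ≤ (B : ℝ) ^ 9 * (1 / (n * l)) := by gcongr
      _ ≤ _ := by gcongr
  rw [hybridPhase, run_seq, show (natConst rAut 0).run E S = PMF.pure _ from rfl, PMF.pure_bind,
    run_seq, show (ringZero (aMask, rZero)).run E (S.tick.setNat rAut 0) = PMF.pure _ from rfl,
    PMF.pure_bind, run_loop]
  set S' := ((S.tick.setNat rAut 0).tick.set (aMask, rZero) 0) with hS'
  have hS : S' ∈ ((seq (natConst rAut 0) (ringZero (aMask, rZero))).run E S).support := by
    simp [run, hS']
  have P' := hP.frame (c := seq (natConst rAut 0) (ringZero (aMask, rZero))) (by decide) rfl hS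
  rw [P'.deg]
  refine (failProb_mono fun T _ hT => ?_).trans (failProb_iter_le (I := I) (k := n)
    (g := fun T => hybridBlock.run E T.tick) (fun i hi T hT => ?_) (a := S'.tick) ?_)
  · exact ⟨hT.1, hT.2.2.2.2 hgap⟩
  · obtain ⟨hP, hk, he, hM, hD⟩ := hT
    refine (failProb_mono fun U hU h => ?_).trans
      (hybridBlock_spec hs hB hi hP.tick hk he hM)
    obtain ⟨h1, h2, h3⟩ := h
    refine ⟨hP.tick.frame (c := hybridBlock) (by decide) rfl hU, h1,
      (congrFun (ring_eq_of_writesRing E (c := hybridBlock) rfl hU) 0).trans he, h2, ?_⟩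
    rintro ⟨k, hk, hgap⟩
    rcases h3 with h3 | ⟨e1, e2, e3, h3⟩
    · exact h3
    · rw [e1, e2, e3]
      refine hD ⟨k, lt_of_le_of_ne (Nat.lt_succ_iff.1 hk) ?_, hgap⟩
      rintro rfl
      exact absurd h3 (not_lt.2 hgap)
  · refine ⟨P'.tick, ?_, ?_, ?_, ?_⟩
    · simp [S', State.tick, State.set, State.setNat]
    · exact (congrFun (ring_eq_of_writesRing E
        (c := seq (natConst rAut 0) (ringZero (aMask, rZero))) rfl hS) 0).trans he
    · simp [S', State.tick, State.set, State.setNat, hP.zero, covered, indicator_empty]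
    · rintro ⟨k, hk, -⟩
      omega

end Search

/-! ### Guessing a component of the secret -/

section Guess

variable {R : Type*} [CommRing R] [Fintype R] {E : Access R} {n Q B : ℕ}
  {χ : PMF R} {s : R} {ι : Type*} [Fintype ι] [DecidableEq ι] {F : ι → Type*}
  [∀ i, Field (F i)] [∀ i, Fintype (F i)] {φ : R ≃+* ∀ i, F i} {σ : ℕ → R →+* R} {π : ℕ → ι → ι}

/-- A guess is kept as the current value if its estimate is close to that of the stored hybrid. -/
def acceptBlock : Program :=
  seq (distBlock rCount rFound) <|
  seq (natSub rTemp rNear rDiff) <|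
  ifNatZero rTemp (natConst rTemp 0)
    (ringAdd (aValue, rZero) (aParGuess, rZero) (aZero, rZero))

/-- A random guess for the component of the secret is tested. -/
def tryBlock : Program :=
  seq (ringRand (aX, rZero)) <|
  seq (ringMul (aParGuess, rZero) (aFoundPart, rZero) (aX, rZero)) <|
  seq estimate acceptBlock

/-- The arguments of the estimates for the guesses. -/
def copyBlock : Program :=
  seq (ringAdd (aParMask, rZero) (aFoundMask, rZero) (aZero, rZero))
    (ringAdd (aParPart, rZero) (aFoundPart, rZero) (aZero, rZero))

/-- The current automorphism is undone, by applying it `n - 1` more times. -/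
def undoBlock : Program :=
  seq (ringAdd (aImage, rZero) (aFoundPart, rZero) (aZero, rZero)) <|
  loop rDegPred <| seq (ringAut (aImage, rZero) rAut (aImage, rZero))
    (ringAut (aValue, rZero) rAut (aValue, rZero))

/-- The component of the secret in `aValue` is added to the output, unless it is already there. -/
def addBlock : Program :=
  seq (ringMul (aProd, rZero) (aValue, rZero) (aCovered, rZero)) <|
  seq (ringSub (aValue, rZero) (aValue, rZero) (aProd, rZero)) <|
  seq (ringAdd (aOut, rZero) (aOut, rZero) (aValue, rZero)) <|
  seq (ringMul (aProd, rZero) (aImage, rZero) (aCovered, rZero)) <|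
  seq (ringSub (aImage, rZero) (aImage, rZero) (aProd, rZero)) <|
  seq (ringAdd (aCovered, rZero) (aCovered, rZero) (aImage, rZero)) <|
  natAdd rAut rAut rOne

/-- One component of the secret is found and added to the output. -/
def guessBlock : Program :=
  seq copyBlock <| seq (loop rGuesses tryBlock) <| seq undoBlock addBlock

/-- All components of the secret are found. -/
def guessPhase : Program :=
  seq (natConst rAut 0) <| seq (ringZero (aOut, rZero)) <| seq (ringZero (aCovered, rZero)) <|
  loop rDeg guessBlock

theorem acceptBlock_run {S T : State R} (hP : Params E n Q B S)
    (hT : T ∈ (acceptBlock.run E S).support) :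
    if (S.nat rFound - S.nat rCount) + (S.nat rCount - S.nat rFound) < 2 * B ^ 6 then
      T.ring aValue 0 = S.ring aParGuess 0 else T.ring aValue 0 = S.ring aValue 0 := by
  simp only [acceptBlock, distBlock, run, PMF.pure_bind] at hT
  split_ifs at hT with h <;>
    simp only [PMF.mem_support_pure_iff] at hT <;> subst hT <;>
    simp [State.tick, State.setNat, hP.near, Nat.sub_eq_zero_iff_le] at h <;>
    simp [State.tick, State.set, State.setNat, State.get, hP.zero, hP.ringZero, h, -not_lt,
      not_lt.2]

theorem copyBlock_run {S T : State R} (hP : Params E n Q B S)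
    (hT : T ∈ (copyBlock.run E S).support) :
    T.ring aParMask 0 = S.ring aFoundMask 0 ∧ T.ring aParPart 0 = S.ring aFoundPart 0 := by
  simp only [copyBlock, run, PMF.pure_bind, PMF.mem_support_pure_iff] at hT
  subst hT
  simp [State.tick, State.set, State.get, hP.zero, hP.ringZero]

theorem undoBlock_run {S T : State R} (hP : Params E n Q B S)
    (hT : T ∈ (undoBlock.run E S).support) :
    T.ring aImage 0 = (E.aut (S.nat rAut))^[n - 1] (S.ring aFoundPart 0) ∧
      T.ring aValue 0 = (E.aut (S.nat rAut))^[n - 1] (S.ring aValue 0) := by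
  rw [undoBlock, run_seq, show (ringAdd (aImage, rZero) (aFoundPart, rZero) (aZero, rZero)).run E S =
    PMF.pure _ from rfl, PMF.pure_bind, run_loop] at hT
  have h := iter_invariant (I := fun l T => T.nat = S.nat ∧
    T.ring aImage 0 = (E.aut (S.nat rAut))^[l] (S.ring aFoundPart 0) ∧
      T.ring aValue 0 = (E.aut (S.nat rAut))^[l] (S.ring aValue 0)) ?_ ?_ T hT
  · rw [show (S.tick.set (aImage, rZero) (S.get (aFoundPart, rZero) +
      S.get (aZero, rZero))).nat rDegPred = n - 1 from hP.degPred] at h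
    exact h.2
  · rintro l - U ⟨h1, h2, h3⟩ V hV
    simp only [run, PMF.pure_bind, PMF.mem_support_pure_iff] at hV
    subst hV
    simp only [Function.iterate_succ_apply', ← h2, ← h3]
    simp [State.tick, State.set, State.get, h1, hP.zero]
  · simp [State.tick, State.set, State.get, hP.zero, hP.ringZero]

theorem addBlock_run {S T : State R} (hP : Params E n Q B S)
    (hT : T ∈ (addBlock.run E S).support) :
    T.nat rAut = S.nat rAut + 1 ∧
      T.ring aOut 0 = S.ring aOut 0 + (S.ring aValue 0 - S.ring aValue 0 * S.ring aCovered 0) ∧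
      T.ring aCovered 0 =
        S.ring aCovered 0 + (S.ring aImage 0 - S.ring aImage 0 * S.ring aCovered 0) := by
  simp only [addBlock, run, PMF.pure_bind, PMF.mem_support_pure_iff] at hT
  subst hT
  simp [State.tick, State.set, State.setNat, State.get, hP.zero, hP.one]

/-- The memory during the tests of guesses. -/
structure Guessing (E : Access R) (n Q B i : ℕ) (M d : R) (c : ℕ) (S : State R) : Prop where
  params : Params E n Q B S
  aut : S.nat rAut = i
  parMask : S.ring aParMask 0 = M
  parPart : S.ring aParPart 0 = d
  part : S.ring aFoundPart 0 = d
  found : S.nat rFound = c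

theorem Guessing.frame {i c : ℕ} {M d : R} {S T : State R} (h : Guessing E n Q B i M d c S)
    {p : Program} (hp : ∀ r < 22, p.writesNat r = false) (hz : p.writesRing aZero = false)
    (h1 : p.writesNat rAut = false) (h2 : p.writesNat rFound = false)
    (h3 : p.writesRing aParMask = false) (h4 : p.writesRing aParPart = false)
    (h5 : p.writesRing aFoundPart = false)
    (hT : T ∈ (p.run E S).support) : Guessing E n Q B i M d c T where
  params := h.params.frame hp hz hT
  aut := (nat_eq_of_writesNat E h1 hT).trans h.aut
  parMask := (congrFun (ring_eq_of_writesRing E h3 hT) 0).trans h.parMask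
  parPart := (congrFun (ring_eq_of_writesRing E h4 hT) 0).trans h.parPart
  part := (congrFun (ring_eq_of_writesRing E h5 hT) 0).trans h.part
  found := (nat_eq_of_writesNat E h2 hT).trans h.found

omit [Fintype ι] in
/-- A tested guess becomes the current value exactly if it is correct, up to the failure probability
of an estimate: the acceptance probabilities of a correct and of a wrong guess differ by more than
`4 B ^ 6`, and both the estimate and the stored value are off by less than `B ^ 6`. -/
theorem acceptBlock_spec (hs : Splitting φ E χ s n Q σ π) (hB : 8 ≤ B) {i c : ℕ} (hi : i < n)
    {M d x : R} (hD : Distinguished φ χ E.oracle B M d c) {S : State R}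
    (hS : Guessing E n Q B i M d c S) (hx : S.ring aParGuess 0 = d * x) :
    failProb ((seq estimate acceptBlock).run E S) (fun T =>
      (d * x = d * σ i s → T.ring aValue 0 = d * x) ∧
      (d * x ≠ d * σ i s → T.ring aValue 0 = S.ring aValue 0)) ≤ (1 / 2) ^ (6 * B) := by
  obtain ⟨j, t, rfl, rfl, hj, hc, hgap⟩ := hD
  have hgood : GoodAut E χ s (S.nat rAut) (σ i) := by
    rw [hS.aut]
    exact hs.good i hi
  have hmul : (B : ℝ) ^ 9 * |level φ χ E.oracle t - level φ χ E.oracle (t ∪ {j})| =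
      |(B : ℝ) ^ 9 * level φ χ E.oracle t - (B : ℝ) ^ 9 * level φ χ E.oracle (t ∪ {j})| := by
    rw [← mul_sub, abs_mul, abs_of_nonneg (by positivity : (0 : ℝ) ≤ (B : ℝ) ^ 9)]
  rw [hmul, lt_abs] at hgap
  have main : ∀ T U : State R, T ∈ (estimate.run E S).support → U ∈ (acceptBlock.run E T).support →
      if |(T.nat rCount : ℝ) - c| < 2 * (B : ℝ) ^ 6 then U.ring aValue 0 = indicator φ {j} * x
      else U.ring aValue 0 = S.ring aValue 0 := by
    intro T U hT hU
    have h := acceptBlock_run (hS.params.frame (c := estimate) (by decide) rfl hT) hU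
    rw [nat_eq_of_writesNat (r := rFound) E rfl hT, hS.found,
      ring_eq_of_writesRing (r := aParGuess) E rfl hT, hx,
      ring_eq_of_writesRing (r := aValue) E rfl hT] at h
    have hdist : ((c - T.nat rCount + (T.nat rCount - c) : ℕ) : ℝ) = |(T.nat rCount : ℝ) - c| := by
      rcases le_total (T.nat rCount) c with h | h
      · rw [Nat.sub_eq_zero_of_le h, add_zero, Nat.cast_sub h, abs_sub_comm, abs_of_nonneg]
        exact sub_nonneg.2 (by exact_mod_cast h)
      · rw [Nat.sub_eq_zero_of_le h, zero_add, Nat.cast_sub h, abs_of_nonneg]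
        exact sub_nonneg.2 (by exact_mod_cast h)
    rw [← hdist]
    convert h using 1
    norm_cast
  rw [abs_lt] at hc
  rw [run_seq, ← add_zero ((1 / 2 : ℝ≥0∞) ^ (6 * B))]
  by_cases hxs : indicator φ {j} * x = indicator φ {j} * σ i s
  · refine failProb_bind_le (estimate_spec hS.params hgood hB hS.parMask hS.parPart hx
      (trial_true_of_eq χ E.oracle hxs)) fun T hT hest => (failProb_eq_zero fun U hU => ?_).le
    change |_ - _ * level φ χ E.oracle t| < _ at hest
    have h := main T U hT hU
    rw [abs_lt] at hest
    rw [if_pos (abs_lt.2 ⟨by linarith, by linarith⟩)] at h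
    exact ⟨fun _ => h, fun h' => absurd hxs h'⟩
  · have hE : indicator φ t * indicator φ {j} = 0 := by
      rw [indicator_mul, Finset.inter_singleton_of_notMem hj, indicator_empty]
    refine failProb_bind_le (estimate_spec hS.params hgood hB hS.parMask hS.parPart hx
      (trial_true_of_ne φ χ E.oracle hE hxs)) fun T hT hest => (failProb_eq_zero fun U hU => ?_).le
    rw [← Finset.sdiff_eq_self_of_disjoint (Finset.disjoint_singleton_left.2 hj),
      indicator_add_sdiff] at hest
    change |_ - _ * level φ χ E.oracle (t ∪ {j})| < _ at hest
    have h := main T U hT hU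
    rw [abs_lt] at hest
    rw [if_neg] at h
    · exact ⟨fun h' => absurd h' hxs, fun _ => h⟩
    · rw [not_lt, le_abs]
      rcases hgap with hgap | hgap
      · exact .inr (by linarith)
      · exact .inl (by linarith)

omit [Fintype ι] in
/-- A random guess is correct with probability `1 / Q`, and a correct value that has been found stays. -/
theorem tryBlock_spec (hs : Splitting φ E χ s n Q σ π) (hB : 8 ≤ B) {i c : ℕ} (hi : i < n)
    {M d : R} (hD : Distinguished φ χ E.oracle B M d c) {S : State R}
    (hS : Guessing E n Q B i M d c S) :
    failProb (tryBlock.run E S) (fun T => T.ring aValue 0 = d * σ i s) ≤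
        1 - (Q : ℝ≥0∞)⁻¹ + (1 / 2) ^ (6 * B) ∧
      (S.ring aValue 0 = d * σ i s →
        failProb (tryBlock.run E S) (fun T => T.ring aValue 0 = d * σ i s) ≤ (1 / 2) ^ (6 * B)) := by
  set g : R → State R := fun x => (S.tick.set (aX, rZero) x).tick.set (aParGuess, rZero) (d * x)
  have hrun : tryBlock.run E S =
      (PMF.uniformOfFintype R).bind fun x => (seq estimate acceptBlock).run E (g x) := by
    simp only [tryBlock, run_seq, run, PMF.bind_map, PMF.pure_bind, Function.comp_def, g]
    congr 1
    ext1 x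
    congr 2
    simp [State.get, State.set, State.tick, hS.params.zero, hS.part]
  have hg : ∀ x, Guessing E n Q B i M d c (g x) ∧ (g x).ring aParGuess 0 = d * x ∧
      (g x).ring aValue 0 = S.ring aValue 0 := fun x => by
    refine ⟨⟨?_, hS.aut, hS.parMask, hS.parPart, hS.part, hS.found⟩, ?_, rfl⟩
    · obtain ⟨_, _, _, _, _, _, _, _, _, _, _, _⟩ := hS.params
      constructor <;> assumption
    · simp [g, State.set, State.tick, hS.params.zero]
  rw [hrun]
  constructor
  · obtain ⟨j, t, hdj, -⟩ := id hD
    refine failProb_bind_le (Φ := fun x => φ x j = φ (σ i s) j) (le_of_eq ?_) fun x _ hx => ?_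
    · have hsurj : Function.Surjective (fun x => φ x j) := fun y =>
        ⟨φ.symm (Pi.single j y), by simp⟩
      have h := failProb_uniform_eq (φ (σ i s) j)
      rwa [← map_uniform_of_surjective (((Pi.evalRingHom F j).comp φ.toRingHom : R →+* F j) : R →+ F j)
        hsurj, failProb_map, hs.card] at h
    · have hx' : d * x = d * σ i s := by
        rw [hdj]
        exact (indicator_singleton_mul_eq φ).2 hx
      exact (failProb_mono fun T _ hT => (hT.1 hx').trans hx').trans
        (acceptBlock_spec hs hB hi hD (hg x).1 (hg x).2.1)
  · intro hv
    refine failProb_bind_le_of_forall fun x _ => ?_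
    refine (failProb_mono fun T _ hT => ?_).trans
      (acceptBlock_spec hs hB hi hD (hg x).1 (hg x).2.1)
    by_cases hx : d * x = d * σ i s
    · exact (hT.1 hx).trans hx
    · exact (hT.2 hx).trans ((hg x).2.2.trans hv)

omit [Fintype R] [Fintype ι] [∀ i, Fintype (F i)] in
theorem iterate_indicator {f : R →+* R} {p : ι → ι}
    (h : ∀ j, f (indicator φ {j}) = indicator φ {p j}) (l : ℕ) (j : ι) :
    f^[l] (indicator φ {j}) = indicator φ {p^[l] j} := by
  induction l generalizing j with
  | zero => rfl
  | succ l ih => rw [Function.iterate_succ_apply, h, ih, Function.iterate_succ_apply]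

/-- The memory during the guess phase: the stored hybrid, and the components of the secret that have
been found after `i` automorphisms. -/
structure Assembling (φ : R ≃+* ∀ i, F i) (E : Access R) (n Q B : ℕ) (s : R) (M d : R) (c : ℕ)
    (ρ : ℕ → ι → ι) (j : ι) (i : ℕ) (S : State R) : Prop where
  params : Params E n Q B S
  aut : S.nat rAut = i
  mask : S.ring aFoundMask 0 = M
  part : S.ring aFoundPart 0 = d
  found : S.nat rFound = c
  covered : S.ring aCovered 0 = indicator φ (covered ρ j i)
  out : S.ring aOut 0 = s * indicator φ (RLWE.covered ρ j i)

omit [Fintype ι] in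
/-- The guesses find the component `d * σ i s` of the secret `σ i s`. Applying `σ i` another `n - 1`
times inverts it, which yields the component of `s` at the idempotent `(σ i)⁻¹ d`. -/
theorem guessBlock_spec (hs : Splitting φ E χ s n Q σ π) (hB : 8 ≤ B) {i c : ℕ} (hi : i < n)
    {M d : R} (hD : Distinguished φ χ E.oracle B M d c) {j : ι} (hd : d = indicator φ {j})
    {S : State R} (hS : Assembling φ E n Q B s M d c (fun k => (π k)^[n - 1]) j i S) :
    failProb (guessBlock.run E S) (Assembling φ E n Q B s M d c (fun k => (π k)^[n - 1]) j (i + 1)) ≤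
      (B ^ 3 : ℕ) * (1 / 2) ^ (6 * B) + (1 - (Q : ℝ≥0∞)⁻¹ + (1 / 2) ^ (6 * B)) ^ (B ^ 3) := by
  rw [guessBlock, run_seq]
  refine failProb_bind_le_of_forall fun T₁ h₁ => ?_
  have P₁ := hS.params.frame (c := copyBlock) (by decide) rfl h₁
  obtain ⟨hpM, hpd⟩ := copyBlock_run hS.params h₁
  have n₁ := fun r h => nat_eq_of_writesNat (c := copyBlock) (r := r) E h h₁
  have r₁ := fun r h => ring_eq_of_writesRing (c := copyBlock) (r := r) E h h₁
  have G₁ : Guessing E n Q B i M d c T₁ := ⟨P₁, (n₁ _ rfl).trans hS.aut, hpM.trans hS.mask,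
    hpd.trans hS.part, (congrFun (r₁ _ rfl) 0).trans hS.part, (n₁ _ rfl).trans hS.found⟩
  have tick : ∀ {T : State R}, Guessing E n Q B i M d c T → Guessing E n Q B i M d c T.tick :=
    fun h => ⟨h.params.tick, h.aut, h.parMask, h.parPart, h.part, h.found⟩
  rw [run_seq, ← add_zero (((B ^ 3 : ℕ) : ℝ≥0∞) * (1 / 2) ^ (6 * B) + _)]
  refine failProb_bind_le (Φ := fun T => T.ring aValue 0 = d * σ i s) ?_ fun T₂ h₂ hv => ?_
  · rw [run_loop, P₁.guesses]
    exact failProb_iter_goal_le (I := Guessing E n Q B i M d c)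
      (fun T hT U hU => (tick hT).frame (p := tryBlock) (by decide) rfl rfl rfl rfl rfl rfl hU)
      (fun T hT hv => (tryBlock_spec hs hB hi hD (tick hT)).2 hv)
      (fun T hT => (tryBlock_spec hs hB hi hD (tick hT)).1) _ (tick G₁)
  have P₂ := P₁.frame (c := loop rGuesses tryBlock) (by decide) rfl h₂
  have n₂ := fun r h => nat_eq_of_writesNat (c := loop rGuesses tryBlock) (r := r) E h h₂
  have r₂ := fun r h => ring_eq_of_writesRing (c := loop rGuesses tryBlock) (r := r) E h h₂
  rw [run_seq]
  refine failProb_bind_le_of_forall fun T₃ h₃ => (failProb_eq_zero fun T h => ?_).le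
  have P₃ := P₂.frame (c := undoBlock) (by decide) rfl h₃
  have n₃ := fun r h => nat_eq_of_writesNat (c := undoBlock) (r := r) E h h₃
  have r₃ := fun r h => ring_eq_of_writesRing (c := undoBlock) (r := r) E h h₃
  have P₄ := P₃.frame (c := addBlock) (by decide) rfl h
  have n₄ := fun r h' => nat_eq_of_writesNat (c := addBlock) (r := r) E h' h
  have r₄ := fun r h' => ring_eq_of_writesRing (c := addBlock) (r := r) E h' h
  obtain ⟨hw, hv₃⟩ := undoBlock_run P₂ h₃
  obtain ⟨hk, hout, hcov⟩ := addBlock_run P₃ h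
  have k₂ : T₂.nat rAut = i := (n₂ _ rfl).trans G₁.aut
  have hn : (n - 1).succ = n := by omega
  rw [k₂, (hs.good i hi).aut, r₂ _ rfl, G₁.part, hd, iterate_indicator (hs.perm i hi)] at hw
  rw [k₂, (hs.good i hi).aut, hv, iterate_map_mul, hd, iterate_indicator (hs.perm i hi),
    ← Function.iterate_succ_apply, hn, hs.iterate i hi] at hv₃
  have hC : T₃.ring aCovered 0 = indicator φ (RLWE.covered (fun k => (π k)^[n - 1]) j i) := by
    rw [r₃ _ rfl, r₂ _ rfl, r₁ _ rfl, hS.covered]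
  have hO : T₃.ring aOut 0 = s * indicator φ (RLWE.covered (fun k => (π k)^[n - 1]) j i) := by
    rw [r₃ _ rfl, r₂ _ rfl, r₁ _ rfl, hS.out]
  have hsucc : indicator φ (RLWE.covered (fun k => (π k)^[n - 1]) j (i + 1)) =
      T₃.ring aCovered 0 + (T₃.ring aImage 0 - T₃.ring aImage 0 * T₃.ring aCovered 0) := by
    rw [hw, hC, indicator_sub_mul, indicator_add_sdiff, covered_succ]
  refine ⟨P₄, ?_, ?_, ?_, ?_, ?_, ?_⟩
  · rw [hk, n₃ _ rfl, k₂]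
  · rw [r₄ _ rfl, r₃ _ rfl, r₂ _ rfl, r₁ _ rfl, hS.mask]
  · rw [r₄ _ rfl, r₃ _ rfl, r₂ _ rfl, r₁ _ rfl, hS.part]
  · rw [n₄ _ rfl, n₃ _ rfl, n₂ _ rfl, n₁ _ rfl, hS.found]
  · rw [hsucc, hcov]
  · rw [hsucc, hout, hO, ← hC, hv₃, hw]
    ring

theorem guessPhase_spec (hs : Splitting φ E χ s n Q σ π) (hB : 8 ≤ B) {S : State R}
    (hP : Params E n Q B S)
    (hD : Distinguished φ χ E.oracle B (S.ring aFoundMask 0) (S.ring aFoundPart 0) (S.nat rFound)) :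
    failProb (guessPhase.run E S) (fun T => T.output = s) ≤
      n * ((B ^ 3 : ℕ) * (1 / 2) ^ (6 * B) +
        (1 - (Q : ℝ≥0∞)⁻¹ + (1 / 2) ^ (6 * B)) ^ (B ^ 3)) := by
  obtain ⟨j, t, hd, -⟩ := id hD
  set ρ : ℕ → ι → ι := fun k => (π k)^[n - 1]
  -- `(π k)^[n - 1]` is the inverse of `π k`, so it maps `j` to `i` if `π k` maps `i` to `j`.
  have huniv : covered ρ j n = Finset.univ := by
    ext i
    obtain ⟨k, hk, hi⟩ := hs.trans i j
    simp only [covered, Finset.mem_image, Finset.mem_range, Finset.mem_univ, iff_true]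
    refine ⟨k, hk, ?_⟩
    have h := iterate_indicator (hs.perm k hk) n i
    rw [hs.iterate k hk, (indicator_injective φ).eq_iff, Finset.singleton_inj] at h
    conv_rhs => rw [h]
    rw [← hi]
    change (π k)^[n - 1] (π k i) = _
    rw [← Function.iterate_succ_apply, show (n - 1).succ = n by omega]
  rw [guessPhase, run_seq, show (natConst rAut 0).run E S = PMF.pure _ from rfl, PMF.pure_bind,
    run_seq, show (ringZero (aOut, rZero)).run E (S.tick.setNat rAut 0) = PMF.pure _ from rfl,
    PMF.pure_bind, run_seq, show (ringZero (aCovered, rZero)).run E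
      ((S.tick.setNat rAut 0).tick.set (aOut, rZero) 0) = PMF.pure _ from rfl,
    PMF.pure_bind, run_loop]
  set S' := ((S.tick.setNat rAut 0).tick.set (aOut, rZero) 0).tick.set (aCovered, rZero) 0 with hS'
  have hS : S' ∈ ((seq (natConst rAut 0) (seq (ringZero (aOut, rZero))
      (ringZero (aCovered, rZero)))).run E S).support := by
    simp [run, hS']
  have P' := hP.frame (c := seq (natConst rAut 0) (seq (ringZero (aOut, rZero))
      (ringZero (aCovered, rZero)))) (by decide) rfl hS
  rw [P'.deg]
  refine (failProb_mono fun T _ hT => ?_).trans (failProb_iter_le (k := n)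
    (I := Assembling φ E n Q B s (S.ring aFoundMask 0) (S.ring aFoundPart 0) (S.nat rFound) ρ j)
    (g := fun T => guessBlock.run E T.tick) (fun i hi T hT => ?_) (a := S'.tick) ?_)
  · rw [State.output, hT.out, huniv, indicator_univ, mul_one]
  · exact guessBlock_spec hs hB hi hD hd ⟨hT.params.tick, hT.aut, hT.mask, hT.part, hT.found,
      hT.covered, hT.out⟩
  · refine ⟨P'.tick, ?_, rfl, rfl, ?_, ?_, ?_⟩
    · simp [S', State.tick, State.set, State.setNat]
    · simp [S', State.tick, State.set, State.setNat]
    · simp [S', State.tick, State.set, State.setNat, hP.zero, RLWE.covered, indicator_empty]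
    · simp [S', State.tick, State.set, State.setNat, hP.zero, RLWE.covered, indicator_empty]

end Guess

/-! ### The whole reduction -/

section Total

variable {R : Type*} [CommRing R] [Fintype R] {E : Access R} {n Q B : ℕ}
  {χ : PMF R} {s : R} {ι : Type*} [Fintype ι] [DecidableEq ι] {F : ι → Type*}
  [∀ i, Field (F i)] [∀ i, Fintype (F i)] {φ : R ≃+* ∀ i, F i} {σ : ℕ → R →+* R} {π : ℕ → ι → ι}

/-- Register `dst` becomes the power of register `base` by register `expo`, by repeated multiplication,
which in turn is repeated addition. -/
def powBlock (dst base expo : ℕ) : Program :=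
  seq (natConst dst 1) <| loop expo <|
    seq (natConst rTemp 0) <| seq (loop base (natAdd rTemp rTemp dst)) (natAdd dst rTemp rZero)

/-- The numbers that only depend on the degree and on the cardinality of the residue fields. -/
def cardBlock : Program :=
  seq (powBlock rCard rPrime rInertia) <|
  seq (natConst rOne 1) <|
  seq (natSub rCardPred rCard rOne) <|
  seq (natSub rDegPred rDeg rOne) <|
  seq (natConst rBase 8) <|
  seq (natAdd rBase rBase rDeg) <|
  seq (natAdd rBase rBase rCard) <|
  seq (natAdd rBase rBase rAdvantage) <|
  seq (natAdd rBase rBase rSecurity) <|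
  seq (natConst rFour 4) <|
  seq (natConst rThree 3) <|
  seq (natConst rSix 6) (natConst rNine 9)

/-- The repetition counts and the thresholds. -/
def countBlock : Program :=
  seq (powBlock rSplits rBase rFour) <|
  seq (powBlock rGuesses rBase rThree) <|
  seq (powBlock rUnit rBase rSix) <|
  seq (powBlock rTrials rBase rNine) <|
  seq (natAdd rNear rUnit rUnit) <|
  seq (natAdd rFar rNear rNear) (natAdd rFar rFar rNear)

/-- The three phases after the computation of the parameters. -/
def mainPart : Program := seq splitPhase (seq hybridPhase guessPhase)

/-- The reduction from search RLWE to decision RLWE. -/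
def reduction : Program := seq cardBlock (seq countBlock mainPart)

theorem powBlock_run {dst base expo : ℕ} (h1 : dst ≠ rTemp) (h2 : base ≠ dst)
    (h3 : base ≠ rTemp) (h4 : expo ≠ dst) (h5 : rZero ≠ dst)
    {S T : State R} (h0 : S.nat rZero = 0) (hT : T ∈ ((powBlock dst base expo).run E S).support) :
    T.nat dst = S.nat base ^ S.nat expo := by
  rw [powBlock, run_seq, show (natConst dst 1).run E S = PMF.pure _ from rfl, PMF.pure_bind,
    run_loop] at hT
  have h := iter_invariant (I := fun l T => T.nat dst = S.nat base ^ l ∧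
    T.nat base = S.nat base ∧ T.nat rZero = 0) ?_ ?_ T hT
  · rw [h.1]
    simp [State.setNat, State.tick, h4]
  · rintro l - U ⟨hU1, hU2, hU3⟩ V hV
    rw [run_seq, show (natConst rTemp 0).run E U.tick = PMF.pure _ from rfl, PMF.pure_bind,
      run_seq, PMF.mem_support_bind_iff] at hV
    obtain ⟨W, hW, hV⟩ := hV
    rw [run_loop] at hW
    have h := iter_invariant (I := fun k T => T.nat rTemp = k * U.nat dst ∧
      T.nat dst = U.nat dst ∧ T.nat base = U.nat base ∧ T.nat rZero = 0) ?_ ?_ W hW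
    · simp only [run, PMF.mem_support_pure_iff] at hV
      subst hV
      simp only [State.setNat, State.tick, ne_eq, h3, not_false_eq_true, Function.update_of_ne] at h
      simp [State.setNat, State.tick, h2, h5, h.1, h.2.2.1, h.2.2.2, hU1, hU2, pow_succ, mul_comm]
    · rintro k - X ⟨hX1, hX2, hX3, hX4⟩ Y hY
      simp only [run, PMF.mem_support_pure_iff] at hY
      subst hY
      simp [State.setNat, State.tick, h1, h3, hX1, hX2, hX3, hX4]
      ring
    · simp [State.setNat, State.tick, h1, h3, hU3]
  · simp [State.setNat, State.tick, h2, h5, h0]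

theorem cardBlock_run {S T : State R} (h0 : S.nat rZero = 0)
    (hT : T ∈ (cardBlock.run E S).support) :
    T.nat rCardPred = S.nat rPrime ^ S.nat rInertia - 1 ∧ T.nat rDegPred = S.nat rDeg - 1 ∧
      T.nat rBase = 8 + S.nat rDeg + S.nat rPrime ^ S.nat rInertia + S.nat rAdvantage +
        S.nat rSecurity ∧
      T.nat rFour = 4 ∧ T.nat rThree = 3 ∧ T.nat rSix = 6 ∧ T.nat rNine = 9 ∧ T.nat rOne = 1 := by
  rw [cardBlock, run_seq, PMF.mem_support_bind_iff] at hT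
  obtain ⟨U, hU, hT⟩ := hT
  have hQ := powBlock_run (by norm_num) (by norm_num) (by norm_num) (by norm_num) (by norm_num) h0 hU
  have n := fun r h => nat_eq_of_writesNat (c := powBlock rCard rPrime rInertia) (r := r) E h hU
  simp only [run, PMF.pure_bind, PMF.mem_support_pure_iff] at hT
  subst hT
  simp [State.setNat, State.tick, hQ, n rDeg rfl, n rAdvantage rfl, n rSecurity rfl]

theorem countBlock_run {S T : State R} (h0 : S.nat rZero = 0) (h4 : S.nat rFour = 4)
    (h3 : S.nat rThree = 3) (h6 : S.nat rSix = 6) (h9 : S.nat rNine = 9)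
    (hT : T ∈ (countBlock.run E S).support) :
    T.nat rSplits = S.nat rBase ^ 4 ∧ T.nat rGuesses = S.nat rBase ^ 3 ∧
      T.nat rTrials = S.nat rBase ^ 9 ∧ T.nat rFar = 6 * S.nat rBase ^ 6 ∧
      T.nat rNear = 2 * S.nat rBase ^ 6 := by
  simp only [countBlock, run_seq, PMF.mem_support_bind_iff] at hT
  obtain ⟨U₁, hU₁, U₂, hU₂, U₃, hU₃, U₄, hU₄, hT⟩ := hT
  have n₁ := fun r h => nat_eq_of_writesNat (c := powBlock rSplits rBase rFour) (r := r) E h hU₁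
  have n₂ := fun r h => nat_eq_of_writesNat (c := powBlock rGuesses rBase rThree) (r := r) E h hU₂
  have n₃ := fun r h => nat_eq_of_writesNat (c := powBlock rUnit rBase rSix) (r := r) E h hU₃
  have n₄ := fun r h => nat_eq_of_writesNat (c := powBlock rTrials rBase rNine) (r := r) E h hU₄
  have e₁ := powBlock_run (by norm_num) (by norm_num) (by norm_num) (by norm_num) (by norm_num)
    h0 hU₁
  have e₂ := powBlock_run (by norm_num) (by norm_num) (by norm_num) (by norm_num) (by norm_num)
    ((n₁ _ rfl).trans h0) hU₂
  have e₃ := powBlock_run (by norm_num) (by norm_num) (by norm_num) (by norm_num) (by norm_num)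
    ((n₂ _ rfl).trans ((n₁ _ rfl).trans h0)) hU₃
  have e₄ := powBlock_run (by norm_num) (by norm_num) (by norm_num) (by norm_num) (by norm_num)
    ((n₃ _ rfl).trans ((n₂ _ rfl).trans ((n₁ _ rfl).trans h0))) hU₄
  rw [h4] at e₁
  rw [n₁ _ rfl, n₁ _ rfl, h3] at e₂
  rw [n₂ _ rfl, n₂ _ rfl, n₁ _ rfl, n₁ _ rfl, h6] at e₃
  rw [n₃ _ rfl, n₃ _ rfl, n₂ _ rfl, n₂ _ rfl, n₁ _ rfl, n₁ _ rfl, h9] at e₄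
  have e₁' : U₄.nat rSplits = S.nat rBase ^ 4 := by rw [n₄ _ rfl, n₃ _ rfl, n₂ _ rfl, e₁]
  have e₂' : U₄.nat rGuesses = S.nat rBase ^ 3 := by rw [n₄ _ rfl, n₃ _ rfl, e₂]
  have e₃' : U₄.nat rUnit = S.nat rBase ^ 6 := by rw [n₄ _ rfl, e₃]
  obtain ⟨V₁, hV₁, V₂, hV₂, hT⟩ := hT
  simp only [run, PMF.mem_support_pure_iff] at hV₁ hV₂ hT
  subst hV₁ hV₂ hT
  simp [State.setNat, State.tick, e₁', e₂', e₃', e₄]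
  constructor <;> ring

theorem params_of_init {n q f m l κ : ℕ} (hm : E.m = m) {T U : State R}
    (hT : T ∈ (cardBlock.run E (State.init [n, q, f, m, l, κ])).support)
    (hU : U ∈ (countBlock.run E T).support) :
    Params E n (q ^ f) (8 + n + q ^ f + l + κ) U := by
  obtain ⟨c1, c2, c3, c4, c5, c6, c7, c8⟩ := cardBlock_run rfl hT
  have nT := fun r h => nat_eq_of_writesNat (c := cardBlock) (r := r) E h hT
  obtain ⟨d1, d2, d3, d4, d5⟩ := countBlock_run ((nT _ rfl).trans rfl) c4 c5 c6 c7 hU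
  have nU := fun r h => nat_eq_of_writesNat (c := countBlock) (r := r) E h hU
  rw [c3] at d1 d2 d3 d4 d5
  refine ⟨(nU _ rfl).trans (nT _ rfl), ((nU _ rfl).trans (nT _ rfl)).trans hm.symm,
    (nU _ rfl).trans (nT _ rfl), (nU _ rfl).trans c1, (nU _ rfl).trans c2, d1, d2, d3, d4, d5,
    (nU _ rfl).trans c8, ?_⟩
  rw [ring_eq_of_writesRing (c := countBlock) E rfl hU,
    ring_eq_of_writesRing (c := cardBlock) E rfl hT]
  rfl

/-- `(1 - 1 / M) ^ k` is small as soon as `k` is a large multiple of `M`. -/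
theorem one_sub_inv_pow_le {M k t : ℕ} (hM : 0 < M) (h : M * t ≤ k) :
    (1 - (M : ℝ≥0∞)⁻¹) ^ k ≤ (1 / 2) ^ t := by
  have hM' : (0 : ℝ) < M := by exact_mod_cast hM
  have h1 : (M : ℝ)⁻¹ ≤ 1 := inv_le_one_of_one_le₀ (by exact_mod_cast hM)
  have e : (1 - (M : ℝ≥0∞)⁻¹) = ENNReal.ofReal (1 - (M : ℝ)⁻¹) := by
    rw [ENNReal.ofReal_sub _ (by positivity), ENNReal.ofReal_one, ENNReal.ofReal_inv_of_pos hM',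
      ENNReal.ofReal_natCast]
  have key : (1 - (M : ℝ)⁻¹) ^ M ≤ 1 / 2 := by
    calc (1 - (M : ℝ)⁻¹) ^ M ≤ (Real.exp (-(M : ℝ)⁻¹)) ^ M := by
          gcongr
          linarith [Real.add_one_le_exp (-(M : ℝ)⁻¹)]
      _ = Real.exp (-1) := by
          rw [← Real.exp_nat_mul]
          congr 1
          field_simp
      _ ≤ _ := by
          rw [Real.exp_neg, one_div]
          exact inv_anti₀ (by norm_num) (by linarith [Real.add_one_le_exp (1 : ℝ)])
  calc (1 - (M : ℝ≥0∞)⁻¹) ^ k ≤ (1 - (M : ℝ≥0∞)⁻¹) ^ (M * t) :=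
        pow_le_pow_of_le_one zero_le tsub_le_self h
    _ = (ENNReal.ofReal ((1 - (M : ℝ)⁻¹) ^ M)) ^ t := by
        rw [e, pow_mul, ENNReal.ofReal_pow (by linarith)]
    _ ≤ (ENNReal.ofReal (1 / 2)) ^ t := by gcongr
    _ = _ := by
        rw [ENNReal.ofReal_div_of_pos (by norm_num)]
        simp

theorem natCast_mul_half_pow_le (B : ℕ) (k : ℕ) : (B : ℝ≥0∞) * (1 / 2) ^ (B + k) ≤ (1 / 2) ^ k := by
  have h : (B : ℝ≥0∞) ≤ 2 ^ B := by exact_mod_cast Nat.lt_two_pow_self.le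
  calc (B : ℝ≥0∞) * (1 / 2) ^ (B + k) ≤ 2 ^ B * (1 / 2) ^ (B + k) := by gcongr
    _ = _ := by
      rw [pow_add, ← mul_assoc, ← mul_pow, one_div, ENNReal.mul_inv_cancel (by simp) (by simp),
        one_pow, one_mul]

/-- The sum of the failure probabilities of the three phases. -/
theorem total_failure_le {n Q B κ N : ℕ} (hN : N ≤ B) (hn : n ≤ B) (hQ : 1 < Q) (hQB : Q ≤ B)
    (hB : 8 ≤ B) (hκ : κ ≤ B) :
    (N : ℝ≥0∞) ^ 2 * (1 - ((Q ^ 2 : ℕ) : ℝ≥0∞)⁻¹) ^ (B ^ 4) +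
      (n * ((1 / 2) ^ (6 * B) + (1 / 2) ^ (6 * B)) +
        n * ((B ^ 3 : ℕ) * (1 / 2) ^ (6 * B) +
          (1 - (Q : ℝ≥0∞)⁻¹ + (1 / 2) ^ (6 * B)) ^ (B ^ 3))) ≤ (1 / 2) ^ κ := by
  -- The exponents `4 B` and `6 B` leave room to absorb each factor `B` into `(1 / 2) ^ B`, and what
  -- remains of each of the five terms is at most `(1 / 2) ^ (2 B)`.
  have half : ∀ {a b : ℕ}, a ≤ b → (1 / 2 : ℝ≥0∞) ^ b ≤ (1 / 2) ^ a := fun h =>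
    pow_le_pow_of_le_one zero_le (by rw [one_div]; exact ENNReal.inv_le_one.2 one_le_two) h
  have h1 : (1 - ((Q ^ 2 : ℕ) : ℝ≥0∞)⁻¹) ^ (B ^ 4) ≤ (1 / 2) ^ (4 * B) := by
    refine one_sub_inv_pow_le (by positivity) ?_
    calc Q ^ 2 * (4 * B) ≤ B ^ 2 * (B * B) := by gcongr; omega
      _ = B ^ 4 := by ring
  have h2 : 1 - (Q : ℝ≥0∞)⁻¹ + (1 / 2) ^ (6 * B) ≤ 1 - ((2 * Q : ℕ) : ℝ≥0∞)⁻¹ := by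
    have hx : (1 / 2 : ℝ≥0∞) ^ (6 * B) ≤ ((2 * Q : ℕ) : ℝ≥0∞)⁻¹ := by
      rw [one_div, ← ENNReal.inv_pow]
      refine ENNReal.inv_le_inv.2 ?_
      have : 2 * Q ≤ 2 ^ (6 * B) := by
        calc 2 * Q ≤ 2 * B := by omega
          _ ≤ 2 * 2 ^ B := by gcongr; exact Nat.lt_two_pow_self.le
          _ = 2 ^ (B + 1) := by ring
          _ ≤ _ := Nat.pow_le_pow_right (by norm_num) (by omega)
      exact_mod_cast this
    have hy : (Q : ℝ≥0∞)⁻¹ = ((2 * Q : ℕ) : ℝ≥0∞)⁻¹ + ((2 * Q : ℕ) : ℝ≥0∞)⁻¹ := by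
      rw [← two_mul, Nat.cast_mul, ENNReal.mul_inv (by simp) (by simp), ← mul_assoc, Nat.cast_two,
        ENNReal.mul_inv_cancel (by simp) (by simp), one_mul]
    have hz : (Q : ℝ≥0∞)⁻¹ ≤ 1 := ENNReal.inv_le_one.2 (by exact_mod_cast hQ.le)
    refine ENNReal.le_sub_of_add_le_right (by simp; omega) ?_
    calc 1 - (Q : ℝ≥0∞)⁻¹ + (1 / 2) ^ (6 * B) + ((2 * Q : ℕ) : ℝ≥0∞)⁻¹ ≤
          1 - (Q : ℝ≥0∞)⁻¹ + (Q : ℝ≥0∞)⁻¹ := by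
          rw [add_assoc]
          conv_rhs => rw [hy]
          rw [← hy]
          gcongr
          conv_rhs => rw [hy]
          gcongr
      _ = 1 := tsub_add_cancel_of_le hz
  have h3 : (1 - (Q : ℝ≥0∞)⁻¹ + (1 / 2) ^ (6 * B)) ^ (B ^ 3) ≤ (1 / 2) ^ (4 * B) := by
    refine (pow_le_pow_left₀ zero_le h2 _).trans (one_sub_inv_pow_le (by omega) ?_)
    calc 2 * Q * (4 * B) ≤ 2 * B * (4 * B) := by gcongr
      _ = 8 * B ^ 2 := by ring
      _ ≤ B * B ^ 2 := by gcongr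
      _ = _ := by ring
  have hB1 : ∀ k, (B : ℝ≥0∞) * (1 / 2) ^ (B + k) ≤ (1 / 2) ^ k := natCast_mul_half_pow_le B
  have hn' : (n : ℝ≥0∞) ≤ B := by exact_mod_cast hn
  have hN' : (N : ℝ≥0∞) ≤ B := by exact_mod_cast hN
  have t1 : (N : ℝ≥0∞) ^ 2 * (1 - ((Q ^ 2 : ℕ) : ℝ≥0∞)⁻¹) ^ (B ^ 4) ≤ (1 / 2) ^ (2 * B) := by
    calc _ ≤ (B : ℝ≥0∞) ^ 2 * (1 / 2) ^ (4 * B) := by gcongr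
      _ = B * (B * (1 / 2) ^ (B + (B + 2 * B))) := by
          rw [show B + (B + 2 * B) = 4 * B by ring]
          ring
      _ ≤ B * (1 / 2) ^ (B + 2 * B) := by gcongr; exact hB1 _
      _ ≤ _ := hB1 _
  have t2 : (n : ℝ≥0∞) * (1 / 2) ^ (6 * B) ≤ (1 / 2) ^ (2 * B) := by
    calc _ ≤ (B : ℝ≥0∞) * (1 / 2) ^ (B + 2 * B) := by
          gcongr ?_ * ?_
          exact half (by omega)
      _ ≤ _ := hB1 _
  have t3 : (n : ℝ≥0∞) * ((B ^ 3 : ℕ) * (1 / 2) ^ (6 * B)) ≤ (1 / 2) ^ (2 * B) := by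
    calc _ ≤ (B : ℝ≥0∞) * ((B ^ 3 : ℕ) * (1 / 2) ^ (6 * B)) := by gcongr
      _ = B * (B * (B * (B * (1 / 2) ^ (B + (B + (B + (B + 2 * B))))))) := by
          rw [show B + (B + (B + (B + 2 * B))) = 6 * B by ring]
          push_cast
          ring
      _ ≤ B * (B * (B * (1 / 2) ^ (B + (B + (B + 2 * B))))) := by gcongr; exact hB1 _
      _ ≤ B * (B * (1 / 2) ^ (B + (B + 2 * B))) := by gcongr; exact hB1 _
      _ ≤ B * (1 / 2) ^ (B + 2 * B) := by gcongr; exact hB1 _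
      _ ≤ _ := hB1 _
  have t4 : (n : ℝ≥0∞) * (1 - (Q : ℝ≥0∞)⁻¹ + (1 / 2) ^ (6 * B)) ^ (B ^ 3) ≤ (1 / 2) ^ (2 * B) := by
    calc _ ≤ (B : ℝ≥0∞) * (1 / 2) ^ (B + 2 * B) := by
          gcongr ?_ * ?_
          exact h3.trans (half (by omega))
      _ ≤ _ := hB1 _
  rw [mul_add, mul_add]
  calc _ ≤ (1 / 2 : ℝ≥0∞) ^ (2 * B) + ((1 / 2) ^ (2 * B) + (1 / 2) ^ (2 * B) +
        ((1 / 2) ^ (2 * B) + (1 / 2) ^ (2 * B))) :=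
        add_le_add t1 (add_le_add (add_le_add t2 t2) (add_le_add t3 t4))
    _ ≤ (8 : ℕ) * (1 / 2) ^ (8 + B) := by
        have : (1 / 2 : ℝ≥0∞) ^ (2 * B) ≤ (1 / 2) ^ (8 + B) := half (by omega)
        calc _ = 5 * (1 / 2 : ℝ≥0∞) ^ (2 * B) := by ring
          _ ≤ (8 : ℕ) * (1 / 2) ^ (8 + B) := by gcongr; norm_num
    _ ≤ (1 / 2) ^ B := natCast_mul_half_pow_le 8 B
    _ ≤ _ := half hκ

theorem mainPart_spec (hs : Splitting φ E χ s n Q σ π) [Nonempty ι] (hn : 0 < n) (hB : 8 ≤ B)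
    (hnB : n ≤ B) {l : ℕ} (hl : 0 < l) (hlB : l ≤ B)
    (hadv : 1 / (l : ℝ) ≤ |level φ χ E.oracle ∅ - level φ χ E.oracle Finset.univ|)
    {S : State R} (hP : Params E n Q B S) :
    failProb (mainPart.run E S) (fun T => T.output = s) ≤
      (Fintype.card ι : ℝ≥0∞) ^ 2 * (1 - ((Q ^ 2 : ℕ) : ℝ≥0∞)⁻¹) ^ (B ^ 4) +
      (n * ((1 / 2) ^ (6 * B) + (1 / 2) ^ (6 * B)) +
        n * ((B ^ 3 : ℕ) * (1 / 2) ^ (6 * B) +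
          (1 - (Q : ℝ≥0∞)⁻¹ + (1 / 2) ^ (6 * B)) ^ (B ^ 3))) := by
  rw [mainPart, run_seq]
  refine failProb_bind_le (splitPhase_spec φ hP hs.card hs.one_lt) fun T _ ⟨hT, j, hj⟩ => ?_
  rw [run_seq]
  exact failProb_bind_le (hybridPhase_spec hs hn hB hnB hl hlB hadv hT hj) fun U _ hU =>
    guessPhase_spec hs hB hU.1 hU.2

theorem card_components_le (hs : Splitting φ E χ s n Q σ π) [Nonempty ι] : Fintype.card ι ≤ n := by
  obtain ⟨j⟩ := ‹Nonempty ι›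
  refine (Finset.card_le_card fun i _ => ?_ : Fintype.card ι ≤ (covered π j n).card).trans
    (Finset.card_image_le.trans (Finset.card_range n).le)
  obtain ⟨k, hk, hi⟩ := hs.trans j i
  exact Finset.mem_image.2 ⟨k, Finset.mem_range.2 hk, hi⟩

/-- The reduction finds the secret in every ring that splits as in `Splitting`, whenever the oracle
distinguishes the unmasked hybrid from the completely masked one. -/
theorem reduction_spec {q f m l κ : ℕ} (hs : Splitting φ E χ s n (q ^ f) σ π) [Nonempty ι]
    (hn : 0 < n) (hm : E.m = m) (hl : 0 < l)
    (hadv : 1 / (l : ℝ) ≤ |level φ χ E.oracle ∅ - level φ χ E.oracle Finset.univ|) :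
    failProb (reduction.run E (State.init [n, q, f, m, l, κ])) (fun T => T.output = s) ≤
      (1 / 2) ^ κ := by
  rw [reduction, run_seq]
  refine failProb_bind_le_of_forall fun T hT => ?_
  rw [run_seq]
  refine failProb_bind_le_of_forall fun U hU => ?_
  have := card_components_le hs
  exact (mainPart_spec hs hn (by omega) (by omega) hl (by omega) hadv
    (params_of_init hm hT hU)).trans (total_failure_le (by omega) (by omega) hs.one_lt (by omega)
      (by omega) (by omega))

/-! ### The running time -/

namespace Program

/-- The number of instructions in the text of a program, loops counting twice. -/
def size : Program → ℕ
  | seq c d => c.size + d.size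
  | ifNatZero _ c d => 1 + (c.size + d.size)
  | ifRingZero _ c d => 1 + (c.size + d.size)
  | loop _ c => 2 + c.size
  | _ => 1

/-- The nesting depth of the loops of a program. -/
def depth : Program → ℕ
  | seq c d => max c.depth d.depth
  | ifNatZero _ c d => max c.depth d.depth
  | ifRingZero _ c d => max c.depth d.depth
  | loop _ c => 1 + c.depth
  | _ => 0

theorem cost_le {c : Program} {ρ : ℕ → ℕ} {Z : ℕ} (hZ : 0 < Z) (h : ∀ r ∈ c.loopRegs, ρ r ≤ Z) :
    c.cost ρ ≤ c.size * Z ^ c.depth := by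
  induction c with
  | seq c d hc hd | ifNatZero _ c d hc hd | ifRingZero _ c d hc hd =>
    simp only [loopRegs, List.mem_append] at h
    have h1 := hc fun r hr => h r (.inl hr)
    have h2 := hd fun r hr => h r (.inr hr)
    have h3 : Z ^ c.depth ≤ Z ^ max c.depth d.depth := Nat.pow_le_pow_right hZ (le_max_left _ _)
    have h4 : Z ^ d.depth ≤ Z ^ max c.depth d.depth := Nat.pow_le_pow_right hZ (le_max_right _ _)
    have h5 : 1 ≤ Z ^ max c.depth d.depth := Nat.one_le_pow _ _ hZ
    have h6 := Nat.mul_le_mul_left c.size h3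
    have h7 := Nat.mul_le_mul_left d.size h4
    simp only [cost, size, depth, add_mul, one_mul]
    omega
  | loop x c hc =>
    simp only [loopRegs, List.mem_cons] at h
    have h1 := hc fun r hr => h r (.inr hr)
    have h2 := h x (.inl rfl)
    have h3 : 1 ≤ Z ^ c.depth := Nat.one_le_pow _ _ hZ
    simp only [cost, size, depth]
    calc 1 + ρ x * (1 + c.cost ρ) ≤ Z * Z ^ c.depth + Z * (Z ^ c.depth + c.size * Z ^ c.depth) := by
          gcongr
          exact Nat.mul_pos hZ h3
      _ = _ := by ring
  | _ => simp [cost, size, depth]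

end Program

/-- No loop register of the program ever exceeds `(9 * X) ^ 9` for the sum `X` of the parameters,
since `B ≤ 9 * X`. -/
theorem reduction_steps {n q f m l κ : ℕ} (hq : 1 < q) (hf0 : f ≠ 0) (hm : E.m = m) {T : State R}
    (hT : T ∈ (reduction.run E (State.init [n, q, f, m, l, κ])).support) :
    T.steps ≤ reduction.size * ((9 * (n + q ^ f + m + l + κ)) ^ 9) ^ reduction.depth := by
  set X := n + q ^ f + m + l + κ
  set Z := (9 * X) ^ 9
  have hf : f < q ^ f := Nat.lt_pow_self hq
  have hX : 9 * X ≤ Z := Nat.le_self_pow (by norm_num) _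
  have hZ : 0 < Z := by omega
  rw [reduction, run_seq, PMF.mem_support_bind_iff] at hT
  obtain ⟨U, hU, hT⟩ := hT
  rw [run_seq, PMF.mem_support_bind_iff] at hT
  obtain ⟨V, hV, hT⟩ := hT
  have hP := params_of_init hm hU hV
  obtain ⟨-, -, c3, c4, c5, c6, c7, -⟩ := cardBlock_run rfl hU
  change U.nat rBase = 8 + n + q ^ f + l + κ at c3
  have hB : (8 + n + q ^ f + l + κ) ^ 9 ≤ Z := Nat.pow_le_pow_left (by omega) 9
  have hB' : ∀ k ≤ 9, (8 + n + q ^ f + l + κ) ^ k ≤ Z := fun k hk =>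
    (Nat.pow_le_pow_right (by omega) hk).trans hB
  have hm' : V.nat rSamples = m := hP.samples.trans hm
  have h1 := steps_le (c := cardBlock) E (State.init (R := R) [n, q, f, m, l, κ]).nat (by decide)
    (fun _ _ => rfl) hU
  have h2 := steps_le (c := countBlock) E U.nat (by decide) (fun _ _ => rfl) hV
  have h3 := steps_le (c := mainPart) E V.nat (by decide) (fun _ _ => rfl) hT
  have hqf : ∀ r ∈ cardBlock.loopRegs, (State.init (R := R) [n, q, f, m, l, κ]).nat r ≤ Z := by
    intro r hr
    have : r = rPrime ∨ r = rInertia := by revert r; decide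
    rcases this with rfl | rfl
    · change q ≤ Z
      have := Nat.le_self_pow hf0 q
      omega
    · change f ≤ Z
      omega
  have g1 := cost_le hZ hqf
  have g2 : countBlock.cost U.nat ≤ _ := cost_le hZ fun r hr => by
    have : r = rBase ∨ r = rFour ∨ r = rThree ∨ r = rSix ∨ r = rNine := by revert r; decide
    rcases this with rfl | rfl | rfl | rfl | rfl <;> omega
  have g3 : mainPart.cost V.nat ≤ _ := cost_le hZ fun r hr => by
    have : r = rSamples ∨ r = rDeg ∨ r = rCardPred ∨ r = rDegPred ∨ r = rSplits ∨
      r = rGuesses ∨ r = rTrials := by revert r; decide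
    rcases this with rfl | rfl | rfl | rfl | rfl | rfl | rfl
    · omega
    · rw [hP.deg]
      omega
    · rw [hP.cardPred]
      omega
    · rw [hP.degPred]
      omega
    · rw [hP.splits]
      exact hB' 4 (by norm_num)
    · rw [hP.guesses]
      exact hB' 3 (by norm_num)
    · rw [hP.trials]
      exact hB
  have d1 : Z ^ cardBlock.depth ≤ Z ^ reduction.depth := Nat.pow_le_pow_right hZ (by decide)
  have d2 : Z ^ countBlock.depth ≤ Z ^ reduction.depth := Nat.pow_le_pow_right hZ (by decide)
  have d3 : Z ^ mainPart.depth ≤ Z ^ reduction.depth := Nat.pow_le_pow_right hZ (by decide)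
  have e1 := Nat.mul_le_mul_left cardBlock.size d1
  have e2 := Nat.mul_le_mul_left countBlock.size d2
  have e3 := Nat.mul_le_mul_left mainPart.size d3
  have hsize : reduction.size = cardBlock.size + (countBlock.size + mainPart.size) := rfl
  rw [hsize, add_mul, add_mul]
  change T.steps ≤ _
  have h0 : (State.init (R := R) [n, q, f, m, l, κ]).steps = 0 := rfl
  omega

end Total

end Reduction

/-! ### Residue fields of an unramified prime in a Galois number field -/

section NumberField

open NumberField UniqueFactorizationMonoid
open scoped Pointwise

section Primes

variable (K : Type*) [Field K] [NumberField K] (q : ℕ) [hq : Fact q.Prime]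

/-- The primes of `𝓞 K` above `q`. -/
abbrev PrimesAbove : Type _ := (Ideal.span {(q : ℤ)}).primesOver (𝓞 K)

variable {K q}

theorem isMaximal_span_int : (Ideal.span {(q : ℤ)}).IsMaximal :=
  Int.ideal_span_isMaximal_of_prime q

theorem PrimesAbove.ne_bot (P : PrimesAbove K q) : P.1 ≠ ⊥ := by
  have := P.2.2
  refine Ideal.ne_bot_of_liesOver_of_ne_bot (p := Ideal.span {(q : ℤ)}) ?_ P.1
  simpa using hq.out.ne_zero

instance PrimesAbove.isMaximal (P : PrimesAbove K q) : P.1.IsMaximal :=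
  P.2.1.isMaximal P.ne_bot

instance PrimesAbove.finite_quotient (P : PrimesAbove K q) : Finite (𝓞 K ⧸ P.1) :=
  Ideal.finiteQuotientOfFreeOfNeBot _ P.ne_bot

noncomputable instance (P : PrimesAbove K q) : Field (𝓞 K ⧸ P.1) := Ideal.Quotient.field _

noncomputable instance (P : PrimesAbove K q) : Fintype (𝓞 K ⧸ P.1) := Fintype.ofFinite _

omit [NumberField K] hq in
theorem map_span_int : (Ideal.span {(q : ℤ)}).map (algebraMap ℤ (𝓞 K)) =
    Ideal.span {(q : 𝓞 K)} := by
  simp [Ideal.map_span]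

theorem span_natCast_ne_bot : Ideal.span {(q : 𝓞 K)} ≠ ⊥ := by
  rw [Ne, Ideal.span_singleton_eq_bot]
  exact_mod_cast hq.out.ne_zero

omit [NumberField K] hq in
theorem PrimesAbove.span_le (P : PrimesAbove K q) : Ideal.span {(q : 𝓞 K)} ≤ P.1 := by
  have := P.2.2
  rw [← map_span_int, Ideal.map_le_iff_le_comap]
  exact (Ideal.over_def P.1 (Ideal.span {(q : ℤ)})).le

omit [NumberField K] in
theorem liesOver_of_span_le {P : Ideal (𝓞 K)} (hP : P.IsPrime)
    (h : Ideal.span {(q : 𝓞 K)} ≤ P) : P.LiesOver (Ideal.span {(q : ℤ)}) := by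
  refine ⟨isMaximal_span_int.eq_of_le (Ideal.IsPrime.ne_top (hP.under ℤ)) ?_⟩
  rw [← map_span_int, Ideal.map_le_iff_le_comap] at h
  exact h

/-- An unramified prime generates the intersection of the primes above it: its normalized factors
are distinct, so an element divisible by each of them is divisible by their product. -/
theorem span_eq_iInf (h : Unramified K q) :
    Ideal.span {(q : 𝓞 K)} = ⨅ P : PrimesAbove K q, P.1 := by
  classical
  refine le_antisymm (le_iInf fun P => P.span_le) fun x hx => ?_
  rcases eq_or_ne x 0 with rfl | hx0
  · exact zero_mem _
  rw [Ideal.mem_iInf] at hx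
  have hx0' : Ideal.span {x} ≠ (⊥ : Ideal (𝓞 K)) := by simpa using hx0
  rw [← Ideal.span_singleton_le_iff_mem, ← Ideal.dvd_iff_le,
    dvd_iff_normalizedFactors_le_normalizedFactors span_natCast_ne_bot hx0', Multiset.le_iff_count]
  intro P
  by_cases hP : P ∈ normalizedFactors (Ideal.span {(q : 𝓞 K)})
  · have hprime : P.IsPrime := Ideal.isPrime_of_prime (prime_of_normalized_factor P hP)
    have hle := Ideal.le_of_dvd (dvd_of_mem_normalizedFactors hP)
    have hover := liesOver_of_span_le hprime hle
    let P' : PrimesAbove K q := ⟨P, hprime, hover⟩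
    have h1 := h P P'.2
    rw [← Ideal.ramificationIdx'_eq_ramificationIdx (Ideal.span {(q : ℤ)}) P
        (by simpa using hq.out.ne_zero),
      Ideal.IsDedekindDomain.ramificationIdx'_eq_normalizedFactors_count
        (by rw [map_span_int]; exact span_natCast_ne_bot) hprime P'.ne_bot, map_span_int] at h1
    rw [h1, Multiset.one_le_count_iff_mem, Ideal.mem_normalizedFactors_iff hx0']
    exact ⟨hprime, (Ideal.span_singleton_le_iff_mem _).2 (hx P')⟩
  · rw [Multiset.count_eq_zero_of_notMem hP]
    exact Nat.zero_le _

/-- The decomposition of `R_q` as the product of the residue fields of the primes above `q`. -/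
noncomputable def toResidues (h : Unramified K q) : Rq K q ≃+* ∀ P : PrimesAbove K q, 𝓞 K ⧸ P.1 :=
  (Ideal.quotEquivOfEq (span_eq_iInf h)).trans
    (Ideal.quotientInfRingEquivPiQuotient (fun P : PrimesAbove K q => P.1) fun _ _ hne =>
      Ideal.isCoprime_of_isMaximal fun e => hne (Subtype.ext e))

theorem toResidues_mk (h : Unramified K q) (x : 𝓞 K) (P : PrimesAbove K q) :
    toResidues h (Ideal.Quotient.mk _ x) P = Ideal.Quotient.mk P.1 x := rfl

theorem card_residue [IsGalois ℚ K] (P : PrimesAbove K q) :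
    Fintype.card (𝓞 K ⧸ P.1) = q ^ (Ideal.span {(q : ℤ)}).inertiaDegIn (𝓞 K) := by
  have := P.2.2
  have := isMaximal_span_int (q := q)
  rw [Ideal.inertiaDegIn_eq_inertiaDeg _ P.1 Gal(K/ℚ), ← Ideal.inertiaDeg'_eq_inertiaDeg
    (Ideal.span {(q : ℤ)}), ← Ideal.absNorm_eq_pow_inertiaDeg' P.1 hq.out, Ideal.absNorm_apply,
    Submodule.cardQuot_apply, Nat.card_eq_fintype_card]

/-! ### The Galois action on residues and on errors -/

omit hq in
theorem galRq_mk (g : Gal(K/ℚ)) (x : 𝓞 K) :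
    galRq K q g (Ideal.Quotient.mk _ x) = Ideal.Quotient.mk _ (g • x) := rfl

omit hq in
theorem galRq_one (x : Rq K q) : galRq K q 1 x = x := by
  obtain ⟨x, rfl⟩ := Ideal.Quotient.mk_surjective x
  rw [galRq_mk, one_smul]

omit hq in
theorem galRq_mul (g h : Gal(K/ℚ)) (x : Rq K q) :
    galRq K q (g * h) x = galRq K q g (galRq K q h x) := by
  obtain ⟨x, rfl⟩ := Ideal.Quotient.mk_surjective x
  simp only [galRq_mk, mul_smul]

omit hq in
theorem galRq_iterate (g : Gal(K/ℚ)) (k : ℕ) (x : Rq K q) :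
    (galRq K q g)^[k] x = galRq K q (g ^ k) x := by
  induction k with
  | zero => simp [galRq_one]
  | succ k ih => rw [Function.iterate_succ_apply', ih, ← galRq_mul, pow_succ']

omit hq in
theorem galRq_bijective (g : Gal(K/ℚ)) : Function.Bijective (galRq K q g) :=
  Function.bijective_iff_has_inverse.2 ⟨galRq K q g⁻¹, fun x => by
    rw [← galRq_mul, inv_mul_cancel, galRq_one], fun x => by
    rw [← galRq_mul, mul_inv_cancel, galRq_one]⟩

/-- The prime `g P` above `q`. -/
noncomputable def PrimesAbove.map (g : Gal(K/ℚ)) (P : PrimesAbove K q) : PrimesAbove K q :=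
  have := P.2.2
  have := P.2.1
  Ideal.primesOver.mk _ (g • P.1)

omit hq in
theorem PrimesAbove.map_val (g : Gal(K/ℚ)) (P : PrimesAbove K q) : (P.map g).1 = g • P.1 := rfl

omit hq in
theorem PrimesAbove.map_inv_map (g : Gal(K/ℚ)) (P : PrimesAbove K q) : (P.map g⁻¹).map g = P :=
  Subtype.ext (by rw [map_val, map_val, smul_inv_smul])

omit hq in
theorem PrimesAbove.map_injective (g : Gal(K/ℚ)) :
    Function.Injective (PrimesAbove.map g : PrimesAbove K q → PrimesAbove K q) := fun _ _ h =>
  Subtype.ext (MulAction.injective g (congrArg Subtype.val h))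

omit hq in
theorem PrimesAbove.exists_map_eq [IsGalois ℚ K] (P P' : PrimesAbove K q) :
    ∃ g : Gal(K/ℚ), P.map g = P' := by
  have := P.2.2
  have := P'.2.2
  obtain ⟨g, hg⟩ := Ideal.exists_smul_eq_of_isGaloisGroup (Ideal.span {(q : ℤ)}) P.1 P'.1 Gal(K/ℚ)
  exact ⟨g, Subtype.ext hg⟩

open scoped Classical in
/-- The residue of `g x` at `g P` is the image of the residue of `x` at `P`; in particular the one is
zero or one if and only if the other is. -/
theorem galRq_indicator (h : Unramified K q) (g : Gal(K/ℚ)) (P : PrimesAbove K q) :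
    galRq K q g (indicator (toResidues h) {P}) = indicator (toResidues h) {P.map g} := by
  obtain ⟨x, hx⟩ := Ideal.Quotient.mk_surjective (indicator (toResidues h) {P})
  rw [← hx, galRq_mk]
  refine (toResidues h).injective (funext fun P' => ?_)
  have h1 : ∀ P₁ P₂ : PrimesAbove K q, toResidues h (indicator (toResidues h) {P₁}) P₂ =
      if P₂ = P₁ then 1 else 0 := fun P₁ P₂ => by simp [indicator]
  obtain ⟨P'', rfl⟩ : ∃ P'', PrimesAbove.map g P'' = P' := ⟨_, P'.map_inv_map g⟩
  have h2 := h1 P P''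
  rw [← hx, toResidues_mk] at h2
  rw [h1, toResidues_mk]
  simp only [(PrimesAbove.map_injective g).eq_iff]
  split_ifs at h2 ⊢ with he
  · rw [← map_one (Ideal.Quotient.mk P''.1), Ideal.Quotient.eq] at h2
    rw [← map_one (Ideal.Quotient.mk (P''.map g).1), Ideal.Quotient.eq, PrimesAbove.map_val,
      ← smul_one g, ← smul_sub, Ideal.smul_mem_pointwise_smul_iff]
    exact h2
  · rw [Ideal.Quotient.eq_zero_iff_mem] at h2 ⊢
    rw [PrimesAbove.map_val, Ideal.smul_mem_pointwise_smul_iff]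
    exact h2

end Primes

section Errors

variable {K : Type*} [Field K] [NumberField K]

open scoped Classical in
/-- The factors `√2` give each complex place the weight `2`, as in `InfinitePlace.mult`. -/
theorem norm_adjustedEmbedding_sq (x : K) :
    ‖adjustedEmbedding K x‖ ^ 2 = ∑ w : InfinitePlace K, (w.mult : ℝ) * w x ^ 2 := by
  have hr : ∀ w : {w : InfinitePlace K // w.IsReal},
      ‖(w.1.embedding x).re‖ ^ 2 = (w.1.mult : ℝ) * w.1 x ^ 2 := fun w => by
    rw [← InfinitePlace.embedding_of_isReal_apply w.2 x, Complex.ofReal_re,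
      InfinitePlace.norm_embedding_of_isReal, InfinitePlace.mult_isReal, Nat.cast_one, one_mul]
  have hc : ∀ w : {w : InfinitePlace K // w.IsComplex},
      ∑ j : Fin 2, ‖Real.sqrt 2 * ![(w.1.embedding x).re, (w.1.embedding x).im] j‖ ^ 2 =
        (w.1.mult : ℝ) * w.1 x ^ 2 := fun w => by
    rw [← InfinitePlace.norm_embedding_eq w.1 x, ← Complex.normSq_eq_norm_sq,
      Complex.normSq_apply, Fin.sum_univ_two, InfinitePlace.mult_isComplex]
    simp only [Real.norm_eq_abs, sq_abs, mul_pow, Real.sq_sqrt (show (0 : ℝ) ≤ 2 by norm_num),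
      Matrix.cons_val_zero, Matrix.cons_val_one, Nat.cast_ofNat]
    ring
  rw [EuclideanSpace.norm_sq_eq, Fintype.sum_sum_type, Fintype.sum_prod_type]
  simp only [adjustedEmbedding, Sum.elim_inl, Sum.elim_inr, hr, hc]
  rw [← Fintype.sum_subtype_add_sum_subtype (fun w : InfinitePlace K => w.IsReal)]
  congr 1
  exact Fintype.sum_equiv (Equiv.subtypeEquivRight fun w =>
    InfinitePlace.not_isReal_iff_isComplex.symm) _ _ fun w => rfl

open scoped Classical in
theorem norm_adjustedEmbedding_smul (g : Gal(K/ℚ)) (x : K) :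
    ‖adjustedEmbedding K (g x)‖ ^ 2 = ‖adjustedEmbedding K x‖ ^ 2 := by
  rw [norm_adjustedEmbedding_sq, norm_adjustedEmbedding_sq]
  refine Fintype.sum_equiv (MulAction.toPerm g⁻¹) _ _ fun w => ?_
  rw [MulAction.toPerm_apply, InfinitePlace.smul_apply]
  congr 2
  simp only [InfinitePlace.mult, InfinitePlace.isReal_smul_iff]

/-- The error distribution is invariant under automorphisms, since they permute the infinite places
of `K` and thereby preserve the norm of the adjusted canonical embedding. -/
theorem errorDist_map_smul {σ : ℝ} (hσ : 0 < σ) (g : Gal(K/ℚ)) :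
    (errorDist K σ hσ).map (fun x => g • x) = errorDist K σ hσ := by
  classical
  ext y
  rw [PMF.map_apply, tsum_eq_single (g⁻¹ • y)]
  · rw [if_pos (smul_inv_smul g y).symm, errorDist, PMF.normalize_apply, PMF.normalize_apply]
    have h : gaussian σ (adjustedEmbedding K ((g⁻¹ • y : 𝓞 K) : K)) =
        gaussian σ (adjustedEmbedding K (y : K)) := by
      rw [gaussian, gaussian, ← norm_adjustedEmbedding_smul g⁻¹ (y : K)]
      rfl
    rw [h]
  · intro x hx
    exact if_neg fun h => hx (by rw [h, inv_smul_smul])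

end Errors

/-! ### The oracle of a number field -/

section Instance

variable {K : Type*} [Field K] [NumberField K] [IsGalois ℚ K] {q : ℕ} [hq : Fact q.Prime]
  {σ : ℝ} (hσ : 0 < σ)

variable (K q) in
/-- The error distribution, reduced modulo `q`. -/
noncomputable def reducedError : PMF (Rq K q) :=
  (errorDist K σ hσ).map (Ideal.Quotient.mk _)

omit [IsGalois ℚ K] in
theorem rlweDist_eq_lwe (s : Rq K q) : rlweDist K q σ hσ s = lwe (reducedError K q hσ) s := by
  simp only [rlweDist, lwe, reducedError, PMF.map_comp]
  rfl

omit [IsGalois ℚ K] hq in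
theorem reducedError_map_galRq (g : Gal(K/ℚ)) :
    (reducedError K q hσ).map (galRq K q g) = reducedError K q hσ := by
  have h : galRq K q g ∘ Ideal.Quotient.mk _ = Ideal.Quotient.mk _ ∘ fun x : 𝓞 K => g • x := rfl
  rw [reducedError, PMF.map_comp, h, ← PMF.map_comp, errorDist_map_smul]

/-- The automorphism with a given number; numbers that are out of range stand for the identity. -/
noncomputable def numbered (τ : Fin (Module.finrank ℚ K) ≃ Gal(K/ℚ)) (k : ℕ) : Gal(K/ℚ) :=
  if hk : k < Module.finrank ℚ K then τ ⟨k, hk⟩ else 1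

open scoped Classical in
theorem splitting_access (h : Unramified K q) (τ : Fin (Module.finrank ℚ K) ≃ Gal(K/ℚ)) {m : ℕ}
    (D : (Fin m → Rq K q × Rq K q) → PMF Bool) (s : Rq K q) :
    Splitting (toResidues h) (access K q σ hσ τ m D s) (reducedError K q hσ) s
      (Module.finrank ℚ K) (q ^ (Ideal.span {(q : ℤ)}).inertiaDegIn (𝓞 K))
      (fun k => galRq K q (numbered τ k)) (fun k => PrimesAbove.map (numbered τ k)) where
  card := card_residue
  one_lt := by
    have := isMaximal_span_int (q := q)
    exact Nat.one_lt_pow (Ideal.inertiaDegIn_ne_zero Gal(K/ℚ)) hq.out.one_lt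
  good k hk :=
    { samples := rlweDist_eq_lwe hσ s
      aut := by
        funext x
        simp [access, numbered, hk]
      bijective := galRq_bijective _
      map := reducedError_map_galRq hσ _ }
  iterate k _ x := by
    rw [galRq_iterate, ← IsGalois.card_aut_eq_finrank ℚ K, pow_card_eq_one', galRq_one]
  perm k _ P := galRq_indicator h _ P
  trans P P' := by
    obtain ⟨g, hg⟩ := P.exists_map_eq P'
    refine ⟨τ.symm g, (τ.symm g).2, ?_⟩
    simpa [numbered] using hg

open scoped Classical in
omit [IsGalois ℚ K] in
/-- RLWE samples are the hybrids with no component masked, and uniform pairs those with all components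
masked. -/
theorem decisionAdvantage_eq (h : Unramified K q) {m : ℕ}
    (D : (Fin m → Rq K q × Rq K q) → PMF Bool) :
    decisionAdvantage K q σ hσ m D =
      |level (toResidues h) (reducedError K q hσ) D ∅ -
        level (toResidues h) (reducedError K q hσ) D Finset.univ| := by
  simp only [decisionAdvantage, level, acceptProb, indicator_empty, indicator_univ, hybrid_zero, hybrid_one,
    rlweDist_eq_lwe, PMF.bind_const]

end Instance

end NumberField

theorem exists_poly_bound (a d : ℕ) :
    ∃ c : ℕ, ∀ X : ℕ, 0 < X → a * ((9 * X) ^ 9) ^ d ≤ c * X ^ c := by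
  refine ⟨a * (9 ^ 9) ^ d + 9 * d, fun X hX => ?_⟩
  rw [mul_pow, mul_pow, ← mul_assoc, ← pow_mul X]
  exact Nat.mul_le_mul (Nat.le_add_right _ _) (Nat.pow_le_pow_right hX (Nat.le_add_left _ _))

end RLWE

theorem mainTheorem2 :
    ∃ (P : RLWE.Program) (c : ℕ),
      ∀ (K : Type*) [Field K] [NumberField K] [IsGalois ℚ K]
        (q : ℕ) [Fact q.Prime] (_ : RLWE.Unramified K q)
        (τ : Fin (Module.finrank ℚ K) ≃ (K ≃ₐ[ℚ] K))
        (σ : ℝ) (hσ : 0 < σ) (m ℓ κ : ℕ)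
        (D : (Fin m → RLWE.Rq K q × RLWE.Rq K q) → PMF Bool),
        0 < ℓ → 1 / (ℓ : ℝ) ≤ RLWE.decisionAdvantage K q σ hσ m D →
        ∀ s : RLWE.Rq K q,
          let n := Module.finrank ℚ K
          let f := (Ideal.span {(q : ℤ)}).inertiaDegIn (𝓞 K)
          let final := P.run (RLWE.access K q σ hσ τ m D s)
            (RLWE.State.init [n, q, f, m, ℓ, κ])
          1 - (1 / 2 : ℝ≥0∞) ^ κ ≤ (final.map RLWE.State.output) s ∧
            ∀ S ∈ final.support, S.steps ≤ c * (n + q ^ f + m + ℓ + κ) ^ c := by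
  classical
  obtain ⟨c, hc⟩ := RLWE.exists_poly_bound RLWE.reduction.size RLWE.reduction.depth
  refine ⟨RLWE.reduction, c, ?_⟩
  intro K _ _ _ q hq h τ σ hσ m ℓ κ D hℓ hadv s n f final
  have := RLWE.isMaximal_span_int (q := q)
  refine ⟨?_, fun S hS => ?_⟩
  · refine le_trans (tsub_le_tsub_left ?_ 1) (RLWE.one_sub_failProb_le_map_apply _ _ _)
    refine RLWE.reduction_spec (RLWE.splitting_access hσ h τ D s) Module.finrank_pos rfl hℓ ?_
    rwa [RLWE.decisionAdvantage_eq hσ h] at hadv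
  · have hX : 0 < n + q ^ f + m + ℓ + κ := by
      have := Module.finrank_pos (R := ℚ) (M := K)
      omega
    exact (RLWE.reduction_steps hq.out.one_lt (Ideal.inertiaDegIn_ne_zero (K ≃ₐ[ℚ] K)) rfl
      hS).trans (hc _ hX)
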